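/- **Conventions.** A CAT(0) cube complex is a nonempty connected, simply connected cube complex whose vertex links are flag. $d$ denotes the combinatorial metric on the vertex set $X^0$, i.e. the path metric of the 1-skeleton, and quasi-isometries are maps between vertex sets for this metric. Halfspaces are sets of vertices: the two components that remain after removing the edges dual to a hyperplane. $\mathcal H(X)$ is the set of halfspaces and $\mathfrak h^*=X^0\setminus\mathfrak h$. A halfspace $\mathfrak h$ is *shallow* if it lies in a bounded neighbourhood of $\mathfrak h^*$, and *deep* otherwise; $X$ is *essential* if all its halfspaces are deep. Halfspaces $\mathfrak h_1,\mathfrak h_2$ are *transverse* if $\mathfrak h_1\cap\mathfrak h_2$, $\mathfrak h_1\cap\mathfrak h_2^*$, $\mathfrak h_1^*\cap\mathfrak h_2$, $\mathfrak h_1^*\cap\mathfrak h_2^*$ are all nonempty; these four sets are then called *quarterspaces*. The quarterspace $\mathfrak h_1\cap\mathfrak h_2$ is *shallow* if it lies in a bounded neighbourhood of $\mathfrak h_1^*\cap\mathfrak h_2^*$, and its *depth* is the least integer $r\ge 0$ such that it lies in the $(r+2)$-neighbourhood of $\mathfrak h_1^*\cap\mathfrak h_2^*$ ($\infty$ if there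 is none). An action on a cube complex is by automorphisms; it is *cocompact* if there are finitely many orbits of cubes. A *pocset* is a poset with an order-reversing involution $A\mapsto A^*$ such that $A$ and $A^*$ are always incomparable; $A,B$ are *transverse* if neither $A$ nor $A^*$ is comparable with $B$, and the pocset has *finite width* if there is a bound on the number of pairwise transverse elements. A *DCC ultrafilter* on it is an upward closed subset containing exactly one of $A,A^*$ for each $A$, and containing no strictly descending infinite chain. The *cubing* of a pocset has the DCC ultrafilters as vertices, an edge joining $\omega_1,\omega_2$ whenever $\omega_1\triangle\omega_2=\{A,A^*\}$ for some $A$, and an $n$-cube for each copy of the 1-skeleton of an $n$-cube. **Theorem.** Let $G$ be a group acting cocompactly on a CAT(0) cube complex $X$, and suppose that no element of $G$ maps a shallow halfspace $\mathfrak h$ of $X$ to its complement $\mathfrak h^*$ (for instance, $X$ is essential, or $G$ acts without inversions in hyperplanes). If $X$ contains a shallow quarterspace, then there is a CAT(0) cube complex $Y$ with an action of $G$ such that: 1. $G$ acts cocompactly on $Y$. 2. $Y$ has fewer $G$-orbits of vertices than $X$. 3. There is a $G$-equivariant quasi-isometry $\phi:Y^0\to X^0$. 4. The same $\phi$ maps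 each halfspace of $Y$ to within finite Hausdorff distance of a halfspace of $X$. 5. $Y$ is locally finite if $X$ is locally finite. 6. There is a nonempty $G$-invariant convex subcomplex $X'\subseteq X$ that is essential (necessarily $X'=X$ if $X$ is essential) such that $Y$ is $G$-equivariantly isomorphic to the cubing of the following pocset. On $\mathcal H(X')$ write $\mathfrak h_1\le\mathfrak h_2$ if $\mathfrak h_1\subseteq\mathfrak h_2$ or $\mathfrak h_1\cap\mathfrak h_2^*$ is a quarterspace of depth $0$ in $X'$; this is a quasi-order. Write $\mathfrak h_1\sim\mathfrak h_2$ if $\mathfrak h_1\le\mathfrak h_2\le\mathfrak h_1$. Then $\mathcal H(X')/{\sim}$, with the induced order and the involution $[\mathfrak h]^*=[\mathfrak h^*]$, is a pocset of finite width. -/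

import Mathlib

open scoped Pointwise

universe u v

/-! ### Cube complexes -/

/-- A subset of the vertex set of the combinatorial `n`-cube is a face if it is obtained by fixing
the values of some of the coordinates. -/
def IsCubeFace {n : ℕ} (F : Set (Fin n → Bool)) : Prop :=
  ∃ a : Fin n → Option Bool, F = {x | ∀ i b, a i = some b → x i = b}

/-- A cubical complex with vertex set `V`. Each (finite dimensional) cube is recorded by its set of
vertices. Every vertex is a cube, every cube is a combinatorial `n`-cube whose subcubes are exactly
its faces, and two cubes that meet do so in a cube (which is then a common face). -/
structure CubeComplex (V : Type u) where
  cubes : Set (Set V)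
  singleton_mem : ∀ v : V, {v} ∈ cubes
  exists_chart : ∀ C ∈ cubes, ∃ (n : ℕ) (f : (Fin n → Bool) → V),
    Function.Injective f ∧ Set.range f = C ∧
      ∀ D ⊆ C, D ∈ cubes ↔ ∃ F : Set (Fin n → Bool), IsCubeFace F ∧ D = f '' F
  inter_mem : ∀ C ∈ cubes, ∀ D ∈ cubes, (C ∩ D).Nonempty → C ∩ D ∈ cubes

namespace CubeComplex

variable {V : Type u} (X : CubeComplex V)

/-- The 1-skeleton. -/
def graph : SimpleGraph V where
  Adj a b := a ≠ b ∧ ({a, b} : Set V) ∈ X.cubes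
  symm := ⟨fun a b h => ⟨h.1.symm, by rw [Set.pair_comm]; exact h.2⟩⟩
  loopless := ⟨fun _ h => h.1 rfl⟩

/-- Homotopy of edge paths relative to their endpoints: the equivalence relation generated by
removing backtracks and by pushing a path across a square with vertices `a, b, d, c`. -/
inductive PathHomotopic : ∀ {x y : V}, X.graph.Walk x y → X.graph.Walk x y → Prop
  | refl {x y : V} (p : X.graph.Walk x y) : PathHomotopic p p
  | symm {x y : V} {p q : X.graph.Walk x y} : PathHomotopic p q → PathHomotopic q p
  | trans {x y : V} {p q r : X.graph.Walk x y} :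
      PathHomotopic p q → PathHomotopic q r → PathHomotopic p r
  | backtrack {x y a b : V} (p : X.graph.Walk x a) (h : X.graph.Adj a b) (q : X.graph.Walk a y) :
      PathHomotopic (p.append (.cons h (.cons h.symm q))) (p.append q)
  | square {x y a b c d : V} (p : X.graph.Walk x a)
      (hab : X.graph.Adj a b) (hbd : X.graph.Adj b d)
      (hac : X.graph.Adj a c) (hcd : X.graph.Adj c d)
      (hsq : ({a, b, c, d} : Set V) ∈ X.cubes) (q : X.graph.Walk d y) :
      PathHomotopic (p.append (.cons hab (.cons hbd q))) (p.append (.cons hac (.cons hcd q)))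

/-- The links are flag simplicial complexes: finitely many edges at a vertex that pairwise span
squares together span a cube. -/
def HasFlagLinks : Prop :=
  ∀ (x : V) (S : Finset V), (∀ a ∈ S, X.graph.Adj x a) →
    (∀ a ∈ S, ∀ b ∈ S, ∃ C ∈ X.cubes, x ∈ C ∧ a ∈ C ∧ b ∈ C) →
    ∃ C ∈ X.cubes, x ∈ C ∧ ∀ a ∈ S, a ∈ C

/-- A CAT(0) cube complex: nonempty, connected, simply connected, and with flag links. -/
structure IsCAT0 : Prop where
  connected : X.graph.Connected
  simplyConnected : ∀ {x y : V} (p q : X.graph.Walk x y), X.PathHomotopic p q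
  flagLinks : X.HasFlagLinks

/-- Every vertex lies in only finitely many cubes. -/
def IsLocallyFinite : Prop := ∀ x : V, {C ∈ X.cubes | x ∈ C}.Finite

/-! ### Halfspaces and quarterspaces -/

/-- Two edges are opposite edges of some square (or equal). -/
def OppositeEdges (e f : Sym2 V) : Prop :=
  ∃ a b c d : V, e = s(a, b) ∧ f = s(c, d) ∧ X.graph.Adj a b ∧ X.graph.Adj c d ∧
    X.graph.Adj a c ∧ X.graph.Adj b d ∧ ({a, b, c, d} : Set V) ∈ X.cubes

/-- The edges dual to the hyperplane that crosses the edge `e`. -/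
def dualEdges (e : Sym2 V) : Set (Sym2 V) := {f | Relation.EqvGen X.OppositeEdges e f}

/-- Halfspaces are combinatorial, i.e. sets of vertices: `h` and its complement are the vertex sets
of the two components left when all the edges dual to a hyperplane are removed. -/
def IsHalfspace (h : Set V) : Prop :=
  ∃ e ∈ X.graph.edgeSet, ∃ c c' : (X.graph.deleteEdges (X.dualEdges e)).ConnectedComponent,
    h = c.supp ∧ hᶜ = c'.supp

/-- The closed `r`-neighbourhood of a set of vertices in the combinatorial metric. -/
def nbhd (r : ℕ) (A : Set V) : Set V := {x | ∃ a ∈ A, X.graph.edist x a ≤ r}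

def HalfspaceShallow (h : Set V) : Prop := ∃ r : ℕ, h ⊆ X.nbhd r hᶜ

/-- All halfspaces are deep. -/
def IsEssential : Prop := ∀ h, X.IsHalfspace h → ¬ X.HalfspaceShallow h

/-- The halfspaces `h`, `k` are transverse, so that `h ∩ k` is a quarterspace. -/
def Transverse (h k : Set V) : Prop :=
  (h ∩ k).Nonempty ∧ (h ∩ kᶜ).Nonempty ∧ (hᶜ ∩ k).Nonempty ∧ (hᶜ ∩ kᶜ).Nonempty

/-- The quarterspace `h ∩ k` lies in a bounded neighbourhood of the opposite quarterspace. -/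
def QuarterspaceShallow (h k : Set V) : Prop := ∃ r : ℕ, h ∩ k ⊆ X.nbhd r (hᶜ ∩ kᶜ)

/-- `X` contains a shallow quarterspace. -/
def HasShallowQuarterspace : Prop :=
  ∃ h k, X.IsHalfspace h ∧ X.IsHalfspace k ∧ Transverse h k ∧ X.QuarterspaceShallow h k

/-- The depth of the quarterspace `h ∩ k`: the least `r` such that `h ∩ k` lies in the
`(r + 2)`-neighbourhood of the opposite quarterspace, and `⊤` if there is none. -/
noncomputable def depth (h k : Set V) : ℕ∞ :=
  ⨅ r ∈ {r : ℕ | h ∩ k ⊆ X.nbhd (r + 2) (hᶜ ∩ kᶜ)}, (r : ℕ∞)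

/-! ### Group actions, convex subcomplexes, quasi-isometries -/

section Action

variable (G : Type v) [Group G] [MulAction G V]

/-- The action of `G` on the vertices is by automorphisms of the cube complex. -/
def ActsOn : Prop := ∀ g : G, ∀ C ∈ X.cubes, g • C ∈ X.cubes

/-- Finitely many `G`-orbits of cubes. -/
def Cocompact : Prop :=
  ∃ F ⊆ X.cubes, F.Finite ∧ ∀ C ∈ X.cubes, ∃ D ∈ F, ∃ g : G, g • D = C

/-- No element of `G` maps a shallow halfspace to the complementary halfspace. -/
def NoShallowInversions : Prop :=
  ∀ h, X.IsHalfspace h → X.HalfspaceShallow h → ∀ g : G, g • h ≠ hᶜ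

end Action

/-- A set of vertices that is convex in the 1-skeleton. -/
def IsConvex (S : Set V) : Prop :=
  ∀ x ∈ S, ∀ y ∈ S, ∀ z : V,
    X.graph.edist x z + X.graph.edist z y = X.graph.edist x y → z ∈ S

/-- The full subcomplex on a set of vertices. -/
def induce (S : Set V) : CubeComplex S where
  cubes := {C | Subtype.val '' C ∈ X.cubes}
  singleton_mem v := by
    simpa only [Set.mem_ofPred_eq, Set.image_singleton] using X.singleton_mem v.1
  exists_chart C hC := by
    obtain ⟨n, f, hf, hr, hD⟩ := X.exists_chart _ hC
    have hS : ∀ x, f x ∈ S := fun x => by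
      have hx : f x ∈ Subtype.val '' C := hr ▸ Set.mem_range_self x
      obtain ⟨c, -, hc⟩ := hx
      exact hc ▸ c.2
    have himg : ∀ F : Set (Fin n → Bool),
        Subtype.val '' ((fun x => (⟨f x, hS x⟩ : S)) '' F) = f '' F := fun F => by
      rw [Set.image_image]
    have hinj := Set.image_injective.2 (Subtype.val_injective (p := fun x => x ∈ S))
    refine ⟨n, fun x => ⟨f x, hS x⟩, fun x y h => hf (congrArg Subtype.val h), ?_, ?_⟩
    · apply hinj
      rw [← Set.image_univ, himg, Set.image_univ, hr]
    · intro D hDC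
      refine (hD _ (Set.image_mono hDC)).trans (exists_congr fun F => and_congr_right fun _ => ?_)
      rw [← himg]
      exact hinj.eq_iff
  inter_mem C hC D hD h := by
    change Subtype.val '' (C ∩ D) ∈ X.cubes
    rw [Set.image_inter Subtype.val_injective]
    refine X.inter_mem _ hC _ hD ?_
    rw [← Set.image_inter Subtype.val_injective]
    exact h.image _

/-- A quasi-isometry between vertex sets with their combinatorial metrics. -/
def IsQuasiIsometry {W : Type u} (Y : CubeComplex W) (φ : W → V) : Prop :=
  ∃ L A : ℝ, 1 ≤ L ∧ 0 ≤ A ∧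
    (∀ y z : W, (Y.graph.dist y z : ℝ) / L - A ≤ (X.graph.dist (φ y) (φ z) : ℝ) ∧
      (X.graph.dist (φ y) (φ z) : ℝ) ≤ L * (Y.graph.dist y z : ℝ) + A) ∧
    ∀ x : V, ∃ y : W, (X.graph.dist x (φ y) : ℝ) ≤ A

/-- `A` and `B` are at finite Hausdorff distance. -/
def FiniteHausdorff (A B : Set V) : Prop := ∃ r : ℕ, A ⊆ X.nbhd r B ∧ B ⊆ X.nbhd r A

end CubeComplex

/-! ### Pocsets and cubings -/

/-- `P` with the relation `le` and the map `star` is a pocset. -/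
structure IsPocset {P : Type u} (le : P → P → Prop) (star : P → P) : Prop where
  refl : ∀ A, le A A
  trans : ∀ A B C, le A B → le B C → le A C
  antisymm : ∀ A B, le A B → le B A → A = B
  star_star : ∀ A, star (star A) = A
  incomparable : ∀ A, ¬ le A (star A) ∧ ¬ le (star A) A
  star_anti : ∀ A B, le A B → le (star B) (star A)

namespace Pocset

variable {P : Type u} (le : P → P → Prop) (star : P → P)

/-- Neither `A` nor `star A` is comparable with `B`. -/
def Transverse (A B : P) : Prop :=
  ¬ le A B ∧ ¬ le B A ∧ ¬ le (star A) B ∧ ¬ le B (star A)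

/-- There is a bound on the number of pairwise transverse elements. -/
def FiniteWidth : Prop :=
  ∃ n : ℕ, ∀ T : Finset P, (∀ A ∈ T, ∀ B ∈ T, A ≠ B → Transverse le star A B) → T.card ≤ n

/-- Ultrafilters that contain no strictly descending infinite chain. -/
structure IsDCCUltrafilter (ω : Set P) : Prop where
  complete : ∀ A, Xor (A ∈ ω) (star A ∈ ω)
  consistent : ∀ A B, A ∈ ω → le A B → B ∈ ω
  dcc : ¬ ∃ A : ℕ → P, ∀ n, A n ∈ ω ∧ le (A (n + 1)) (A n) ∧ A (n + 1) ≠ A n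

/-- The vertices of the cubing. -/
abbrev CubingVertex := {ω : Set P // IsDCCUltrafilter le star ω}

/-- The 1-skeleton of the cubing. -/
def cubingGraph : SimpleGraph (CubingVertex le star) where
  Adj ω ω' := ∃ A : P, symmDiff ω.1 ω'.1 = {A, star A}
  symm := ⟨fun ω ω' ⟨A, hA⟩ => ⟨A, by rw [symmDiff_comm]; exact hA⟩⟩
  loopless := ⟨fun ω ⟨A, hA⟩ => by
    rw [symmDiff_self] at hA
    have hmem : A ∈ (⊥ : Set P) := hA ▸ Set.mem_insert A _
    exact hmem⟩

/-- The 1-skeleton of the `n`-cube: vertices are adjacent if they differ in one coordinate. -/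
def cubeGraph (n : ℕ) : SimpleGraph (Fin n → Bool) where
  Adj x y := hammingDist x y = 1
  symm := ⟨fun x y h => by rw [hammingDist_comm]; exact h⟩
  loopless := ⟨fun x h => by simp at h⟩

/-- The cubes of the cubing: an `n`-cube is attached to every copy of the 1-skeleton of an `n`-cube
in the 1-skeleton of the cubing. -/
def IsCubingCube (K : Set (CubingVertex le star)) : Prop :=
  ∃ n : ℕ, Nonempty (cubeGraph n ≃g (cubingGraph le star).induce K)

end Pocset

/-! ### The quotient pocset of halfspaces -/

namespace CubeComplex

variable {V : Type u} (X : CubeComplex V)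

/-- The set of halfspaces. -/
abbrev Halfspace := {h : Set V // X.IsHalfspace h}

variable {X}

/-- The complementary halfspace. -/
def Halfspace.star (h : X.Halfspace) : X.Halfspace :=
  ⟨(h.1)ᶜ, by
    obtain ⟨e, he, c, c', h₁, h₂⟩ := h.2
    exact ⟨e, he, c', c, h₂, by rw [compl_compl]; exact h₁⟩⟩

/-- `h ≤ k` if `h ⊆ k` or `h ∩ k*` is a quarterspace of depth 0. -/
def Halfspace.le (h k : X.Halfspace) : Prop :=
  h.1 ⊆ k.1 ∨ (CubeComplex.Transverse h.1 (k.1)ᶜ ∧ X.depth h.1 (k.1)ᶜ = 0)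

/-- `h ∼ k` if `h ≤ k` and `k ≤ h`. -/
def Halfspace.equiv (h k : X.Halfspace) : Prop := Halfspace.le h k ∧ Halfspace.le k h

theorem Halfspace.star_le_star {h k : X.Halfspace} (hk : Halfspace.le h k) :
    Halfspace.le (Halfspace.star k) (Halfspace.star h) := by
  rcases hk with hk | ⟨⟨h1, h2, h3, h4⟩, hd⟩
  · exact Or.inl (Set.compl_subset_compl.2 hk)
  · right
    simp only [Halfspace.star, CubeComplex.Transverse, CubeComplex.depth, compl_compl] at *
    refine ⟨⟨?_, ?_, ?_, ?_⟩, ?_⟩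
    · rwa [Set.inter_comm]
    · rwa [Set.inter_comm]
    · rwa [Set.inter_comm]
    · rwa [Set.inter_comm]
    · rwa [Set.inter_comm (k.1)ᶜ, Set.inter_comm k.1]

variable (X)

/-- The quotient of the set of halfspaces by `∼` (more precisely by the equivalence relation that
`∼` generates, which is `∼` itself when `≤` is a quasi-order). -/
def HalfspaceQuotient := Quot (Halfspace.equiv (X := X))

variable {X}

/-- The relation that `≤` induces on equivalence classes. -/
def HalfspaceQuotient.le (A B : X.HalfspaceQuotient) : Prop :=
  ∃ h k : X.Halfspace, Quot.mk _ h = A ∧ Quot.mk _ k = B ∧ Halfspace.le h k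

/-- The involution `[h]* = [h*]`. -/
def HalfspaceQuotient.star : X.HalfspaceQuotient → X.HalfspaceQuotient :=
  Quot.map Halfspace.star fun _ _ h =>
    ⟨Halfspace.star_le_star h.2, Halfspace.star_le_star h.1⟩

/-- `S` is (the vertex set of) a `G`-invariant convex subcomplex of `X` that is essential. -/
structure IsEssentialCore (X : CubeComplex V) (G : Type v) [Group G] [MulAction G V]
    (S : Set V) : Prop where
  nonempty : S.Nonempty
  invariant : ∀ g : G, g • S = S
  convex : X.IsConvex S
  essential : (X.induce S).IsEssential

/-- `Y` is, `G`-equivariantly, the cubing of the quotient pocset of halfspaces of the full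
subcomplex of `X` on the `G`-invariant set `S`; in particular this quotient is a pocset of finite
width. -/
def IsCubingOfQuotient {W : Type u} (Y : CubeComplex W) (X : CubeComplex V) (S : Set V)
    (G : Type v) [Group G] [MulAction G V] [MulAction G W] : Prop :=
  (∀ h k l : (X.induce S).Halfspace, Halfspace.le h k → Halfspace.le k l → Halfspace.le h l) ∧
  IsPocset (HalfspaceQuotient.le (X := X.induce S)) HalfspaceQuotient.star ∧
  Pocset.FiniteWidth (HalfspaceQuotient.le (X := X.induce S)) HalfspaceQuotient.star ∧
  ∃ e : W ≃ Pocset.CubingVertex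
      (HalfspaceQuotient.le (X := X.induce S)) HalfspaceQuotient.star,
    (∀ C : Set W, C ∈ Y.cubes ↔ Pocset.IsCubingCube _ _ (e '' C)) ∧
    ∀ (g : G) (y : W) (h k : (X.induce S).Halfspace),
      (Subtype.val '' k.1 : Set V) = g • (Subtype.val '' h.1 : Set V) →
      (Quot.mk _ k ∈ (e (g • y)).1 ↔ Quot.mk _ h ∈ (e y).1)

end CubeComplex

/-!
A CAT(0) cube complex is the same thing as a discrete wallspace: a family `H` of halfspaces on the
vertex set such that any two points are separated by finitely many walls and a halfspace that is
minimal at a point can be left by crossing its wall only (`IsWallspace`). The cubes are recovered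
from `H` as the sets of points cut out by finitely many pairwise transverse walls (`IsWallCube`);
a complex obtained in this way is called dual to `H` (`CubeComplex.IsDual`), and its metric counts
walls.

* Complexes dual to a wallspace are CAT(0) with halfspaces `H` (`CubeComplex.IsDual.isCAT0`,
  `CubeComplex.IsDual.isHalfspace_iff`). Conversely, every CAT(0) cube complex is dual to its
  halfspaces (`CubeComplex.IsCAT0.isDual`). This rests on the quadrangle condition for the distance
  from a vertex (`CubeComplex.IsCAT0.quadrangle`). To deduce that from simple connectedness, edge
  paths are considered up to pushing across squares and up to cancellation of backtracks; the flag
  condition makes the cancellation well defined, so that homotopic paths have equivalent reduced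
  forms (`CubeComplex.PathHomotopic.run_eqv`), and geodesics are reduced.

* The essential core is obtained by removing halfspaces. A shallow halfspace of least depth is
  minimal, and as it is not mapped to its complement, those of its translates that contain a given
  point are pairwise transverse. So there are at most `N` of them, where `N` is the dimension, and
  what is left after removing all translates is convex and coarsely dense. Fewer orbits of vertices
  remain, so the procedure stops (`IsWallspace.exists_core`).

* In an essential wallspace let `h ≤ k` if every point of `h \ k` is at distance at most two from
  `k \ h` (`WallLE`). This is the quasi-order of the theorem (`CubeComplex.Halfspace.le_iff`). The
  complex `Y` has as its vertices the points whose halfspaces are upward closed for `≤`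
  (`consistentPoints`), and as its halfspaces the traces of the given ones. Every point lies within
  distance `N` of a consistent one, which can be chosen in prescribed halfspaces as far as `≤`
  allows (`IsWallspace.exists_consistent`). Hence the quasi-order is the inclusion of traces, the
  consistent points form a wallspace (`IsWallspace.consistent`) and are quasi-isometrically embedded,
  and they are the vertices of the cubing of the quotient pocset
  (`CubeComplex.HalfspaceQuotient.pointEquiv`).

* If there is a shallow quarterspace, then one of least depth has depth zero, and its points are not
  consistent (`IsWallspace.consistentPoints_ne_univ`). So orbits of vertices get lost.
-/

/-! ### Squares and 3-cubes -/

namespace CubeComplex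

variable {V : Type u} (X : CubeComplex V)

/-- `a, b, d, c` are the vertices of a nondegenerate square, in this cyclic order. -/
structure Sq (a b c d : V) : Prop where
  ab : X.graph.Adj a b
  ac : X.graph.Adj a c
  bd : X.graph.Adj b d
  cd : X.graph.Adj c d
  ad_ne : a ≠ d
  bc_ne : b ≠ c
  mem : ({a, b, c, d} : Set V) ∈ X.cubes

variable {X}

theorem Sq.swap {a b c d : V} (h : X.Sq a b c d) : X.Sq a c b d :=
  ⟨h.ac, h.ab, h.cd, h.bd, h.ad_ne, h.bc_ne.symm, by
    have := h.mem; rwa [Set.insert_comm b c] at this⟩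

theorem Sq.rev {a b c d : V} (h : X.Sq a b c d) : X.Sq d b c a :=
  ⟨h.bd.symm, h.cd.symm, h.ab.symm, h.ac.symm, h.ad_ne.symm, h.bc_ne, by
    have := h.mem
    have e : ({d, b, c, a} : Set V) = {a, b, c, d} := by
      ext x; simp only [Set.mem_insert_iff, Set.mem_singleton_iff]; tauto
    rwa [e]⟩

theorem Sq.rot {a b c d : V} (h : X.Sq a b c d) : X.Sq b a d c :=
  ⟨h.ab.symm, h.bd, h.ac, h.cd.symm, h.bc_ne, h.ad_ne, by
    have := h.mem
    have e : ({b, a, d, c} : Set V) = {a, b, c, d} := by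
      ext x; simp only [Set.mem_insert_iff, Set.mem_singleton_iff]; tauto
    rwa [e]⟩

theorem ncard_cube {C : Set V} (hC : C ∈ X.cubes) : ∃ n : ℕ, C.ncard = 2 ^ n := by
  obtain ⟨n, f, hf, hr, -⟩ := X.exists_chart C hC
  refine ⟨n, ?_⟩
  rw [← hr, ← Set.image_univ, Set.ncard_image_of_injective _ hf, Set.ncard_univ]
  simp

theorem finite_cube {C : Set V} (hC : C ∈ X.cubes) : C.Finite := by
  obtain ⟨n, f, hf, hr, -⟩ := X.exists_chart C hC
  rw [← hr]; exact Set.finite_range f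

theorem triple_notMem_cubes {a b c : V} (hab : a ≠ b) (hac : a ≠ c) (hbc : b ≠ c) :
    ({a, b, c} : Set V) ∉ X.cubes := by
  intro h
  obtain ⟨n, hn⟩ := ncard_cube h
  rw [Set.ncard_eq_three.2 ⟨a, b, c, hab, hac, hbc, rfl⟩] at hn
  rcases n with _ | _ | n
  · simp at hn
  · simp at hn
  · rw [pow_succ, pow_succ] at hn; omega

/-- Two squares with three common vertices coincide. -/
theorem Sq.unique {a b c d d' : V} (h : X.Sq a b c d) (h' : X.Sq a b c d') : d = d' := by
  have hne : (({a, b, c, d} : Set V) ∩ {a, b, c, d'}).Nonempty := ⟨a, by simp, by simp⟩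
  have hmem := X.inter_mem _ h.mem _ h'.mem hne
  by_contra hdd
  have e : (({a, b, c, d} : Set V) ∩ {a, b, c, d'}) = {a, b, c} := by
    have h1 := h.ad_ne; have h2 := h.bd.1; have h3 := h.cd.1
    ext x; simp only [Set.mem_insert_iff, Set.mem_singleton_iff, Set.mem_inter_iff]
    constructor
    · rintro ⟨rfl | rfl | rfl | rfl, h⟩ <;> simp_all
    · rintro (rfl | rfl | rfl) <;> simp
  rw [e] at hmem
  exact triple_notMem_cubes h.ab.1 h.ac.1 h.bc_ne hmem

end CubeComplex

/-! ### Flips of vertices of the combinatorial cube -/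

/-- Change the `i`-th coordinate. -/
def bflip {n : ℕ} (i : Fin n) (x : Fin n → Bool) : Fin n → Bool := Function.update x i (!x i)

theorem bflip_same {n : ℕ} (i : Fin n) (x : Fin n → Bool) : bflip i x i = !x i := by simp [bflip]

theorem bflip_of_ne {n : ℕ} {i j : Fin n} (h : j ≠ i) (x : Fin n → Bool) : bflip i x j = x j := by
  simp [bflip, h]

theorem bflip_ne {n : ℕ} (i : Fin n) (x : Fin n → Bool) : bflip i x ≠ x := by
  intro h; have := congrFun h i; simp [bflip] at this

theorem bflip_comm {n : ℕ} (i j : Fin n) (x : Fin n → Bool) :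
    bflip i (bflip j x) = bflip j (bflip i x) := by
  by_cases h : i = j
  · rw [h]
  · funext k
    by_cases hi : k = i
    · subst hi; simp [bflip, h]
    · by_cases hj : k = j
      · subst hj; simp [bflip, hi]
      · simp [bflip, hi, hj]

theorem bflip_injective {n : ℕ} {i j : Fin n} {x : Fin n → Bool} (h : bflip i x = bflip j x) :
    i = j := by
  by_contra hne
  have := congrFun h i
  rw [bflip_same, bflip_of_ne hne] at this
  simp at this

/-- Induction along coordinate changes: a property that is preserved by flips and holds at one
vertex of the cube holds at all of them. -/
theorem bflip_induction {n : ℕ} {p : (Fin n → Bool) → Prop} (x : Fin n → Bool) (h0 : p x)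
    (h : ∀ y i, p y → p (bflip i y)) (y : Fin n → Bool) : p y := by
  classical
  have key : ∀ s : Finset (Fin n), p (fun i => if i ∈ s then y i else x i) := by
    intro s
    induction s using Finset.induction_on with
    | empty => simpa using h0
    | insert a s ha ih =>
      by_cases hxy : y a = x a
      · convert ih using 1
        funext i; by_cases hi : i = a
        · subst hi; simp [ha, hxy]
        · simp [hi]
      · convert h _ a ih using 1
        funext i; by_cases hi : i = a
        · subst hi; rw [bflip_same]; simp only [Finset.mem_insert, true_or, if_true, ha, if_false]
          revert hxy; cases y i <;> cases x i <;> simp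
        · rw [bflip_of_ne hi]; simp [hi]
  simpa using key Finset.univ

theorem isCubeFace_pair {n : ℕ} (i : Fin n) (x : Fin n → Bool) :
    IsCubeFace {x, bflip i x} := by
  classical
  refine ⟨fun j => if j = i then none else some (x j), ?_⟩
  ext z
  simp only [Set.mem_insert_iff, Set.mem_singleton_iff, Set.mem_ofPred_eq]
  constructor
  · rintro (rfl | rfl) j b hb <;> by_cases hj : j = i <;> simp_all [bflip_of_ne]
  · intro hz
    have hz' : ∀ j, j ≠ i → z j = x j := fun j hj => hz j (x j) (by simp [hj])
    by_cases hi : z i = x i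
    · left; funext j; by_cases hj : j = i
      · subst hj; exact hi
      · exact hz' j hj
    · right; funext j; by_cases hj : j = i
      · subst hj; rw [bflip_same]; revert hi; cases z j <;> cases x j <;> simp
      · rw [hz' j hj, bflip_of_ne hj]

theorem isCubeFace_square {n : ℕ} {i j : Fin n} (hij : i ≠ j) (x : Fin n → Bool) :
    IsCubeFace {x, bflip i x, bflip j x, bflip i (bflip j x)} := by
  classical
  refine ⟨fun k => if k = i ∨ k = j then none else some (x k), ?_⟩
  ext z
  simp only [Set.mem_insert_iff, Set.mem_singleton_iff, Set.mem_ofPred_eq]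
  constructor
  · rintro (rfl | rfl | rfl | rfl) k b hb <;> by_cases hk : k = i <;> by_cases hk' : k = j <;>
      simp_all [bflip_of_ne]
  · intro hz
    have hz' : ∀ k, k ≠ i → k ≠ j → z k = x k := fun k hk hk' => hz k (x k) (by simp [hk, hk'])
    have key : ∀ w : Fin n → Bool, w i = z i → w j = z j → (∀ k, k ≠ i → k ≠ j → w k = x k) →
        z = w := by
      intro w h1 h2 h3
      funext k
      by_cases hk : k = i
      · rw [hk, h1]
      · by_cases hk' : k = j
        · rw [hk', h2]
        · rw [hz' k hk hk', h3 k hk hk']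
    by_cases hi : z i = x i <;> by_cases hj : z j = x j
    · exact Or.inl (key _ hi.symm hj.symm fun _ _ _ => rfl)
    · refine Or.inr (Or.inr (Or.inl (key _ ?_ ?_ fun k _ hk' => bflip_of_ne hk' x)))
      · rw [bflip_of_ne hij, hi]
      · rw [bflip_same]; revert hj; cases z j <;> cases x j <;> simp
    · refine Or.inr (Or.inl (key _ ?_ ?_ fun k hk _ => bflip_of_ne hk x))
      · rw [bflip_same]; revert hi; cases z i <;> cases x i <;> simp
      · rw [bflip_of_ne hij.symm, hj]
    · refine Or.inr (Or.inr (Or.inr (key _ ?_ ?_ fun k hk hk' => ?_)))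
      · rw [bflip_same, bflip_of_ne hij]; revert hi; cases z i <;> cases x i <;> simp
      · rw [bflip_of_ne hij.symm, bflip_same]; revert hj; cases z j <;> cases x j <;> simp
      · rw [bflip_of_ne hk, bflip_of_ne hk']

/-- A face with exactly two vertices is an edge. -/
theorem IsCubeFace.eq_bflip {n : ℕ} {x y : Fin n → Bool} (hxy : x ≠ y)
    (h : IsCubeFace ({x, y} : Set (Fin n → Bool))) : ∃ i, y = bflip i x := by
  obtain ⟨a, ha⟩ := h
  have hx : x ∈ {x | ∀ i b, a i = some b → x i = b} := ha ▸ Set.mem_insert x _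
  have hy : y ∈ {x | ∀ i b, a i = some b → x i = b} := ha ▸ Set.mem_insert_of_mem x rfl
  obtain ⟨i, hi⟩ := Function.ne_iff.1 hxy
  have hai : a i = none := by
    cases h : a i with
    | none => rfl
    | some b => exact absurd ((hx i b h).trans (hy i b h).symm) hi
  have hm : bflip i x ∈ ({x, y} : Set (Fin n → Bool)) := by
    rw [ha]
    intro j b hb
    have hj : j ≠ i := by rintro rfl; rw [hai] at hb; cases hb
    rw [bflip_of_ne hj]; exact hx j b hb
  rcases hm with hm | hm
  · exact absurd hm (bflip_ne i x)
  · exact ⟨i, hm.symm⟩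

namespace CubeComplex

variable {V : Type u} {X : CubeComplex V}

/-- `f` is a parametrization of the cube `C` by the combinatorial `n`-cube. -/
structure IsChart (X : CubeComplex V) (C : Set V) {n : ℕ} (f : (Fin n → Bool) → V) : Prop where
  inj : Function.Injective f
  range_eq : Set.range f = C
  face : ∀ D ⊆ C, D ∈ X.cubes ↔ ∃ F : Set (Fin n → Bool), IsCubeFace F ∧ D = f '' F

section Chart
variable {C : Set V} {n : ℕ} {f : (Fin n → Bool) → V} (hf : X.IsChart C f)
include hf

theorem IsChart.mem_cubes {F : Set (Fin n → Bool)} (hF : IsCubeFace F) : f '' F ∈ X.cubes :=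
  (hf.face _ (by rw [← hf.range_eq]; exact Set.image_subset_range f F)).2 ⟨F, hF, rfl⟩

theorem IsChart.adj_bflip (x : Fin n → Bool) (i : Fin n) : X.graph.Adj (f x) (f (bflip i x)) := by
  refine ⟨fun h => bflip_ne i x (hf.inj h).symm, ?_⟩
  have := hf.mem_cubes (isCubeFace_pair i x)
  rwa [Set.image_pair] at this

theorem IsChart.sq_bflip (x : Fin n → Bool) {i j : Fin n} (hij : i ≠ j) :
    X.Sq (f x) (f (bflip i x)) (f (bflip j x)) (f (bflip i (bflip j x))) := by
  refine ⟨hf.adj_bflip x i, hf.adj_bflip x j, ?_, hf.adj_bflip _ i, ?_, ?_, ?_⟩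
  · rw [bflip_comm]; exact hf.adj_bflip _ j
  · intro h
    have := congrFun (hf.inj h) i
    rw [bflip_same, bflip_of_ne hij] at this; simp at this
  · intro h; exact hij (bflip_injective (hf.inj h))
  · have := hf.mem_cubes (isCubeFace_square hij x)
    rwa [Set.image_insert_eq, Set.image_insert_eq, Set.image_pair] at this

theorem IsChart.eq_bflip_of_adj {x : Fin n → Bool} {c : V} (hc : c ∈ C)
    (h : X.graph.Adj (f x) c) : ∃ i, c = f (bflip i x) := by
  rw [← hf.range_eq] at hc
  obtain ⟨y, rfl⟩ := hc
  have hsub : ({f x, f y} : Set V) ⊆ C := by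
    rw [← hf.range_eq]; rintro _ (rfl | rfl) <;> exact Set.mem_range_self _
  obtain ⟨F, hF, he⟩ := (hf.face _ hsub).1 h.2
  rw [← Set.image_pair] at he
  rw [← (Set.image_injective.2 hf.inj) he] at hF
  obtain ⟨i, hi⟩ := hF.eq_bflip fun e => h.1 (by rw [e])
  exact ⟨i, by rw [hi]⟩

end Chart

theorem exists_isChart {C : Set V} (hC : C ∈ X.cubes) :
    ∃ (n : ℕ) (f : (Fin n → Bool) → V), X.IsChart C f := by
  obtain ⟨n, f, h1, h2, h3⟩ := X.exists_chart C hC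
  exact ⟨n, f, h1, h2, h3⟩

/-- The flag condition in dimension 3: three squares that pairwise meet along the three edges at a
vertex `d` are the squares at a vertex of a 3-cube; `z` is the vertex opposite to `d`. -/
theorem HasFlagLinks.exists_threeCube (hX : X.HasFlagLinks) {d c c' y a a' t : V}
    (h1 : X.Sq d c y a) (h2 : X.Sq d c' y a') (h3 : X.Sq d c c' t) :
    ∃ z, X.Sq y a a' z ∧ X.Sq c a t z ∧ X.Sq c' a' t z := by
  classical
  obtain ⟨C, hC, hd, hS⟩ := hX d {c, c', y} (by
      simp only [Finset.mem_insert, Finset.mem_singleton]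
      rintro _ (rfl | rfl | rfl)
      exacts [h1.ab, h2.ab, h1.ac]) (by
      have hs : ∀ x, X.graph.Adj d x → ∃ C ∈ X.cubes, d ∈ C ∧ x ∈ C ∧ x ∈ C :=
        fun x hx => ⟨{d, x}, hx.2, by simp, by simp, by simp⟩
      simp only [Finset.mem_insert, Finset.mem_singleton]
      rintro _ (rfl | rfl | rfl) _ (rfl | rfl | rfl)
      exacts [hs _ h1.ab, ⟨_, h3.mem, by simp⟩, ⟨_, h1.mem, by simp⟩,
        ⟨_, h3.mem, by simp⟩, hs _ h2.ab, ⟨_, h2.mem, by simp⟩,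
        ⟨_, h1.mem, by simp⟩, ⟨_, h2.mem, by simp⟩, hs _ h1.ac])
  obtain ⟨n, f, hf⟩ := exists_isChart hC
  have hd' := hd
  rw [← hf.range_eq] at hd'
  obtain ⟨x, rfl⟩ := hd'
  obtain ⟨i, rfl⟩ := hf.eq_bflip_of_adj (hS c (by simp)) h1.ab
  obtain ⟨j, rfl⟩ := hf.eq_bflip_of_adj (hS c' (by simp)) h2.ab
  obtain ⟨k, rfl⟩ := hf.eq_bflip_of_adj (hS y (by simp)) h1.ac
  have hik : i ≠ k := fun h => h1.bc_ne (by rw [h])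
  have hjk : j ≠ k := fun h => h2.bc_ne (by rw [h])
  have hij : i ≠ j := fun h => h3.bc_ne (by rw [h])
  obtain rfl := h1.unique (hf.sq_bflip x hik)
  obtain rfl := h2.unique (hf.sq_bflip x hjk)
  obtain rfl := h3.unique (hf.sq_bflip x hij)
  refine ⟨f (bflip i (bflip j (bflip k x))), hf.sq_bflip _ hij, ?_, ?_⟩
  · have := (hf.sq_bflip (bflip i x) hjk).swap
    rwa [bflip_comm k i, bflip_comm j i, bflip_comm j i] at this
  · have := (hf.sq_bflip (bflip j x) hik).swap
    rw [bflip_comm k j] at this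
    exact this

end CubeComplex

/-! ### Edge paths up to pushing across squares, and the quadrangle condition -/

namespace CubeComplex

variable {V : Type u} (X : CubeComplex V)

/-- Equivalence of edge paths under pushing subpaths of length two across squares. A path is the
list of its vertices, listed from its endpoint back to its starting point. The definition is
recursive in the length: two paths with the same endpoint `y` are equivalent if they agree up to
equivalence before their last edges, or if their last edges are the sides `a, y` and `d, y` of a
square `c, a, y, d` and up to equivalence both paths run through `c`. -/
inductive PathEqv : List V → List V → Prop
  | nil : PathEqv [] []
  | cons (y : V) {p q : List V} : PathEqv p q → PathEqv (y :: p) (y :: q)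
  | square (y : V) {p q r : List V} {a c d : V} : PathEqv p (a :: c :: r) →
      PathEqv q (d :: c :: r) → X.Sq c a d y → PathEqv (y :: p) (y :: q)

variable {X}

namespace PathEqv

theorem refl : ∀ p : List V, X.PathEqv p p
  | [] => nil
  | y :: p => cons y (refl p)

theorem symm {p q : List V} (h : X.PathEqv p q) : X.PathEqv q p := by
  induction h with
  | nil => exact nil
  | cons y _ ih => exact cons y ih
  | square y h1 h2 hs _ _ => exact square y h2 h1 hs.swap

theorem length_eq {p q : List V} (h : X.PathEqv p q) : p.length = q.length := by
  induction h with
  | nil => rfl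
  | cons y _ ih => simp [ih]
  | square y h1 h2 hs ih1 ih2 => simp_all

theorem head_eq {x y : V} {p q : List V} (h : X.PathEqv (x :: p) (y :: q)) : x = y := by
  cases h <;> rfl

theorem exists_cons {y : V} {p q : List V} (h : X.PathEqv (y :: p) q) : ∃ q', q = y :: q' := by
  cases h <;> exact ⟨_, rfl⟩

end PathEqv

/-- Transitivity is where the flag condition enters: three last edges give a 3-cube. -/
theorem PathEqv.trans (hX : X.HasFlagLinks) {p q s : List V} (h1 : X.PathEqv p q)
    (h2 : X.PathEqv q s) : X.PathEqv p s := by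
  suffices H : ∀ n : ℕ, ∀ p q s : List V, p.length = n → X.PathEqv p q → X.PathEqv q s →
      X.PathEqv p s from H _ p q s rfl h1 h2
  clear h1 h2 p q s
  intro n
  induction n using Nat.strong_induction_on with
  | _ n IH =>
    intro p q s hn h1 h2
    have hl1 := h1.length_eq
    have hl2 := h2.length_eq
    cases h1 with
    | nil => exact h2
    | @cons y p q h1 =>
      simp only [List.length_cons] at hn hl1
      cases h2 with
      | cons _ h2 => exact .cons y (IH _ (by omega) _ _ _ rfl h1 h2)
      | square _ h2 h3 hs => exact .square y (IH _ (by omega) _ _ _ rfl h1 h2) h3 hs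
    | @square y p q r a c d ha hd hs =>
      simp only [List.length_cons] at hn hl1
      have la := ha.length_eq
      have ld := hd.length_eq
      simp only [List.length_cons] at la ld
      cases h2 with
      | cons _ h2 =>
        exact .square y ha (IH _ (by have := h2.length_eq; omega) _ _ _ rfl h2.symm hd) hs
      | @square _ _ s r1 a1 c1 d1 ha1 hd1 hs1 =>
        have la1 := ha1.length_eq
        have ld1 := hd1.length_eq
        simp only [List.length_cons] at la1 ld1
        have key := IH _ (by simp only [List.length_cons]; omega) _ _ _ rfl hd.symm ha1
        cases key with
        | cons _ key =>
          obtain rfl := key.head_eq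
          obtain rfl := hs.swap.rot.unique hs1.rot
          refine .cons y (IH _ (by omega) _ _ _ rfl ha (IH _ ?_ _ _ _ rfl (.cons a key) hd1.symm))
          simp only [List.length_cons]; omega
        | @square _ _ _ u e t e1 k1 k2 hs2 =>
          obtain rfl := k1.head_eq
          obtain rfl := k2.head_eq
          have lk1 := k1.length_eq
          have lk2 := k2.length_eq
          simp only [List.length_cons] at lk1 lk2
          -- Three distinct last edges ending at `y`: reroute all paths through the vertex `z` of the
          -- 3-cube that is opposite to the vertex `d`.
          obtain ⟨z, z1, z2, z3⟩ := hX.exists_threeCube hs.swap.rot hs1.rot hs2.rev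
          have w1 : X.PathEqv p (a :: z :: t :: u) := by
            refine IH _ (by omega) _ _ _ rfl ha (.square a k1 (.refl _) z2.swap.rot)
          have w2 : X.PathEqv s (d1 :: z :: t :: u) := by
            refine IH _ (by omega) _ _ _ rfl hd1 (.square d1 k2 (.refl _) z3.swap.rot)
          exact .square y w1 w2 z1.rev

/-- Up to equivalence, the last edge of the path `p` comes from `z`. -/
def Desc (X : CubeComplex V) (p : List V) (z : V) : Prop := ∃ a r, X.PathEqv p (a :: z :: r)

/-- No equivalent path has a backtrack. -/
def Red (X : CubeComplex V) : List V → Prop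
  | [] => True
  | y :: p => Red X p ∧ ¬ X.Desc p y

theorem PathEqv.cancel {a a' z : V} {r r' : List V}
    (h : X.PathEqv (a :: z :: r) (a' :: z :: r')) : X.PathEqv (z :: r) (z :: r') := by
  cases h with
  | cons _ h => exact h
  | square _ h1 h2 hs =>
    obtain rfl := h1.head_eq
    obtain rfl := h2.head_eq
    exact absurd rfl hs.bc_ne

theorem Desc.congr (hX : X.HasFlagLinks) {p q : List V} {z : V} (h : X.PathEqv p q)
    (hd : X.Desc p z) : X.Desc q z := by
  obtain ⟨a, r, hr⟩ := hd
  exact ⟨a, r, h.symm.trans hX hr⟩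

theorem Red.congr (hX : X.HasFlagLinks) {p q : List V} (h : X.PathEqv p q) (hp : X.Red p) :
    X.Red q := by
  suffices H : (X.Red p ↔ X.Red q) from H.1 hp
  clear hp
  have aux : ∀ {p q r : List V} {a c d y : V}, X.PathEqv p (a :: c :: r) →
      X.PathEqv q (d :: c :: r) → X.Sq c a d y → (X.Red p ↔ X.Red (a :: c :: r)) →
      (X.Red q ↔ X.Red (d :: c :: r)) → X.Red (y :: p) → X.Red (y :: q) := by
    intro p q r a c d y h1 h2 hs i1 i2 hp
    obtain ⟨hp1, hp2⟩ := hp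
    obtain ⟨hcr, hac⟩ := i1.1 hp1
    refine ⟨i2.2 ⟨hcr, ?_⟩, ?_⟩
    · rintro ⟨t, s, hts⟩
      obtain rfl := hts.head_eq
      exact hp2 ⟨a, d :: s, h1.trans hX ((PathEqv.cons a hts).trans hX
        (.square a (.refl _) (.refl _) hs.swap.rot))⟩
    · rintro ⟨t, s, hts⟩
      have h3 := h2.symm.trans hX hts
      cases h3 with
      | cons _ h3 => exact absurd h3.head_eq fun e => hs.ad_ne e
      | square _ k1 k2 hs' =>
        obtain rfl := k1.head_eq
        obtain rfl := k2.head_eq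
        obtain rfl := hs.swap.rot.unique hs'.rev
        exact hac ⟨_, _, k1⟩
  induction h with
  | nil => rfl
  | cons y h ih =>
    exact and_congr ih (not_congr ⟨Desc.congr hX h, Desc.congr hX h.symm⟩)
  | square y h1 h2 hs i1 i2 => exact ⟨aux h1 h2 hs i1 i2, aux h2 h1 hs.swap i2 i1⟩

/-- Prolong a path by an edge to `z`, or cancel: if an equivalent path has its last edge coming from
`z`, remove that edge instead. -/
noncomputable def step (X : CubeComplex V) (q : List V) (z : V) : List V :=
  open Classical in
  if h : X.Desc q z then z :: h.choose_spec.choose else z :: q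

theorem step_of_desc (hX : X.HasFlagLinks) {q r : List V} {a z : V}
    (h : X.PathEqv q (a :: z :: r)) : X.PathEqv (X.step q z) (z :: r) := by
  have hd : X.Desc q z := ⟨a, r, h⟩
  rw [step, dif_pos hd]
  exact (hd.choose_spec.choose_spec.symm.trans hX h).cancel

theorem step_of_not_desc {q : List V} {z : V} (h : ¬ X.Desc q z) : X.step q z = z :: q := by
  rw [step, dif_neg h]

theorem step_congr (hX : X.HasFlagLinks) {q q' : List V} (h : X.PathEqv q q') (z : V) :
    X.PathEqv (X.step q z) (X.step q' z) := by
  by_cases hd : X.Desc q z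
  · obtain ⟨a, r, hr⟩ := hd
    exact (step_of_desc hX hr).trans hX (step_of_desc hX (h.symm.trans hX hr)).symm
  · rw [step_of_not_desc hd, step_of_not_desc fun hd' => hd (hd'.congr hX h.symm)]
    exact .cons z h

theorem exists_step_eq (q : List V) (z : V) : ∃ t, X.step q z = z :: t := by
  rw [step]; split_ifs <;> exact ⟨_, rfl⟩

theorem red_step (hX : X.HasFlagLinks) {q : List V} (h : X.Red q) (z : V) :
    X.Red (X.step q z) := by
  by_cases hd : X.Desc q z
  · obtain ⟨a, r, hr⟩ := hd
    exact Red.congr hX (step_of_desc hX hr).symm (Red.congr hX hr h).1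
  · rw [step_of_not_desc hd]; exact ⟨h, hd⟩

theorem length_step (hX : X.HasFlagLinks) (q : List V) (z : V) :
    (X.step q z).length ≤ q.length + 1 := by
  by_cases hd : X.Desc q z
  · obtain ⟨a, r, hr⟩ := hd
    have h1 := (step_of_desc hX hr).length_eq
    have h2 := hr.length_eq
    simp only [List.length_cons] at h1 h2
    omega
  · rw [step_of_not_desc hd]; simp

theorem step_step_backtrack (hX : X.HasFlagLinks) {y z : V} {q : List V}
    (h : X.Red (y :: q)) : X.PathEqv (X.step (X.step (y :: q) z) y) (y :: q) := by
  by_cases hd : X.Desc (y :: q) z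
  · obtain ⟨a, r, hr⟩ := hd
    obtain rfl := hr.head_eq
    refine (step_congr hX (step_of_desc hX hr) _).trans hX ?_
    rw [step_of_not_desc (Red.congr hX hr h).2]
    exact hr.symm
  · rw [step_of_not_desc hd]
    exact step_of_desc hX (.refl _)

/-- Crossing a square by its two pairs of sides has the same effect on a reduced path. The cases are
whether the first steps, to `b` and to `c`, cancel. -/
theorem step_step_square (hX : X.HasFlagLinks) {a b c d : V} {q : List V}
    (h : X.Red (a :: q)) (hs : X.Sq a b c d) :
    X.PathEqv (X.step (X.step (a :: q) b) d) (X.step (X.step (a :: q) c) d) := by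
  have none : ∀ {b c : V}, X.Sq a b c d → ¬ X.Desc (a :: q) c → ¬ X.Desc (b :: a :: q) d := by
    rintro b c hs hc ⟨b', s, hb⟩
    obtain rfl := hb.head_eq
    cases hb with
    | cons _ hb => exact hs.ad_ne hb.head_eq
    | square _ k1 k2 hs' =>
      obtain rfl := k1.head_eq
      obtain rfl := k2.head_eq
      obtain rfl := hs.rot.unique hs'.rev
      exact hc ⟨_, _, k1⟩
  have one : ∀ {b c : V}, X.Sq a b c d → X.Desc (a :: q) b → ¬ X.Desc (a :: q) c →
      X.PathEqv (X.step (X.step (a :: q) b) d) (X.step (X.step (a :: q) c) d) := by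
    rintro b c hs ⟨a', r, hr⟩ hc
    obtain rfl := hr.head_eq
    have h1 : X.PathEqv (c :: a :: q) (c :: d :: b :: r) :=
      .square c hr (.refl _) hs.rot
    have h2 : X.Red (c :: d :: b :: r) := Red.congr hX h1 ⟨h, hc⟩
    rw [step_of_not_desc hc]
    refine (step_congr hX (step_of_desc hX hr) d).trans hX ?_
    rw [step_of_not_desc h2.1.2]
    exact (step_of_desc hX h1).symm
  by_cases hb : X.Desc (a :: q) b <;> by_cases hc : X.Desc (a :: q) c
  · obtain ⟨a', r, hr⟩ := hb
    obtain ⟨a'', r', hr'⟩ := hc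
    have h1 := hr.symm.trans hX hr'
    obtain rfl := hr.head_eq
    cases h1 with
    | cons _ h1 => exact absurd h1.head_eq hs.bc_ne
    | square _ k1 k2 hs' =>
      obtain rfl := k1.head_eq
      obtain rfl := k2.head_eq
      obtain rfl := hs.unique hs'.rev
      have e1 := (step_congr hX ((step_of_desc hX hr).trans hX k1) d).trans hX
        (step_of_desc hX (.refl _))
      have e2 := (step_congr hX ((step_of_desc hX hr').trans hX k2) d).trans hX
        (step_of_desc hX (.refl _))
      exact e1.trans hX e2.symm
  · exact one hs hb hc
  · exact (one hs.swap hc hb).symm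
  · rw [step_of_not_desc hb, step_of_not_desc hc, step_of_not_desc (none hs hc),
      step_of_not_desc (none hs.swap hb)]
    exact .square d (.refl _) (.refl _) hs

/-- Prolong a path by a walk, cancelling backtracks. -/
noncomputable def run (X : CubeComplex V) :
    ∀ {x y : V}, List V → X.graph.Walk x y → List V
  | _, _, q, .nil => q
  | _, _, q, .cons (v := z) _ p => run X (X.step q z) p

theorem run_append {x y z : V} (p : X.graph.Walk x y) (p' : X.graph.Walk y z) (q : List V) :
    X.run q (p.append p') = X.run (X.run q p) p' := by
  induction p generalizing q with
  | nil => rfl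
  | cons h p ih => exact ih _ _

theorem run_congr (hX : X.HasFlagLinks) {x y : V} (p : X.graph.Walk x y) {q q' : List V}
    (h : X.PathEqv q q') : X.PathEqv (X.run q p) (X.run q' p) := by
  induction p generalizing q q' with
  | nil => exact h
  | cons _ p ih => exact ih (step_congr hX h _)

theorem red_run (hX : X.HasFlagLinks) {x y : V} (p : X.graph.Walk x y) {q : List V}
    (h : X.Red q) : X.Red (X.run q p) := by
  induction p generalizing q with
  | nil => exact h
  | cons _ p ih => exact ih (red_step hX h _)

theorem exists_run_eq {x y : V} (p : X.graph.Walk x y) (q : List V) :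
    ∃ t, X.run (x :: q) p = y :: t := by
  induction p generalizing q with
  | nil => exact ⟨_, rfl⟩
  | cons h p ih =>
    rename_i u v w
    obtain ⟨t, ht⟩ := exists_step_eq (X := X) (u :: q) v
    simp only [run, ht]; exact ih t

theorem length_run (hX : X.HasFlagLinks) {x y : V} (p : X.graph.Walk x y) (q : List V) :
    (X.run q p).length ≤ q.length + p.length := by
  induction p generalizing q with
  | nil => exact le_rfl
  | cons h p ih =>
    rename_i u v w
    have h1 := ih (X.step q v)
    have h2 := length_step hX q v
    simp only [run, SimpleGraph.Walk.length_cons]; omega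

/-- The classes of reduced paths are acted upon by homotopy classes of paths. -/
theorem PathHomotopic.run_eqv (hX : X.HasFlagLinks) {x y : V} {p p' : X.graph.Walk x y}
    (h : X.PathHomotopic p p') {q : List V} (hq : X.Red (x :: q)) :
    X.PathEqv (X.run (x :: q) p) (X.run (x :: q) p') := by
  induction h generalizing q with
  | refl p => exact .refl _
  | symm _ ih => exact (ih hq).symm
  | trans _ _ ih1 ih2 => exact (ih1 hq).trans hX (ih2 hq)
  | backtrack p h p' =>
    rw [run_append, run_append]
    obtain ⟨t, ht⟩ := exists_run_eq p q
    have hr := red_run hX p hq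
    rw [ht] at hr ⊢
    exact run_congr hX p' (step_step_backtrack hX hr)
  | @square a b c d p hab hbd hac hcd hsq p' =>
    rw [run_append, run_append]
    by_cases hbc : b = c
    · subst hbc; exact .refl _
    obtain ⟨t, ht⟩ := exists_run_eq p q
    have hr := red_run hX p hq
    rw [ht] at hr ⊢
    refine run_congr hX p' (step_step_square hX hr ⟨hab, hac, hbd, hcd, ?_, hbc, hsq⟩)
    rintro rfl
    have e : ({a, b, c, a} : Set V) = {a, b, c} := by
      ext z; simp only [Set.mem_insert_iff, Set.mem_singleton_iff]; tauto
    rw [e] at hsq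
    exact triple_notMem_cubes hab.1 hac.1 hbc hsq

/-- The list `p` consists of the vertices of an edge path from `v`. -/
def IsPathFrom (X : CubeComplex V) (v : V) : List V → Prop
  | [] => False
  | [x] => x = v
  | y :: x :: p => X.graph.Adj x y ∧ IsPathFrom X v (x :: p)

theorem PathEqv.isPathFrom_iff {v : V} {p q : List V} (h : X.PathEqv p q) :
    X.IsPathFrom v p ↔ X.IsPathFrom v q := by
  induction h with
  | nil => rfl
  | @cons y p q h ih =>
    rcases p with _ | ⟨x, p⟩
    · cases h; rfl
    · obtain ⟨q', rfl⟩ := h.exists_cons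
      exact and_congr_right fun _ => ih
  | @square y p q r a c d h1 h2 hs ih1 ih2 =>
    obtain ⟨p', rfl⟩ := h1.symm.exists_cons
    obtain ⟨q', rfl⟩ := h2.symm.exists_cons
    have e1 : X.IsPathFrom v (a :: c :: r) ↔ X.IsPathFrom v (c :: r) :=
      ⟨fun h => h.2, fun h => ⟨hs.ab, h⟩⟩
    have e2 : X.IsPathFrom v (d :: c :: r) ↔ X.IsPathFrom v (c :: r) :=
      ⟨fun h => h.2, fun h => ⟨hs.ac, h⟩⟩
    exact ⟨fun h => ⟨hs.cd, ih2.2 (e2.2 (e1.1 (ih1.1 h.2)))⟩,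
      fun h => ⟨hs.bd, ih1.2 (e1.2 (e2.1 (ih2.1 h.2)))⟩⟩

theorem isPathFrom_step (hX : X.HasFlagLinks) {v y z : V} {q : List V}
    (h : X.IsPathFrom v (y :: q)) (hyz : X.graph.Adj y z) :
    X.IsPathFrom v (X.step (y :: q) z) := by
  by_cases hd : X.Desc (y :: q) z
  · obtain ⟨a, r, hr⟩ := hd
    exact (step_of_desc hX hr).isPathFrom_iff.2 (hr.isPathFrom_iff.1 h).2
  · rw [step_of_not_desc hd]; exact ⟨hyz, h⟩

theorem isPathFrom_run (hX : X.HasFlagLinks) {v x y : V} (p : X.graph.Walk x y) {q : List V}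
    (h : X.IsPathFrom v (x :: q)) : X.IsPathFrom v (X.run (x :: q) p) := by
  induction p generalizing q with
  | nil => exact h
  | cons hz p ih =>
    rename_i u z w
    have h1 := isPathFrom_step hX h hz
    obtain ⟨t, ht⟩ := exists_step_eq (X := X) (u :: q) z
    rw [ht] at h1
    simp only [run, ht]; exact ih h1

theorem IsPathFrom.dist_le (hc : X.graph.Connected) {v y : V} {q : List V}
    (h : X.IsPathFrom v (y :: q)) : X.graph.dist v y ≤ q.length := by
  induction q generalizing y with
  | nil => obtain rfl := h; simp
  | cons x q ih =>
    have h1 := ih h.2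
    have h2 := hc.dist_triangle (u := v) (v := x) (w := y)
    rw [SimpleGraph.dist_eq_one_iff_adj.2 h.1] at h2
    simp only [List.length_cons]; omega

/-- A reduced path representing a geodesic. -/
theorem exists_reduced (hX : X.IsCAT0) (v a : V) (p : X.graph.Walk v a)
    (hp : p.length = X.graph.dist v a) : ∃ A : List V, X.run [v] p = a :: A ∧
      X.IsPathFrom v (a :: A) ∧ A.length = X.graph.dist v a := by
  obtain ⟨A, hA⟩ := exists_run_eq p []
  have h1 : X.IsPathFrom v (a :: A) := hA ▸ isPathFrom_run hX.flagLinks p (q := []) rfl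
  refine ⟨A, hA, h1, le_antisymm ?_ (h1.dist_le hX.connected)⟩
  have := length_run hX.flagLinks p [v]
  rw [hA] at this
  simp only [List.length_cons, List.length_nil] at this; omega

/-- The quadrangle condition: if `a` and `d` are distinct neighbours of `b` that are closer to `v`,
then `a, b, d` are three vertices of a square whose fourth vertex is still closer to `v`. -/
theorem IsCAT0.quadrangle (hX : X.IsCAT0) {v a b d : V} (hab : X.graph.Adj a b)
    (hdb : X.graph.Adj d b) (had : a ≠ d) (ha : X.graph.dist v b = X.graph.dist v a + 1)
    (hd : X.graph.dist v b = X.graph.dist v d + 1) :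
    ∃ c, X.Sq c a d b ∧ X.graph.dist v a = X.graph.dist v c + 1 := by
  -- A geodesic from `v` to `b` through `a` is reduced, so `run` does not shorten it.
  have key : ∀ a, X.graph.Adj a b → X.graph.dist v b = X.graph.dist v a + 1 →
      ∃ (p : X.graph.Walk v b) (A : List V), X.run [v] p = b :: a :: A ∧
        X.IsPathFrom v (a :: A) ∧ A.length = X.graph.dist v a := by
    intro a hab ha
    obtain ⟨p, hp⟩ := hX.connected.exists_walk_length_eq_dist v a
    obtain ⟨A, h1, h2, h3⟩ := exists_reduced hX v a p hp
    refine ⟨p.append (.cons hab .nil), A, ?_, h2, h3⟩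
    rw [run_append, h1]
    refine step_of_not_desc ?_
    rintro ⟨a', r, hr⟩
    have h4 := (hr.isPathFrom_iff.1 h2).2.dist_le hX.connected
    have h5 := hr.length_eq
    simp only [List.length_cons] at h5; omega
  obtain ⟨p, A, h1, h2, h3⟩ := key a hab ha
  obtain ⟨p', D, h1', h2', h3'⟩ := key d hdb hd
  -- The geodesics through `a` and through `d` are homotopic, hence equivalent, and the definition of
  -- equivalence provides the square.
  have h := (hX.simplyConnected p p').run_eqv hX.flagLinks (q := []) ⟨trivial, fun ⟨_, _, h⟩ => by
    cases h⟩
  rw [h1, h1'] at h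
  cases h with
  | cons _ h => exact absurd h.head_eq had
  | @square _ _ _ r _ c _ k1 k2 hs =>
    obtain rfl := k1.head_eq
    obtain rfl := k2.head_eq
    refine ⟨c, hs, ?_⟩
    have h4 := (k1.isPathFrom_iff.1 h2).2.dist_le hX.connected
    have h5 := k1.length_eq
    have h6 := hX.connected.dist_triangle (u := v) (v := c) (w := a)
    rw [SimpleGraph.dist_eq_one_iff_adj.2 hs.ab] at h6
    simp only [List.length_cons] at h5; omega

theorem PathHomotopic.length_mod_two {x y : V} {p q : X.graph.Walk x y}
    (h : X.PathHomotopic p q) : p.length % 2 = q.length % 2 := by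
  induction h with
  | refl p => rfl
  | symm _ ih => exact ih.symm
  | trans _ _ ih1 ih2 => exact ih1.trans ih2
  | backtrack p h q =>
    simp only [SimpleGraph.Walk.length_append, SimpleGraph.Walk.length_cons]; omega
  | square p _ _ _ _ _ q =>
    simp only [SimpleGraph.Walk.length_append, SimpleGraph.Walk.length_cons]

/-- The 1-skeleton is bipartite. -/
theorem IsCAT0.dist_ne (hX : X.IsCAT0) (v : V) {a b : V} (h : X.graph.Adj a b) :
    X.graph.dist v a ≠ X.graph.dist v b := by
  obtain ⟨p, hp⟩ := hX.connected.exists_walk_length_eq_dist v a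
  obtain ⟨q, hq⟩ := hX.connected.exists_walk_length_eq_dist v b
  have := (hX.simplyConnected (p.append (.cons h .nil)) q).length_mod_two
  simp only [SimpleGraph.Walk.length_append, SimpleGraph.Walk.length_cons,
    SimpleGraph.Walk.length_nil] at this
  omega

end CubeComplex

/-! ### Discrete wallspaces -/

section Wallspace

variable {V : Type u}

/-- The halfspaces in `H` that contain `x` but not `y`. -/
def sepWalls (H : Set (Set V)) (x y : V) : Set (Set V) := {h | h ∈ H ∧ x ∈ h ∧ y ∉ h}

/-- A family `H` of halfspaces, closed under complements, such that `V` is the vertex set of a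
CAT(0) cube complex with halfspaces `H`: any two points are separated by finitely many halfspaces
and by at least one if they are distinct, and a halfspace that is minimal among those containing
`x` can be left by crossing only its own wall. -/
structure IsWallspace (H : Set (Set V)) : Prop where
  compl_mem : ∀ h ∈ H, hᶜ ∈ H
  nonempty : ∀ h ∈ H, h.Nonempty
  finite_sep : ∀ x y, (sepWalls H x y).Finite
  eq_of_sep : ∀ x y, sepWalls H x y = ∅ → x = y
  cross : ∀ x, ∀ h ∈ H, x ∈ h → (∀ k ∈ H, x ∈ k → k ⊆ h → k = h) → ∃ y, sepWalls H x y = {h}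

/-- The number of walls between `x` and `y`. -/
noncomputable def wallDist (H : Set (Set V)) (x y : V) : ℕ := (sepWalls H x y).ncard

/-- Convexity with respect to a family of halfspaces. -/
def WallConvex (H : Set (Set V)) (S : Set V) : Prop :=
  ∀ x ∈ S, ∀ y ∈ S, ∀ z, (∀ h ∈ H, x ∈ h → y ∈ h → z ∈ h) → z ∈ S

/-- Finite families of pairwise transverse elements of `H` have at most `N` elements. -/
def WallDimLE (H : Set (Set V)) (N : ℕ) : Prop :=
  ∀ T : Finset (Set V), (∀ t ∈ T, t ∈ H) →
    (∀ s ∈ T, ∀ t ∈ T, s ≠ t → CubeComplex.Transverse s t) → T.card ≤ N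

variable {H : Set (Set V)}

theorem WallDimLE.finite_and_ncard_le {N : ℕ} (hN : WallDimLE H N) {T : Set (Set V)} (hT : T ⊆ H)
    (hp : ∀ s ∈ T, ∀ t ∈ T, s ≠ t → CubeComplex.Transverse s t) : T.Finite ∧ T.ncard ≤ N := by
  have h1 : ∀ S : Finset (Set V), ↑S ⊆ T → S.card ≤ N := fun S hS =>
    hN S (fun t ht => hT (hS ht)) fun s hs t ht => hp s (hS hs) t (hS ht)
  have hf : T.Finite := by
    by_contra hinf
    obtain ⟨S, hS, hc⟩ := Set.Infinite.exists_subset_card_eq hinf (N + 1)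
    have := h1 S hS
    omega
  refine ⟨hf, ?_⟩
  rw [Set.ncard_eq_toFinset_card T hf]
  exact h1 _ (by simp)

namespace IsWallspace

variable (hH : IsWallspace H)
include hH

theorem compl_mem_sep {x y : V} {h : Set V} (h1 : h ∈ sepWalls H x y) : hᶜ ∈ sepWalls H y x :=
  ⟨hH.compl_mem _ h1.1, h1.2.2, fun h => h h1.2.1⟩

theorem sep_eq_image (x y : V) : sepWalls H y x = compl '' sepWalls H x y := by
  ext h
  constructor
  · intro h1; exact ⟨hᶜ, hH.compl_mem_sep h1, compl_compl h⟩
  · rintro ⟨k, hk, rfl⟩; exact hH.compl_mem_sep hk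

theorem sep_symm {x y : V} {h : Set V} (h1 : sepWalls H x y = {h}) : sepWalls H y x = {hᶜ} := by
  rw [hH.sep_eq_image, h1, Set.image_singleton]

theorem wallDist_comm (x y : V) : wallDist H x y = wallDist H y x := by
  rw [wallDist, wallDist, hH.sep_eq_image, Set.ncard_image_of_injective _ compl_injective]

theorem wallDist_triangle (x y z : V) :
    wallDist H x z ≤ wallDist H x y + wallDist H y z := by
  refine (Set.ncard_le_ncard ?_ ((hH.finite_sep x y).union (hH.finite_sep y z))).trans
    (Set.ncard_union_le _ _)
  rintro h ⟨h1, h2, h3⟩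
  by_cases hy : y ∈ h
  · exact Or.inr ⟨h1, hy, h3⟩
  · exact Or.inl ⟨h1, h2, hy⟩

theorem eq_of_forall {x y : V} (h : ∀ k ∈ H, x ∈ k → y ∈ k) : x = y :=
  hH.eq_of_sep x y (Set.eq_empty_of_forall_notMem fun k hk => hk.2.2 (h k hk.1 hk.2.1))

theorem wallDist_eq_zero {x y : V} (h : wallDist H x y = 0) : x = y :=
  hH.eq_of_sep x y ((Set.ncard_eq_zero (hH.finite_sep x y)).1 h)

/-- A consistent choice of halfspaces that differs only finitely from the halfspaces containing
some point consists of the halfspaces containing a point. -/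
theorem realize (ω : Set (Set V)) (hc : ∀ h ∈ H, h ∈ ω ↔ hᶜ ∉ ω)
    (hu : ∀ h ∈ H, ∀ k ∈ H, h ∈ ω → h ⊆ k → k ∈ ω) (x : V)
    (hf : {h | h ∈ H ∧ h ∈ ω ∧ x ∉ h}.Finite) : ∃ y, ∀ h ∈ H, y ∈ h ↔ h ∈ ω := by
  induction hn : {h | h ∈ H ∧ h ∈ ω ∧ x ∉ h}.ncard using Nat.strong_induction_on generalizing x with
  | _ n ih =>
    rcases Set.eq_empty_or_nonempty {h | h ∈ H ∧ h ∈ ω ∧ x ∉ h} with he | hne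
    · have h0 : ∀ h ∈ H, h ∈ ω → x ∈ h := by
        intro h hh hω
        by_contra hx
        exact (Set.eq_empty_iff_forall_notMem.1 he h) ⟨hh, hω, hx⟩
      refine ⟨x, fun h hh => ⟨fun hx => (hc h hh).2 fun hω => ?_, h0 h hh⟩⟩
      exact h0 _ (hH.compl_mem h hh) hω hx
    -- Cross the wall of a largest halfspace of `ω` that does not contain `x`.
    · obtain ⟨h, ⟨hD, hmax⟩⟩ := hf.exists_maximal hne
      obtain ⟨hh, hω, hx⟩ := hD
      obtain ⟨y, hy⟩ := hH.cross x hᶜ (hH.compl_mem h hh) hx (by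
        intro k hk hxk hkh
        have h1 : h ⊆ kᶜ := Set.subset_compl_comm.1 hkh
        have h2 : kᶜ ∈ {h | h ∈ H ∧ h ∈ ω ∧ x ∉ h} :=
          ⟨hH.compl_mem k hk, hu h hh _ (hH.compl_mem k hk) hω h1, fun h => h hxk⟩
        exact hkh.antisymm (Set.compl_subset_comm.1 (hmax h2 h1)))
      have hsub : {k | k ∈ H ∧ k ∈ ω ∧ y ∉ k} ⊆ {h | h ∈ H ∧ h ∈ ω ∧ x ∉ h} \ {h} := by
        rintro k ⟨hk, hkω, hyk⟩
        refine ⟨⟨hk, hkω, fun hxk => ?_⟩, ?_⟩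
        · have : k ∈ sepWalls H x y := ⟨hk, hxk, hyk⟩
          rw [hy] at this
          obtain rfl := this
          exact (hc h hh).1 hω hkω
        · rintro rfl
          have : kᶜ ∈ sepWalls H x y := hy ▸ rfl
          exact this.2.2 hyk
      refine ih _ ?_ y (hf.subset (hsub.trans Set.sdiff_subset)) rfl
      rw [← hn]
      refine (Set.ncard_le_ncard hsub (hf.subset Set.sdiff_subset)).trans_lt ?_
      exact Set.ncard_sdiff_singleton_lt_of_mem ⟨hh, hω, hx⟩ hf

/-- Walls adjacent to `x` that pairwise are not nested away from `x` can be crossed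
simultaneously. -/
theorem exists_sep_eq {x : V} {T : Set (Set V)} (hT : T.Finite) (hTH : T ⊆ H)
    (hx : ∀ t ∈ T, x ∈ t) (hmin : ∀ t ∈ T, ∀ k ∈ H, x ∈ k → k ⊆ t → k = t)
    (hp : ∀ s ∈ T, ∀ t ∈ T, s ≠ t → ¬ sᶜ ⊆ t) : ∃ y, sepWalls H x y = T := by
  obtain ⟨y, hy⟩ := hH.realize {k | (x ∈ k ∧ k ∉ T) ∨ kᶜ ∈ T} (by
      intro h hh
      simp only [Set.mem_ofPred_eq, compl_compl, Set.mem_compl_iff]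
      by_cases hxh : x ∈ h
      · have h1 : hᶜ ∉ T := fun h1 => hx _ h1 hxh
        tauto
      · have h1 : h ∉ T := fun h1 => hxh (hx _ h1)
        tauto) (by
      rintro h hh k hk (⟨h1, h2⟩ | h1) hhk
      · refine Or.inl ⟨hhk h1, fun hkT => h2 ?_⟩
        rwa [hmin k hkT h hh h1 hhk]
      · by_cases hxk : x ∈ k
        · refine Or.inl ⟨hxk, fun hkT => ?_⟩
          by_cases e : hᶜ = k
          · obtain ⟨z, hz⟩ := hH.nonempty h hh
            have := hhk hz
            rw [← e] at this; exact this hz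
          · exact hp _ h1 _ hkT e (by rwa [compl_compl])
        · right
          rwa [hmin _ h1 kᶜ (hH.compl_mem k hk) hxk (Set.compl_subset_compl.2 hhk)]) x (by
      refine (hT.image compl).subset ?_
      rintro h ⟨hh, h1 | h1, h2⟩
      · exact absurd h1.1 h2
      · exact ⟨_, h1, compl_compl h⟩)
  refine ⟨y, ?_⟩
  ext k
  constructor
  · rintro ⟨hk, hxk, hyk⟩
    by_contra hkT
    exact hyk ((hy k hk).2 (Or.inl ⟨hxk, hkT⟩))
  · intro hkT
    refine ⟨hTH hkT, hx k hkT, fun hyk => ?_⟩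
    rcases (hy k (hTH hkT)).1 hyk with h1 | h1
    · exact h1.2 hkT
    · exact hx _ h1 (hx k hkT)

/-- Distinct points can be brought closer by crossing one wall. -/
theorem exists_step {x y : V} (hxy : x ≠ y) : ∃ z, ∃ h ∈ sepWalls H x y,
    sepWalls H x z = {h} ∧ sepWalls H z y = sepWalls H x y \ {h} := by
  have hne : (sepWalls H x y).Nonempty := by
    rw [Set.nonempty_iff_ne_empty]; exact fun h => hxy (hH.eq_of_sep x y h)
  obtain ⟨h, ⟨h1, hmin⟩⟩ := (hH.finite_sep x y).exists_minimal hne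
  obtain ⟨z, hz⟩ := hH.cross x h h1.1 h1.2.1 fun k hk hxk hkh =>
    hkh.antisymm (hmin ⟨hk, hxk, fun hy => h1.2.2 (hkh hy)⟩ hkh)
  refine ⟨z, h, h1, hz, ?_⟩
  have hzh : h ∈ sepWalls H x z := hz ▸ rfl
  have hzx := hH.sep_symm hz
  ext k
  constructor
  · rintro ⟨hk, hzk, hyk⟩
    refine ⟨⟨hk, ?_, hyk⟩, ?_⟩
    · by_contra hxk
      have : k ∈ sepWalls H z x := ⟨hk, hzk, hxk⟩
      rw [hzx] at this
      obtain rfl := this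
      exact hyk h1.2.2
    · rintro rfl; exact hzh.2.2 hzk
  · rintro ⟨⟨hk, hxk, hyk⟩, hkh⟩
    refine ⟨hk, ?_, hyk⟩
    by_contra hzk
    have : k ∈ sepWalls H x z := ⟨hk, hxk, hzk⟩
    rw [hz] at this
    exact hkh this

/-- The median of three points: it lies in the halfspaces that contain at least two of them. -/
theorem median (x y z : V) : ∃ m, ∀ h ∈ H,
    m ∈ h ↔ (x ∈ h ∧ y ∈ h) ∨ (x ∈ h ∧ z ∈ h) ∨ (y ∈ h ∧ z ∈ h) := by
  refine hH.realize {h | (x ∈ h ∧ y ∈ h) ∨ (x ∈ h ∧ z ∈ h) ∨ (y ∈ h ∧ z ∈ h)} ?_ ?_ x ?_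
  · intro h _
    simp only [Set.mem_ofPred_eq, Set.mem_compl_iff]; tauto
  · intro h _ k _ h1 hk
    have := @hk x; have := @hk y; have := @hk z
    simp only [Set.mem_ofPred_eq] at h1 ⊢; tauto
  · refine (hH.finite_sep y x).subset ?_
    rintro h ⟨h1, h2, h3⟩
    simp only [Set.mem_ofPred_eq] at h2
    exact ⟨h1, by tauto, h3⟩

/-- The projection of `x` to the intersection of finitely many pairwise intersecting
halfspaces. -/
theorem exists_projection {T : Set (Set V)} (hT : T.Finite) (hTH : T ⊆ H)
    (hp : ∀ s ∈ T, ∀ t ∈ T, (s ∩ t).Nonempty) (x : V) : ∃ y, ∀ k ∈ H,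
      y ∈ k ↔ (∃ t ∈ T, t ⊆ k) ∨ (x ∈ k ∧ ∀ t ∈ T, ¬ t ⊆ kᶜ) := by
  have hp' : ∀ s ∈ T, ∀ t ∈ T, ∀ k : Set V, s ⊆ k → ¬ t ⊆ kᶜ := by
    intro s hs t ht k h1 h2
    obtain ⟨z, hz⟩ := hp s hs t ht
    exact h2 hz.2 (h1 hz.1)
  refine hH.realize {k | (∃ t ∈ T, t ⊆ k) ∨ (x ∈ k ∧ ∀ t ∈ T, ¬ t ⊆ kᶜ)} ?_ ?_ x ?_
  · intro k _
    simp only [Set.mem_ofPred_eq, Set.mem_compl_iff, compl_compl]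
    constructor
    · rintro (⟨t, ht, htk⟩ | ⟨h1, h2⟩) (⟨s, hs, hsk⟩ | ⟨h3, h4⟩)
      · exact hp' t ht s hs k htk hsk
      · exact h4 t ht htk
      · exact h2 s hs hsk
      · exact h3 h1
    · intro h
      by_contra h'
      push Not at h h'
      by_cases hx : x ∈ k
      · obtain ⟨t, ht, h2⟩ := h'.2 hx
        exact h.1 t ht h2
      · obtain ⟨t, ht, h2⟩ := h.2 hx
        exact h'.1 t ht h2
  · rintro h _ k _ (⟨t, ht, hth⟩ | ⟨h1, h2⟩) hk
    · exact Or.inl ⟨t, ht, hth.trans hk⟩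
    · exact Or.inr ⟨hk h1, fun t ht h3 => h2 t ht (h3.trans (Set.compl_subset_compl.2 hk))⟩
  · have : {h | h ∈ H ∧ h ∈ {k | (∃ t ∈ T, t ⊆ k) ∨ (x ∈ k ∧ ∀ t ∈ T, ¬ t ⊆ kᶜ)} ∧ x ∉ h} ⊆
        ⋃ t ∈ T, {h | h ∈ H ∧ t ⊆ h ∧ x ∉ h} := by
      rintro h ⟨h1, ⟨t, ht, hth⟩ | h2, h3⟩
      · exact Set.mem_biUnion ht ⟨h1, hth, h3⟩
      · exact absurd h2.1 h3
    refine (hT.biUnion fun t ht => ?_).subset this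
    obtain ⟨z, hz⟩ := hH.nonempty t (hTH ht)
    exact (hH.finite_sep z x).subset fun h hh => ⟨hh.1, hh.2.1 hz, hh.2.2⟩

/-- The gate of `x` in a convex set: a point `p` such that every halfspace that contains `p` and
not `x` contains the whole set. It is a point of the set nearest to `x`. -/
theorem exists_gate {S : Set V} (hS : WallConvex H S) (hne : S.Nonempty) (x : V) :
    ∃ p ∈ S, (∀ k ∈ H, p ∈ k → x ∉ k → S ⊆ k) ∧ ∀ s ∈ S, wallDist H x p ≤ wallDist H x s := by
  obtain ⟨p, hp, hmin⟩ : ∃ p ∈ S, ∀ s ∈ S, wallDist H x p ≤ wallDist H x s := by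
    obtain ⟨p, hp, hm⟩ := WellFounded.has_min (measure fun s => wallDist H x s).wf S hne
    exact ⟨p, hp, fun s hs => not_lt.1 (hm s hs)⟩
  refine ⟨p, hp, fun k hk hpk hxk s hs => ?_, hmin⟩
  by_contra hsk
  obtain ⟨m, hm⟩ := hH.median p s x
  have hmS : m ∈ S := hS p hp s hs m fun h hh h1 h2 => (hm h hh).2 (Or.inl ⟨h1, h2⟩)
  refine absurd (hmin m hmS) (not_le.2 ?_)
  refine Set.ncard_lt_ncard ⟨?_, ?_⟩ (hH.finite_sep x p)
  · rintro h ⟨hh, hxh, hmh⟩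
    refine ⟨hh, hxh, fun hph => hmh ((hm h hh).2 (Or.inr (Or.inl ⟨hph, hxh⟩)))⟩
  · intro hsub
    have h1 : kᶜ ∈ sepWalls H x p := ⟨hH.compl_mem k hk, hxk, fun h => h hpk⟩
    refine (hsub h1).2.2 ((hm _ (hH.compl_mem k hk)).2 (Or.inr (Or.inr ⟨hsk, hxk⟩)))

/-- Helly's property for a convex set and two halfspaces. -/
theorem helly {S h k : Set V} (hS : WallConvex H S) (hh : h ∈ H) (hk : k ∈ H)
    (h1 : (S ∩ h).Nonempty) (h2 : (S ∩ k).Nonempty) (h3 : (h ∩ k).Nonempty) :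
    (S ∩ (h ∩ k)).Nonempty := by
  obtain ⟨x, hx⟩ := h1
  obtain ⟨y, hy⟩ := h2
  obtain ⟨z, hz⟩ := h3
  obtain ⟨m, hm⟩ := hH.median x y z
  exact ⟨m, hS x hx.1 y hy.1 m fun l hl h1 h2 => (hm l hl).2 (Or.inl ⟨h1, h2⟩),
    (hm h hh).2 (Or.inr (Or.inl ⟨hx.2, hz.1⟩)), (hm k hk).2 (Or.inr (Or.inr ⟨hy.2, hz.2⟩))⟩

/-- Finitely many pairwise transverse halfspaces are all the halfspaces separating some two
points. -/
theorem exists_sep_eq_of_transverse {T : Set (Set V)} (hT : T.Finite) (hTH : T ⊆ H)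
    (hne : Nonempty V) (hp : ∀ s ∈ T, ∀ t ∈ T, s ≠ t → CubeComplex.Transverse s t) :
    ∃ x y, sepWalls H x y = T := by
  have hself : ∀ s ∈ T, ∀ t ∈ T, (s ∩ t).Nonempty := by
    intro s hs t ht
    by_cases e : s = t
    · subst e; rw [Set.inter_self]; exact hH.nonempty s (hTH hs)
    · exact (hp s hs t ht e).1
  have hself' : ∀ s ∈ compl '' T, ∀ t ∈ compl '' T, (s ∩ t).Nonempty := by
    rintro _ ⟨s, hs, rfl⟩ _ ⟨t, ht, rfl⟩
    by_cases e : s = t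
    · subst e; rw [Set.inter_self]; exact hH.nonempty _ (hH.compl_mem _ (hTH hs))
    · exact (hp s hs t ht e).2.2.2
  have hTH' : compl '' T ⊆ H := by rintro _ ⟨s, hs, rfl⟩; exact hH.compl_mem _ (hTH hs)
  obtain ⟨x0⟩ := hne
  -- Projecting forth and back between the intersections of the halfspaces and of their complements
  -- gives a pair of nearest points.
  obtain ⟨y, hy⟩ := hH.exists_projection (hT.image compl) hTH' hself' x0
  obtain ⟨x, hx⟩ := hH.exists_projection hT hTH hself y
  obtain ⟨y', hy'⟩ := hH.exists_projection (hT.image compl) hTH' hself' x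
  refine ⟨x, y', ?_⟩
  ext k
  constructor
  · rintro ⟨hk, hxk, hyk⟩
    have h1 := (hy' _ (hH.compl_mem k hk)).1 hyk
    have h2 : ∃ s ∈ T, k ⊆ s := by
      rcases h1 with ⟨_, ⟨s, hs, rfl⟩, hsk⟩ | h1
      · exact ⟨s, hs, Set.compl_subset_compl.1 hsk⟩
      · exact absurd hxk h1.1
    obtain ⟨s, hs, hks⟩ := h2
    have hys : y ∉ s := (hy _ (hTH' ⟨s, hs, rfl⟩)).2 (Or.inl ⟨_, ⟨s, hs, rfl⟩, subset_rfl⟩)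
    rcases (hx k hk).1 hxk with ⟨t, ht, htk⟩ | h3
    · by_cases e : t = s
      · subst e; rwa [← htk.antisymm hks]
      · obtain ⟨z, hz⟩ := (hp t ht s hs e).2.1
        exact absurd (hks (htk hz.1)) hz.2
    · exact absurd (hks h3.1) hys
  · intro hk
    refine ⟨hTH hk, (hx k (hTH hk)).2 (Or.inl ⟨k, hk, subset_rfl⟩), ?_⟩
    exact (hy' _ (hTH' ⟨k, hk, rfl⟩)).2 (Or.inl ⟨_, ⟨k, hk, rfl⟩, subset_rfl⟩)

end IsWallspace

end Wallspace

/-! ### Cubes of a wallspace -/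

section WallCube

variable {V : Type u}

/-- The set `C` has points on both sides of the wall of `k`. -/
def Crosses (k C : Set V) : Prop := (k ∩ C).Nonempty ∧ (kᶜ ∩ C).Nonempty

/-- The vertex sets of cubes in the cube complex of a wallspace, described intrinsically: a
nonempty intersection of halfspaces that is crossed by finitely many, pairwise transverse, walls. -/
structure IsWallCube (H : Set (Set V)) (C : Set V) : Prop where
  nonempty : C.Nonempty
  finite : {k | k ∈ H ∧ Crosses k C}.Finite
  transverse : ∀ h ∈ H, ∀ k ∈ H, Crosses h C → Crosses k C → h ≠ k → h ≠ kᶜ →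
    CubeComplex.Transverse h k
  closed : ∀ z, (∀ k ∈ H, C ⊆ k → z ∈ k) → z ∈ C

/-- A parametrization of `C` by the combinatorial cube, whose coordinates are the halfspaces
`h i`. -/
structure IsWallChart (H : Set (Set V)) (C : Set V) {n : ℕ} (h : Fin n → Set V)
    (f : (Fin n → Bool) → V) : Prop where
  range_eq : Set.range f = C
  mem : ∀ i, h i ∈ H
  coord : ∀ a i, f a ∈ h i ↔ a i = true
  const : ∀ k ∈ H, (∀ i, k ≠ h i ∧ k ≠ (h i)ᶜ) → ∀ a b, f a ∈ k → f b ∈ k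

variable {H : Set (Set V)}

theorem Crosses.compl {k C : Set V} (h : Crosses k C) : Crosses kᶜ C :=
  ⟨h.2, by rw [compl_compl]; exact h.1⟩

theorem Crosses.mono {k C D : Set V} (h : Crosses k C) (hCD : C ⊆ D) : Crosses k D :=
  ⟨h.1.mono (Set.inter_subset_inter_right _ hCD), h.2.mono (Set.inter_subset_inter_right _ hCD)⟩

theorem crosses_of_not_subset {k C : Set V} {x : V} (hx : x ∈ C) (hxk : x ∈ k) (h : ¬ C ⊆ k) :
    Crosses k C := by
  obtain ⟨z, hz, hzk⟩ := Set.not_subset.1 h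
  exact ⟨⟨x, hxk, hx⟩, ⟨z, hzk, hz⟩⟩

namespace IsWallChart

variable {C : Set V} {n : ℕ} {h : Fin n → Set V} {f : (Fin n → Bool) → V}
  (hf : IsWallChart H C h f)
include hf

theorem injective : Function.Injective f := by
  intro a b hab
  funext i
  have h1 := hf.coord a i
  rw [hab, hf.coord b i] at h1
  revert h1; cases a i <;> cases b i <;> simp

theorem exists_of_crosses {k : Set V} (hk : k ∈ H) (hc : Crosses k C) :
    ∃ i, k = h i ∨ k = (h i)ᶜ := by
  by_contra hne
  push Not at hne
  rw [← hf.range_eq] at hc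
  obtain ⟨⟨_, h1, a, rfl⟩, ⟨_, h2, b, rfl⟩⟩ := hc
  exact h2 (hf.const k hk hne a b h1)

theorem transverse_coord {i j : Fin n} (hij : i ≠ j) : CubeComplex.Transverse (h i) (h j) := by
  classical
  have key : ∀ s t : Bool, ∃ a : Fin n → Bool, a i = s ∧ a j = t := fun s t =>
    ⟨fun k => if k = i then s else t, by simp, by simp [hij.symm]⟩
  have hc : ∀ a i, f a ∈ (h i)ᶜ ↔ a i = false := by
    intro a i; rw [Set.mem_compl_iff, hf.coord]; simp
  refine ⟨?_, ?_, ?_, ?_⟩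
  · obtain ⟨a, h1, h2⟩ := key true true
    exact ⟨f a, (hf.coord _ _).2 h1, (hf.coord _ _).2 h2⟩
  · obtain ⟨a, h1, h2⟩ := key true false
    exact ⟨f a, (hf.coord _ _).2 h1, (hc _ _).2 h2⟩
  · obtain ⟨a, h1, h2⟩ := key false true
    exact ⟨f a, (hc _ _).2 h1, (hf.coord _ _).2 h2⟩
  · obtain ⟨a, h1, h2⟩ := key false false
    exact ⟨f a, (hc _ _).2 h1, (hc _ _).2 h2⟩

/-- A point on the same sides as a vertex `f a` of the cube for all coordinates, and on the same
side as the cube for all other walls, is `f a`. -/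
theorem eq_of_coord (hH : IsWallspace H) {a : Fin n → Bool} {z : V}
    (h1 : ∀ i, z ∈ h i ↔ a i = true) (h2 : ∀ k ∈ H, C ⊆ k → z ∈ k) : z = f a := by
  refine (hH.eq_of_forall fun k hk hak => ?_).symm
  by_cases hC : C ⊆ k
  · exact h2 k hk hC
  · have hx : f a ∈ C := hf.range_eq ▸ Set.mem_range_self a
    obtain ⟨i, rfl | rfl⟩ := hf.exists_of_crosses hk (crosses_of_not_subset hx hak hC)
    · exact (h1 i).2 ((hf.coord a i).1 hak)
    · exact fun hz => hak ((hf.coord a i).2 ((h1 i).1 hz))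

theorem isWallCube (hH : IsWallspace H) : IsWallCube H C where
  nonempty := ⟨f fun _ => true, hf.range_eq ▸ Set.mem_range_self _⟩
  finite := by
    refine ((Set.finite_range h).union (Set.finite_range fun i => (h i)ᶜ)).subset ?_
    rintro k ⟨hk, hc⟩
    obtain ⟨i, rfl | rfl⟩ := hf.exists_of_crosses hk hc
    · exact Or.inl ⟨i, rfl⟩
    · exact Or.inr ⟨i, rfl⟩
  transverse := by
    intro k hk l hl hkc hlc h1 h2
    obtain ⟨i, hi⟩ := hf.exists_of_crosses hk hkc
    obtain ⟨j, hj⟩ := hf.exists_of_crosses hl hlc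
    have hij : i ≠ j := by
      rintro rfl
      rcases hi with rfl | rfl <;> rcases hj with rfl | rfl <;> simp at h1 h2
    obtain ⟨t1, t2, t3, t4⟩ := hf.transverse_coord hij
    rcases hi with rfl | rfl <;> rcases hj with rfl | rfl <;>
      simp only [CubeComplex.Transverse, compl_compl] <;> tauto
  closed := by
    classical
    intro z hz
    rw [hf.eq_of_coord hH (a := fun i => decide (z ∈ h i)) (fun i => by simp) hz, ← hf.range_eq]
    exact Set.mem_range_self _

/-- The wall cubes contained in a wall cube are its faces. -/
theorem isWallCube_iff (hH : IsWallspace H) {D : Set V} (hD : D ⊆ C) :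
    IsWallCube H D ↔ ∃ F : Set (Fin n → Bool), IsCubeFace F ∧ D = f '' F := by
  classical
  constructor
  · intro hDc
    obtain ⟨x0, hx0⟩ := hDc.nonempty
    -- The coordinates of walls not crossing `D` are fixed.
    let a : Fin n → Option Bool := fun i =>
      if Crosses (h i) D then none else some (decide (x0 ∈ h i))
    refine ⟨{x | ∀ i b, a i = some b → x i = b}, ⟨a, rfl⟩, ?_⟩
    have ha : ∀ i, ¬ Crosses (h i) D → a i = some (decide (x0 ∈ h i)) := fun i hi => by
      simp only [a, if_neg hi]
    ext z
    constructor
    · intro hz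
      have hz' := hD hz
      rw [← hf.range_eq] at hz'
      obtain ⟨x, rfl⟩ := hz'
      refine ⟨x, fun i b hb => ?_, rfl⟩
      by_cases hc : Crosses (h i) D
      · simp only [a, if_pos hc] at hb; cases hb
      · rw [ha i hc, Option.some.injEq] at hb
        rw [← hb]
        have : f x ∈ h i ↔ x0 ∈ h i := by
          by_contra hne
          refine hc ?_
          by_cases h1 : f x ∈ h i
          · exact ⟨⟨_, h1, hz⟩, ⟨x0, fun h2 => hne ⟨fun _ => h2, fun _ => h1⟩, hx0⟩⟩
          · exact ⟨⟨x0, by tauto, hx0⟩, ⟨f x, h1, hz⟩⟩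
        rw [hf.coord] at this
        by_cases h3 : x0 ∈ h i
        · simpa [h3] using this
        · simpa [h3] using this
    · rintro ⟨x, hx, rfl⟩
      refine hDc.closed _ fun k hk hDk => ?_
      by_cases hC : C ⊆ k
      · exact hC (hf.range_eq ▸ Set.mem_range_self x)
      · obtain ⟨i, hi⟩ := hf.exists_of_crosses hk (crosses_of_not_subset (hD hx0) (hDk hx0) hC)
        have hc : ¬ Crosses (h i) D := by
          rintro ⟨⟨y, hy⟩, ⟨z, hz⟩⟩
          rcases hi with rfl | rfl
          · exact hz.1 (hDk hz.2)
          · exact hDk hy.2 hy.1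
        have h1 := hx i _ (ha i hc)
        rcases hi with rfl | rfl
        · rw [hf.coord, h1]; simpa using hDk hx0
        · rw [Set.mem_compl_iff, hf.coord, h1]; simpa using hDk hx0
  · rintro ⟨F, ⟨a, rfl⟩, rfl⟩
    have hC := hf.isWallCube hH
    refine ⟨⟨f fun i => (a i).getD true, ⟨_, fun i b hb => by simp [hb], rfl⟩⟩,
      hC.finite.subset fun k hk => ⟨hk.1, hk.2.mono hD⟩,
      fun k hk l hl hkc hlc => hC.transverse k hk l hl (hkc.mono hD) (hlc.mono hD), ?_⟩
    intro z hz
    have hzC := hC.closed z fun k hk hCk => hz k hk (hD.trans hCk)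
    rw [← hf.range_eq] at hzC
    obtain ⟨x, rfl⟩ := hzC
    refine ⟨x, fun i b hb => ?_, rfl⟩
    cases b with
    | true =>
      refine (hf.coord x i).1 (hz _ (hf.mem i) ?_)
      rintro _ ⟨y, hy, rfl⟩
      exact (hf.coord y i).2 (hy i _ hb)
    | false =>
      have := hz _ (hH.compl_mem _ (hf.mem i)) (by
        rintro _ ⟨y, hy, rfl⟩
        rw [Set.mem_compl_iff, hf.coord, hy i _ hb]; simp)
      rw [Set.mem_compl_iff, hf.coord] at this
      simpa using this

end IsWallChart

namespace IsWallCube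

/-- The walls crossing a wall cube can be crossed independently of each other. -/
theorem exists_chart (hH : IsWallspace H) {C : Set V} (hC : IsWallCube H C) :
    ∃ (n : ℕ) (h : Fin n → Set V) (f : (Fin n → Bool) → V), IsWallChart H C h f := by
  classical
  obtain ⟨x, hx⟩ := hC.nonempty
  have hT : {k | k ∈ H ∧ Crosses k C ∧ x ∈ k}.Finite :=
    hC.finite.subset fun k hk => ⟨hk.1, hk.2.1⟩
  have := hT.to_subtype
  let e := (Finite.equivFin {k | k ∈ H ∧ Crosses k C ∧ x ∈ k}).symm
  let h := fun i => (e i).1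
  have hh : ∀ i, h i ∈ H ∧ Crosses (h i) C ∧ x ∈ h i := fun i => (e i).2
  have hsurj : ∀ k ∈ H, Crosses k C → x ∈ k → ∃ i, k = h i := fun k h1 h2 h3 =>
    ⟨e.symm ⟨k, h1, h2, h3⟩, by change k = (e _).1; rw [e.apply_symm_apply]⟩
  have hinj : Function.Injective h := Subtype.val_injective.comp e.injective
  have htr : ∀ i j, h i ≠ h j → CubeComplex.Transverse (h i) (h j) := fun i j hij =>
    hC.transverse _ (hh i).1 _ (hh j).1 (hh i).2.1 (hh j).2.1 hij fun e =>
      (e ▸ (hh i).2.2 : x ∈ (h j)ᶜ) (hh j).2.2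
  have hex : ∀ a : Fin _ → Bool, ∃ y, sepWalls H x y = h '' {i | a i = false} := by
    intro a
    refine hH.exists_sep_eq ((Set.toFinite _).image h) ?_ ?_ ?_ ?_
    · rintro _ ⟨i, _, rfl⟩; exact (hh i).1
    · rintro _ ⟨i, _, rfl⟩; exact (hh i).2.2
    · rintro _ ⟨i, _, rfl⟩ k hk hxk hki
      have hck : Crosses k C := crosses_of_not_subset hx hxk fun hCk => by
        obtain ⟨z, hz⟩ := (hh i).2.1.2
        exact hz.1 (hki (hCk hz.2))
      obtain ⟨j, rfl⟩ := hsurj k hk hck hxk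
      by_contra hne
      obtain ⟨z, hz⟩ := (htr j i hne).2.1
      exact hz.2 (hki hz.1)
    · rintro _ ⟨i, _, rfl⟩ _ ⟨j, _, rfl⟩ hne hsub
      obtain ⟨z, hz⟩ := (htr i j hne).2.2.2
      exact hz.2 (hsub hz.1)
  choose f hf using hex
  have hcoord : ∀ a i, f a ∈ h i ↔ a i = true := by
    intro a i
    constructor
    · intro h1
      by_contra h2
      have h3 : h i ∈ sepWalls H x (f a) := by
        rw [hf]; exact ⟨i, (by simpa using h2 : a i = false), rfl⟩
      exact h3.2.2 h1
    · intro h1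
      by_contra h2
      have h3 : h i ∈ sepWalls H x (f a) := ⟨(hh i).1, (hh i).2.2, h2⟩
      rw [hf] at h3
      obtain ⟨j, hj, hji⟩ := h3
      rw [hinj hji, Set.mem_ofPred_eq, h1] at hj
      cases hj
  have hmem : ∀ a, f a ∈ C := by
    intro a
    refine hC.closed _ fun k hk hCk => ?_
    by_contra hak
    have : k ∈ sepWalls H x (f a) := ⟨hk, hCk hx, hak⟩
    rw [hf] at this
    obtain ⟨i, _, rfl⟩ := this
    obtain ⟨z, hz⟩ := (hh i).2.1.2
    exact hz.1 (hCk hz.2)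
  have hconst : ∀ k ∈ H, (∀ i, k ≠ h i ∧ k ≠ (h i)ᶜ) → ∀ y ∈ C, ∀ z ∈ C, y ∈ k → z ∈ k := by
    intro k hk hne y hy z hz hyk
    by_contra hzk
    have hc : Crosses k C := ⟨⟨y, hyk, hy⟩, ⟨z, hzk, hz⟩⟩
    by_cases hxk : x ∈ k
    · obtain ⟨i, hi⟩ := hsurj k hk hc hxk
      exact (hne i).1 hi
    · obtain ⟨i, hi⟩ := hsurj kᶜ (hH.compl_mem k hk) hc.compl hxk
      exact (hne i).2 (by rw [← hi, compl_compl])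
  refine ⟨_, h, f, ?_, fun i => (hh i).1, hcoord, fun k hk hne a b =>
    hconst k hk hne _ (hmem a) _ (hmem b)⟩
  refine Set.Subset.antisymm (by rintro _ ⟨a, rfl⟩; exact hmem a) fun z hz => ?_
  refine ⟨fun i => decide (z ∈ h i), hH.eq_of_forall fun k hk hak => ?_⟩
  by_cases hne : ∀ i, k ≠ h i ∧ k ≠ (h i)ᶜ
  · exact hconst k hk hne _ (hmem _) z hz hak
  · push Not at hne
    obtain ⟨i, hi⟩ := hne
    by_cases hki : k = h i
    · subst hki; simpa using (hcoord _ i).1 hak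
    · rw [hi hki] at hak ⊢
      intro h1; exact hak ((hcoord _ i).2 (by simpa using h1))

theorem inter {C D : Set V} (hC : IsWallCube H C) (hD : IsWallCube H D)
    (hne : (C ∩ D).Nonempty) : IsWallCube H (C ∩ D) where
  nonempty := hne
  finite := hC.finite.subset fun _ hk => ⟨hk.1, hk.2.mono Set.inter_subset_left⟩
  transverse h hh k hk h1 h2 := hC.transverse h hh k hk (h1.mono Set.inter_subset_left)
    (h2.mono Set.inter_subset_left)
  closed z hz := ⟨hC.closed z fun k hk hCk => hz k hk (Set.inter_subset_left.trans hCk),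
    hD.closed z fun k hk hDk => hz k hk (Set.inter_subset_right.trans hDk)⟩

theorem singleton (hH : IsWallspace H) (x : V) : IsWallCube H {x} := by
  have h1 : ∀ k : Set V, ¬ Crosses k {x} := by
    rintro k ⟨⟨_, h1, rfl⟩, ⟨_, h2, rfl⟩⟩; exact h2 h1
  refine ⟨⟨x, rfl⟩, ?_, fun h _ k _ hc => absurd hc (h1 h), fun z hz => ?_⟩
  · convert Set.finite_empty
    ext k; simp [h1]
  · exact (hH.eq_of_forall fun k hk hx => hz k hk (by simpa using hx)).symm

/-- The cube at `x` in the directions of a finite set of walls. -/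
theorem of_directions (hH : IsWallspace H) {x : V} {T : Set (Set V)} (hT : T.Finite)
    (hp : ∀ s ∈ T, ∀ t ∈ T, s ≠ t → CubeComplex.Transverse s t) :
    IsWallCube H {z | ∀ k ∈ H, x ∈ k → k ∉ T → z ∈ k} := by
  have hx : x ∈ {z | ∀ k ∈ H, x ∈ k → k ∉ T → z ∈ k} := fun k _ h _ => h
  have hc : ∀ k ∈ H, Crosses k {z | ∀ k ∈ H, x ∈ k → k ∉ T → z ∈ k} → k ∈ T ∨ kᶜ ∈ T := by
    rintro k hk ⟨⟨y, hyk, hy⟩, ⟨z, hzk, hz⟩⟩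
    by_cases hxk : x ∈ k
    · left; by_contra hkT; exact hzk (hz k hk hxk hkT)
    · right; by_contra hkT; exact hy _ (hH.compl_mem k hk) hxk hkT hyk
  refine ⟨⟨x, hx⟩, (hT.union (hT.image compl)).subset ?_, ?_, ?_⟩
  · rintro k ⟨hk, hkc⟩
    rcases hc k hk hkc with h1 | h1
    · exact Or.inl h1
    · exact Or.inr ⟨_, h1, compl_compl k⟩
  · intro h hh k hk h1 h2 hne hne'
    have hne1 : hᶜ ≠ k := fun e => hne' (by rw [← e, compl_compl])
    have hne2 : hᶜ ≠ kᶜ := fun e => hne (compl_injective e)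
    rcases hc h hh h1 with h1 | h1 <;> rcases hc k hk h2 with h2 | h2
    · exact hp h h1 k h2 hne
    · have := hp h h1 _ h2 hne'
      simp only [CubeComplex.Transverse, compl_compl] at this ⊢; tauto
    · have := hp _ h1 _ h2 hne1
      simp only [CubeComplex.Transverse, compl_compl] at this ⊢; tauto
    · have := hp _ h1 _ h2 hne2
      simp only [CubeComplex.Transverse, compl_compl] at this ⊢; tauto
  · intro z hz k hk hxk hkT
    exact hz k hk fun y hy => hy k hk hxk hkT

end IsWallCube

/-- In a 4-cycle, opposite edges cross the same wall. -/
theorem IsWallspace.sep_eq_of_fourCycle (hH : IsWallspace H) {a b c d : V} {p q r s : Set V}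
    (hab : sepWalls H a b = {p}) (hcd : sepWalls H c d = {q}) (hac : sepWalls H a c = {r})
    (hbd : sepWalls H b d = {s}) (had : a ≠ d) (hbc : b ≠ c) : p = q := by
  have hba := hH.sep_symm hab
  have hp : p ∈ sepWalls H a b := hab ▸ rfl
  have h1 : c ∈ p := by
    by_contra hc
    have hr : p ∈ sepWalls H a c := ⟨hp.1, hp.2.1, hc⟩
    rw [hac] at hr
    obtain rfl := hr
    refine hbc (hH.eq_of_forall fun k hk hbk => ?_)
    by_contra hck
    by_cases hak : a ∈ k
    · have : k ∈ sepWalls H a c := ⟨hk, hak, hck⟩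
      rw [hac] at this
      obtain rfl := this
      exact hp.2.2 hbk
    · have : k ∈ sepWalls H b a := ⟨hk, hbk, hak⟩
      rw [hba] at this
      obtain rfl := this
      exact hck hc
  have h2 : d ∉ p := by
    intro hd
    have hs : pᶜ ∈ sepWalls H b d := ⟨hH.compl_mem _ hp.1, hp.2.2, fun h => h hd⟩
    rw [hbd] at hs
    obtain rfl := hs
    refine had (hH.eq_of_forall fun k hk hak => ?_)
    by_contra hdk
    by_cases hbk : b ∈ k
    · have : k ∈ sepWalls H b d := ⟨hk, hbk, hdk⟩
      rw [hbd] at this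
      obtain rfl := this
      exact hak hp.2.1
    · have : k ∈ sepWalls H a b := ⟨hk, hak, hbk⟩
      rw [hab] at this
      obtain rfl := this
      exact hdk hd
  have : p ∈ sepWalls H c d := ⟨hp.1, h1, h2⟩
  rw [hcd] at this
  exact this

/-- A copy of the 1-skeleton of the `n`-cube spans a wall cube. -/
theorem IsWallspace.exists_isWallChart (hH : IsWallspace H) {n : ℕ} {f : (Fin n → Bool) → V}
    (hinj : Function.Injective f)
    (hadj : ∀ x i, ∃ h, sepWalls H (f x) (f (bflip i x)) = {h}) :
    ∃ h, IsWallChart H (Set.range f) h f := by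
  classical
  have hset : ∀ (y : Fin n → Bool) (i : Fin n) (b : Bool),
      bflip i (Function.update y i b) = Function.update y i (!b) := by
    intro y i b; simp [bflip]
  have hcomm : ∀ (y : Fin n → Bool) {i j : Fin n} (b : Bool), j ≠ i →
      bflip j (Function.update y i b) = Function.update (bflip j y) i b := by
    intro y i j b hij
    funext k
    by_cases hk : k = j
    · subst hk; rw [bflip_same]; simp [hij, bflip_same]
    · rw [bflip_of_ne hk]
      by_cases hk' : k = i
      · subst hk'; simp
      · simp [hk', bflip_of_ne hk]
  have hex : ∀ i, ∃ h, ∀ y, sepWalls H (f (Function.update y i true))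
      (f (Function.update y i false)) = {h} := by
    intro i
    obtain ⟨h, hh⟩ := hadj (Function.update (fun _ => true) i true) i
    rw [hset] at hh
    refine ⟨h, fun y => ?_⟩
    refine bflip_induction (p := fun y => sepWalls H (f (Function.update y i true))
      (f (Function.update y i false)) = {h}) (fun _ => true) hh ?_ y
    intro y j hy
    by_cases hij : j = i
    · subst hij
      have e : ∀ b, Function.update (bflip j y) j b = Function.update y j b := by
        intro b; simp [bflip]
      rw [e, e]; exact hy
    · obtain ⟨q, hq⟩ := hadj (Function.update (bflip j y) i true) i
      rw [hset] at hq
      obtain ⟨r, hr⟩ := hadj (Function.update y i true) j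
      obtain ⟨s, hs⟩ := hadj (Function.update y i false) j
      rw [hcomm _ _ hij] at hr hs
      have := hH.sep_eq_of_fourCycle hy hq hr hs (fun e => by
        have := congrFun (hinj e) i; simp at this) (fun e => by
        have := congrFun (hinj e) i; simp at this)
      rw [this]; exact hq
  choose h hh using hex
  have hm : ∀ i y, h i ∈ sepWalls H (f (Function.update y i true))
      (f (Function.update y i false)) := fun i y => hh i y ▸ rfl
  refine ⟨h, rfl, fun i => (hm i fun _ => true).1, ?_, ?_⟩
  · intro a i
    have h1 := hm i a
    constructor
    · intro h2
      by_contra h3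
      have e : Function.update a i false = a := by
        rw [← (by simpa using h3 : a i = false)]; simp
      rw [e] at h1; exact h1.2.2 h2
    · intro h2
      have e : Function.update a i true = a := by rw [← h2]; simp
      rw [e] at h1; exact h1.2.1
  · intro k hk hne a b ha
    refine bflip_induction (p := fun y => f y ∈ k) a ha (fun y i hy => ?_) b
    by_contra hyk
    have h1 := hh i y
    cases hb : y i with
    | true =>
      have e : Function.update y i true = y := by rw [← hb]; simp
      have e' := hset y i true
      rw [e, Bool.not_true] at e'
      rw [e, ← e'] at h1
      have : k ∈ sepWalls H (f y) (f (bflip i y)) := ⟨hk, hy, hyk⟩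
      rw [h1] at this
      exact (hne i).1 this
    | false =>
      have e : Function.update y i false = y := by rw [← hb]; simp
      have e' := hset y i false
      rw [e, Bool.not_false] at e'
      have h2 := hH.sep_symm h1
      rw [e, ← e'] at h2
      have : k ∈ sepWalls H (f y) (f (bflip i y)) := ⟨hk, hy, hyk⟩
      rw [h2] at this
      exact (hne i).2 this

end WallCube

/-! ### The cube complex of a wallspace -/

section

variable {V : Type u} {H : Set (Set V)}

namespace IsWallspace

variable (hH : IsWallspace H)
include hH

theorem eq_of_sep_eq {x y z : V} (h : sepWalls H x y = sepWalls H x z) : y = z := by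
  refine hH.eq_of_forall fun k hk hy => ?_
  by_contra hz
  by_cases hx : x ∈ k
  · have : k ∈ sepWalls H x z := ⟨hk, hx, hz⟩
    rw [← h] at this; exact this.2.2 hy
  · have : kᶜ ∈ sepWalls H x y := ⟨hH.compl_mem k hk, hx, fun h => h hy⟩
    rw [h] at this; exact this.2.2 hz

omit hH in
theorem minimal_of_sep {x y : V} {h : Set V} (hxy : sepWalls H x y = {h}) :
    ∀ k ∈ H, x ∈ k → k ⊆ h → k = h := by
  intro k hk hx hkh
  have h1 : h ∈ sepWalls H x y := hxy ▸ rfl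
  have : k ∈ sepWalls H x y := ⟨hk, hx, fun hy => h1.2.2 (hkh hy)⟩
  rwa [hxy] at this

theorem sep_subset_of_step {x y z : V} {h : Set V} (hxy : sepWalls H x y = {h}) (hz : z ∉ h) :
    sepWalls H x z = insert h (sepWalls H y z) ∧ h ∉ sepWalls H y z := by
  have h1 : h ∈ sepWalls H x y := hxy ▸ rfl
  refine ⟨?_, fun h2 => h1.2.2 h2.2.1⟩
  ext k
  constructor
  · rintro ⟨hk, hx, hzk⟩
    by_cases hy : y ∈ k
    · exact Or.inr ⟨hk, hy, hzk⟩
    · left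
      have : k ∈ sepWalls H x y := ⟨hk, hx, hy⟩
      rwa [hxy] at this
  · rintro (rfl | ⟨hk, hy, hzk⟩)
    · exact ⟨h1.1, h1.2.1, hz⟩
    · refine ⟨hk, ?_, hzk⟩
      by_contra hx
      have : k ∈ sepWalls H y x := ⟨hk, hy, hx⟩
      rw [hH.sep_symm hxy] at this
      obtain rfl := this
      exact hzk hz

theorem wallDist_step {x y z : V} {h : Set V} (hxy : sepWalls H x y = {h}) (hz : z ∉ h) :
    wallDist H x z = wallDist H y z + 1 := by
  obtain ⟨h1, h2⟩ := hH.sep_subset_of_step hxy hz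
  rw [wallDist, h1, Set.ncard_insert_of_notMem h2 (hH.finite_sep y z), wallDist]

theorem mem_iff_wallDist_lt {x y v : V} {h : Set V} (hxy : sepWalls H x y = {h}) :
    v ∈ h ↔ wallDist H v x < wallDist H v y := by
  rw [hH.wallDist_comm v, hH.wallDist_comm v]
  by_cases hv : v ∈ h
  · have := hH.wallDist_step (hH.sep_symm hxy) (fun h => h hv : v ∉ hᶜ)
    simp [hv, this]
  · have := hH.wallDist_step hxy hv
    simp [hv, this]

theorem exists_edge [hV : Nonempty V] {h : Set V} (hh : h ∈ H) : ∃ x y, sepWalls H x y = {h} := by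
  refine hH.exists_sep_eq_of_transverse (Set.finite_singleton h) (by simpa using hh) hV ?_
  rintro s rfl t rfl h; exact absurd rfl h

theorem isWallCube_pair_iff {x y : V} (hxy : x ≠ y) :
    IsWallCube H {x, y} ↔ ∃ h, sepWalls H x y = {h} := by
  constructor
  · intro hc
    obtain ⟨z, h, h1, h2, -⟩ := hH.exists_step hxy
    have hzm : h ∈ sepWalls H x z := h2 ▸ rfl
    have hz : z ∈ ({x, y} : Set V) := by
      refine hc.closed z fun k hk hxyk => ?_
      by_contra hzk
      have : k ∈ sepWalls H x z := ⟨hk, hxyk (by simp), hzk⟩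
      rw [h2] at this
      obtain rfl := this
      exact h1.2.2 (hxyk (by simp))
    rcases hz with rfl | rfl
    · exact absurd hzm.2.1 hzm.2.2
    · exact ⟨h, h2⟩
  · rintro ⟨h, hh⟩
    have := IsWallCube.of_directions hH (x := x) (Set.finite_singleton h) (by
      rintro s rfl t rfl h; exact absurd rfl h)
    convert this using 1
    ext z
    constructor
    · rintro (rfl | rfl) k hk hx hkh
      · exact hx
      · by_contra hyk
        have : k ∈ sepWalls H x z := ⟨hk, hx, hyk⟩
        rw [hh] at this; exact hkh this
    · intro hz
      have hsub : sepWalls H x z ⊆ {h} := by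
        rintro k ⟨hk, hx, hzk⟩
        by_contra hkh
        exact hzk (hz k hk hx hkh)
      rcases Set.subset_singleton_iff_eq.1 hsub with h1 | h1
      · exact Or.inl (hH.eq_of_sep _ _ h1).symm
      · exact Or.inr (hH.eq_of_sep_eq (h1.trans hh.symm))

/-- Two transverse walls adjacent to a vertex span a square. -/
theorem exists_square {a b c : V} {p q : Set V} (hab : sepWalls H a b = {p})
    (hac : sepWalls H a c = {q}) (hpq : CubeComplex.Transverse p q) :
    ∃ d, sepWalls H b d = {q} ∧ sepWalls H c d = {p} ∧ IsWallCube H {a, b, c, d} := by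
  have hne : p ≠ q := by
    rintro rfl
    obtain ⟨z, h1, h2⟩ := hpq.2.1
    exact h2 h1
  have hp : p ∈ sepWalls H a b := hab ▸ rfl
  have hq : q ∈ sepWalls H a c := hac ▸ rfl
  obtain ⟨d, hd⟩ := hH.exists_sep_eq (x := a) (T := {p, q}) (Set.toFinite _)
    (by rintro _ (rfl | rfl); exacts [hp.1, hq.1]) (by rintro _ (rfl | rfl); exacts [hp.2.1, hq.2.1])
    (by rintro _ (rfl | rfl); exacts [minimal_of_sep hab, minimal_of_sep hac]) (by
      obtain ⟨z, h1, h2⟩ := hpq.2.2.2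
      rintro _ (rfl | rfl) _ (rfl | rfl) h3 h4
      exacts [h3 rfl, h2 (h4 h1), h1 (h4 h2), h3 rfl])
  have hpd : p ∈ sepWalls H a d := by rw [hd]; simp
  have hqd : q ∈ sepWalls H a d := by rw [hd]; simp
  have key : ∀ {b : V} {p q : Set V}, sepWalls H a b = {p} → p ≠ q → sepWalls H a d = {p, q} →
      sepWalls H b d = {q} := by
    intro b p q hab hne hd
    have hpd : p ∈ sepWalls H a d := by rw [hd]; simp
    obtain ⟨h1, h2⟩ := hH.sep_subset_of_step hab hpd.2.2
    rw [hd] at h1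
    ext k
    constructor
    · intro hk
      have : k ∈ ({p, q} : Set (Set V)) := h1 ▸ Or.inr hk
      rcases this with rfl | h3
      · exact absurd hk h2
      · exact h3
    · rintro rfl
      have : k ∈ insert p (sepWalls H b d) := h1 ▸ (by simp)
      rcases this with h3 | h3
      · exact absurd h3.symm hne
      · exact h3
  refine ⟨d, key hab hne hd, key hac hne.symm (by rw [hd, Set.pair_comm]), ?_⟩
  have := IsWallCube.of_directions hH (x := a) (T := {p, q}) (Set.toFinite _) (by
    rintro s (rfl | rfl) t (rfl | rfl) h
    · exact absurd rfl h
    · exact hpq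
    · obtain ⟨h1, h2, h3, h4⟩ := hpq
      simp only [CubeComplex.Transverse, Set.inter_comm s] at *
      rw [Set.inter_comm sᶜ, Set.inter_comm sᶜ]
      exact ⟨h1, h3, h2, h4⟩
    · exact absurd rfl h)
  convert this using 1
  ext z
  constructor
  · rintro (rfl | rfl | rfl | rfl) k hk hx hkh
    · exact hx
    all_goals
      by_contra hyk
      have : k ∈ sepWalls H a z := ⟨hk, hx, hyk⟩
    · rw [hab] at this; exact hkh (Or.inl this)
    · rw [hac] at this; exact hkh (Or.inr this)
    · rw [hd] at this; exact hkh this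
  · intro hz
    have hsub : sepWalls H a z ⊆ {p, q} := by
      rintro k ⟨hk, hx, hzk⟩
      by_contra hkh
      exact hzk (hz k hk hx hkh)
    rcases Set.subset_pair_iff_eq.1 hsub with h1 | h1 | h1 | h1
    · exact Or.inl (hH.eq_of_sep _ _ h1).symm
    · exact Or.inr (Or.inl (hH.eq_of_sep_eq (h1.trans hab.symm)))
    · exact Or.inr (Or.inr (Or.inl (hH.eq_of_sep_eq (h1.trans hac.symm))))
    · exact Or.inr (Or.inr (Or.inr (hH.eq_of_sep_eq (h1.trans hd.symm))))

end IsWallspace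

/-- The cube complex of a wallspace. -/
def CubeComplex.ofWalls (hH : IsWallspace H) : CubeComplex V where
  cubes := {C | IsWallCube H C}
  singleton_mem := IsWallCube.singleton hH
  exists_chart C hC := by
    obtain ⟨n, h, f, hf⟩ := hC.exists_chart hH
    exact ⟨n, f, hf.injective, hf.range_eq, fun D hD => hf.isWallCube_iff hH hD⟩
  inter_mem _ hC _ hD hne := hC.inter hD hne

namespace CubeComplex

variable (X : CubeComplex V)

/-- `X` is the cube complex of the wallspace `H`. -/
structure IsDual (X : CubeComplex V) (H : Set (Set V)) : Prop where
  wallspace : IsWallspace H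
  cubes_iff : ∀ C, C ∈ X.cubes ↔ IsWallCube H C

theorem isDual_ofWalls (hH : IsWallspace H) : (ofWalls hH).IsDual H := ⟨hH, fun _ => Iff.rfl⟩

variable {X}

theorem PathHomotopic.cons_congr {x y z : V} (h : X.graph.Adj x y) {p q : X.graph.Walk y z}
    (hpq : X.PathHomotopic p q) : X.PathHomotopic (.cons h p) (.cons h q) := by
  induction hpq with
  | refl p => exact .refl _
  | symm _ ih => exact ih.symm
  | trans _ _ ih1 ih2 => exact ih1.trans ih2
  | backtrack p h' q => exact .backtrack (.cons h p) h' q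
  | square p hab hbd hac hcd hsq q => exact .square (.cons h p) hab hbd hac hcd hsq q

namespace IsDual

variable (hX : X.IsDual H)
include hX

theorem adj_iff {x y : V} : X.graph.Adj x y ↔ ∃ h, sepWalls H x y = {h} := by
  constructor
  · intro h
    exact (hX.wallspace.isWallCube_pair_iff h.1).1 ((hX.cubes_iff _).1 h.2)
  · rintro ⟨h, hh⟩
    have hne : x ≠ y := by
      rintro rfl
      have : h ∈ sepWalls H x x := hh ▸ rfl
      exact this.2.2 this.2.1
    exact ⟨hne, (hX.cubes_iff _).2 ((hX.wallspace.isWallCube_pair_iff hne).2 ⟨h, hh⟩)⟩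

theorem exists_walk (x y : V) : ∃ p : X.graph.Walk x y, p.length = wallDist H x y := by
  induction hn : wallDist H x y generalizing x with
  | zero =>
    obtain rfl := hX.wallspace.wallDist_eq_zero hn
    exact ⟨.nil, rfl⟩
  | succ n ih =>
    have hxy : x ≠ y := by
      rintro rfl
      have : sepWalls H x x = ∅ := Set.eq_empty_of_forall_notMem fun k hk => hk.2.2 hk.2.1
      rw [wallDist, this, Set.ncard_empty] at hn; omega
    obtain ⟨z, h, h1, h2, -⟩ := hX.wallspace.exists_step hxy
    have := hX.wallspace.wallDist_step h2 h1.2.2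
    obtain ⟨p, hp⟩ := ih z (by omega)
    exact ⟨.cons (hX.adj_iff.2 ⟨h, h2⟩) p, by simp [hp]⟩

theorem wallDist_le_length {x y : V} (p : X.graph.Walk x y) : wallDist H x y ≤ p.length := by
  induction p with
  | nil =>
    rename_i x
    have : sepWalls H x x = ∅ := Set.eq_empty_of_forall_notMem fun k hk => hk.2.2 hk.2.1
    simp [wallDist, this]
  | cons h p ih =>
    rename_i x y z
    obtain ⟨k, hk⟩ := hX.adj_iff.1 h
    have h1 := hX.wallspace.wallDist_triangle x y z
    have h2 : wallDist H x y = 1 := by rw [wallDist, hk, Set.ncard_singleton]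
    rw [SimpleGraph.Walk.length_cons]; omega

theorem connected [Nonempty V] : X.graph.Connected :=
  ⟨fun x y => ⟨(hX.exists_walk x y).choose⟩⟩

theorem dist_eq (x y : V) : X.graph.dist x y = wallDist H x y := by
  obtain ⟨p, hp⟩ := hX.exists_walk x y
  have : Nonempty V := ⟨x⟩
  obtain ⟨q, hq⟩ := hX.connected.exists_walk_length_eq_dist x y
  exact le_antisymm (hp ▸ SimpleGraph.dist_le p) (hq ▸ hX.wallDist_le_length q)

theorem edist_eq (x y : V) : X.graph.edist x y = wallDist H x y := by
  obtain ⟨p, hp⟩ := hX.exists_walk x y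
  rw [← hX.dist_eq, SimpleGraph.Reachable.coe_dist_eq_edist ⟨p⟩]

theorem mem_nbhd_iff {r : ℕ} {A : Set V} {x : V} :
    x ∈ X.nbhd r A ↔ ∃ a ∈ A, wallDist H x a ≤ r := by
  simp only [nbhd, Set.mem_ofPred_eq, hX.edist_eq, Nat.cast_le]

/-- The edge `e` crosses the wall of `h`. -/
theorem sep_iff_of_oppositeEdges {e f : Sym2 V} (hef : X.OppositeEdges e f) (h : Set V) :
    (∃ a b, e = s(a, b) ∧ sepWalls H a b = {h}) ↔ ∃ a b, f = s(a, b) ∧ sepWalls H a b = {h} := by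
  obtain ⟨a, b, c, d, rfl, rfl, hab, hcd, hac, hbd, hsq⟩ := hef
  by_cases had : a = d
  · subst had
    by_cases hbc : b = c
    · subst hbc; rw [Sym2.eq_swap]
    · have e : ({a, b, c, a} : Set V) = {a, b, c} := by
        ext z; simp only [Set.mem_insert_iff, Set.mem_singleton_iff]; tauto
      rw [e] at hsq
      exact absurd hsq (triple_notMem_cubes hab.1 hac.1 hbc)
  by_cases hbc : b = c
  · subst hbc
    have e : ({a, b, b, d} : Set V) = {a, b, d} := by
      ext z; simp only [Set.mem_insert_iff, Set.mem_singleton_iff]; tauto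
    rw [e] at hsq
    exact absurd hsq (triple_notMem_cubes hab.1 had hbd.1)
  obtain ⟨p, hp⟩ := hX.adj_iff.1 hab
  obtain ⟨q, hq⟩ := hX.adj_iff.1 hcd
  obtain ⟨r, hr⟩ := hX.adj_iff.1 hac
  obtain ⟨s, hs⟩ := hX.adj_iff.1 hbd
  obtain rfl := hX.wallspace.sep_eq_of_fourCycle hp hq hr hs had hbc
  have hp' := hX.wallspace.sep_symm hp
  have hq' := hX.wallspace.sep_symm hq
  have aux : ∀ {a b : V}, sepWalls H a b = {p} → sepWalls H b a = {pᶜ} →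
      ((∃ x y, s(a, b) = s(x, y) ∧ sepWalls H x y = {h}) ↔ h = p ∨ h = pᶜ) := by
    intro a b h1 h2
    constructor
    · rintro ⟨x, y, hxy, h3⟩
      rcases Sym2.eq_iff.1 hxy with ⟨rfl, rfl⟩ | ⟨rfl, rfl⟩
      · rw [h1] at h3; exact Or.inl (Set.singleton_eq_singleton_iff.1 h3).symm
      · rw [h2] at h3; exact Or.inr (Set.singleton_eq_singleton_iff.1 h3).symm
    · rintro (rfl | rfl)
      · exact ⟨a, b, rfl, h1⟩
      · exact ⟨b, a, Sym2.eq_swap, h2⟩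
  rw [aux hp hp', aux hq hq']

/-- Edges crossing the same wall are dual to the same hyperplane. -/
theorem eqvGen_of_sep {a b c d : V} {h : Set V} (hab : sepWalls H a b = {h})
    (hcd : sepWalls H c d = {h}) : Relation.EqvGen X.OppositeEdges s(a, b) s(c, d) := by
  have hH := hX.wallspace
  induction hn : wallDist H a c generalizing a b with
  | zero =>
    obtain rfl := hH.wallDist_eq_zero hn
    obtain rfl := hH.eq_of_sep_eq (hab.trans hcd.symm)
    exact .refl _
  | succ n ih =>
    have hac : a ≠ c := by
      rintro rfl
      have : sepWalls H a a = ∅ := Set.eq_empty_of_forall_notMem fun k hk => hk.2.2 hk.2.1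
      rw [wallDist, this, Set.ncard_empty] at hn; omega
    obtain ⟨z, k, h1, h2, -⟩ := hH.exists_step hac
    have ha : h ∈ sepWalls H a b := hab ▸ rfl
    have hc : h ∈ sepWalls H c d := hcd ▸ rfl
    have hbk : b ∈ k := by
      by_contra hb
      have : k ∈ sepWalls H a b := ⟨h1.1, h1.2.1, hb⟩
      rw [hab] at this
      obtain rfl := this
      exact h1.2.2 hc.2.1
    have hdk : d ∉ k := by
      intro hd
      have : k ∈ sepWalls H d c := ⟨h1.1, hd, h1.2.2⟩
      rw [hH.sep_symm hcd] at this
      obtain rfl := this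
      exact h1.2.1 ha.2.1
    obtain ⟨w, hw1, hw2, hw3⟩ := hH.exists_square hab h2
      ⟨⟨a, ha.2.1, h1.2.1⟩, ⟨c, hc.2.1, h1.2.2⟩, ⟨b, ha.2.2, hbk⟩, ⟨d, hc.2.2, hdk⟩⟩
    have hz := hH.wallDist_step h2 h1.2.2
    refine .trans _ _ _ (.rel _ _ ⟨a, b, z, w, rfl, rfl, hX.adj_iff.2 ⟨_, hab⟩,
      hX.adj_iff.2 ⟨_, hw2⟩, hX.adj_iff.2 ⟨_, h2⟩, hX.adj_iff.2 ⟨_, hw1⟩,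
      (hX.cubes_iff _).2 ?_⟩) (ih hw2 (by omega))
    exact hw3

theorem mem_dualEdges_iff {a b c d : V} {h : Set V} (hab : sepWalls H a b = {h}) :
    s(c, d) ∈ X.dualEdges s(a, b) ↔ sepWalls H c d = {h} ∨ sepWalls H d c = {h} := by
  constructor
  · intro hm
    have key : ∀ e f, Relation.EqvGen X.OppositeEdges e f →
        ((∃ a b, e = s(a, b) ∧ sepWalls H a b = {h}) ↔
          ∃ a b, f = s(a, b) ∧ sepWalls H a b = {h}) := by
      intro e f hef
      induction hef with
      | rel e f h => exact hX.sep_iff_of_oppositeEdges h _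
      | refl => rfl
      | symm _ _ _ ih => exact ih.symm
      | trans _ _ _ _ _ ih1 ih2 => exact ih1.trans ih2
    obtain ⟨x, y, hxy, hs⟩ := (key _ _ hm).1 ⟨a, b, rfl, hab⟩
    rcases Sym2.eq_iff.1 hxy with ⟨rfl, rfl⟩ | ⟨rfl, rfl⟩
    · exact Or.inl hs
    · exact Or.inr hs
  · rintro (h1 | h1)
    · exact hX.eqvGen_of_sep hab h1
    · have := hX.eqvGen_of_sep hab h1
      rwa [Sym2.eq_swap (a := d)] at this

/-- The components left after removing the edges that cross a wall are its two sides. -/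
theorem supp_eq {a b x : V} {h g : Set V} (hab : sepWalls H a b = {h}) (hg : g = h ∨ g = hᶜ)
    (hx : x ∈ g) : ((X.graph.deleteEdges (X.dualEdges s(a, b))).connectedComponentMk x).supp = g := by
  have hH := hX.wallspace
  have hhH : h ∈ H := (hab ▸ rfl : h ∈ sepWalls H a b).1
  have hgH : g ∈ H := by
    rcases hg with rfl | rfl
    exacts [hhH, hH.compl_mem _ hhH]
  have h1 : ∀ u v, (X.graph.deleteEdges (X.dualEdges s(a, b))).Adj u v → u ∈ g → v ∈ g := by
    intro u v huv hu
    rw [SimpleGraph.deleteEdges_adj, hX.mem_dualEdges_iff hab] at huv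
    obtain ⟨k, hk⟩ := hX.adj_iff.1 huv.1
    by_contra hv
    have : g ∈ sepWalls H u v := ⟨hgH, hu, hv⟩
    rw [hk] at this
    obtain rfl := this
    refine huv.2 ?_
    rcases hg with rfl | rfl
    · exact Or.inl hk
    · right; rw [hH.sep_symm hk, compl_compl]
  have h2 : ∀ n u v, wallDist H u v = n → u ∈ g → v ∈ g →
      (X.graph.deleteEdges (X.dualEdges s(a, b))).Reachable u v := by
    intro n
    induction n with
    | zero =>
      intro u v huv _ _
      rw [hH.wallDist_eq_zero huv]
    | succ n ih =>
      intro u v huv hu hv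
      have hne : u ≠ v := by
        rintro rfl
        have : sepWalls H u u = ∅ := Set.eq_empty_of_forall_notMem fun k hk => hk.2.2 hk.2.1
        rw [wallDist, this, Set.ncard_empty] at huv; omega
      obtain ⟨z, k, hk, hz, -⟩ := hH.exists_step hne
      have hzd := hH.wallDist_step hz hk.2.2
      have hkg : k ≠ g := by rintro rfl; exact hk.2.2 hv
      have hkg' : k ≠ gᶜ := by rintro rfl; exact hk.2.1 hu
      have hzg : z ∈ g := by
        by_contra hzg
        have : g ∈ sepWalls H u z := ⟨hgH, hu, hzg⟩
        rw [hz] at this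
        exact hkg this.symm
      refine SimpleGraph.Reachable.trans (SimpleGraph.Adj.reachable ?_) (ih z v (by omega) hzg hv)
      rw [SimpleGraph.deleteEdges_adj, hX.mem_dualEdges_iff hab]
      refine ⟨hX.adj_iff.2 ⟨k, hz⟩, ?_⟩
      rw [hH.sep_symm hz, hz, Set.singleton_eq_singleton_iff, Set.singleton_eq_singleton_iff]
      rintro (rfl | h3)
      · rcases hg with rfl | rfl
        · exact hkg rfl
        · exact hkg' (compl_compl _).symm
      · rcases hg with rfl | rfl
        · exact hkg' (by rw [← h3, compl_compl])
        · exact hkg (by rw [← h3, compl_compl])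
  ext y
  rw [SimpleGraph.ConnectedComponent.mem_supp_iff, SimpleGraph.ConnectedComponent.eq]
  constructor
  · rintro ⟨p⟩
    have : ∀ {u v} (_ : (X.graph.deleteEdges (X.dualEdges s(a, b))).Walk u v), v ∈ g → u ∈ g := by
      intro u v p hv
      induction p with
      | nil => exact hv
      | cons h _ ih => exact h1 _ _ h.symm (ih hv)
    exact this p hx
  · intro hy; exact h2 _ y x rfl hy hx

theorem isHalfspace_iff {h : Set V} : X.IsHalfspace h ↔ h ∈ H := by
  have hH := hX.wallspace
  constructor
  · rintro ⟨e, he, c, c', h1, -⟩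
    induction e with
    | _ x y =>
    obtain ⟨k, hk⟩ := hX.adj_iff.1 he
    have hkH : k ∈ H := (hk ▸ rfl : k ∈ sepWalls H x y).1
    induction c using SimpleGraph.ConnectedComponent.ind with
    | _ a =>
    by_cases ha : a ∈ k
    · rw [hX.supp_eq hk (Or.inl rfl) ha] at h1; rwa [h1]
    · rw [hX.supp_eq hk (Or.inr rfl) ha] at h1; rw [h1]; exact hH.compl_mem _ hkH
  · intro hh
    have : Nonempty V := (hH.nonempty h hh).nonempty
    obtain ⟨x, y, hxy⟩ := hH.exists_edge hh
    have hm : h ∈ sepWalls H x y := hxy ▸ rfl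
    exact ⟨s(x, y), hX.adj_iff.2 ⟨_, hxy⟩, _, _, (hX.supp_eq hxy (Or.inl rfl) hm.2.1).symm,
      (hX.supp_eq hxy (Or.inr rfl) hm.2.2).symm⟩

/-- Geodesics with the same endpoints are homotopic. -/
theorem pathHomotopic_of_geodesic {x y : V} (p q : X.graph.Walk x y)
    (hp : p.length = wallDist H x y) (hq : q.length = wallDist H x y) :
    X.PathHomotopic p q := by
  have hH := hX.wallspace
  induction hn : wallDist H x y generalizing x with
  | zero =>
    cases p with
    | cons => simp at hp; omega
    | nil =>
      cases q with
      | cons => simp at hq; omega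
      | nil => exact .refl _
  | succ n ih =>
    cases p with
    | nil => simp at hp; omega
    | @cons _ a _ hxa p =>
      cases q with
      | nil => simp at hq; omega
      | @cons _ b _ hxb q =>
        simp only [SimpleGraph.Walk.length_cons] at hp hq
        have e1 := hX.wallDist_le_length p
        have e2 := hX.wallDist_le_length q
        obtain ⟨k, hk⟩ := hX.adj_iff.1 hxa
        obtain ⟨l, hl⟩ := hX.adj_iff.1 hxb
        have hkm : k ∈ sepWalls H x a := hk ▸ rfl
        have hlm : l ∈ sepWalls H x b := hl ▸ rfl
        have out : ∀ {a : V} {k : Set V}, sepWalls H x a = {k} → wallDist H a y ≤ n → y ∉ k := by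
          intro a k hk ha hy
          have := hH.wallDist_step (hH.sep_symm hk) (fun h => h hy : y ∉ kᶜ)
          omega
        have hyk := out hk (by omega)
        have hyl := out hl (by omega)
        have d1 := hH.wallDist_step hk hyk
        have d2 := hH.wallDist_step hl hyl
        by_cases hkl : k = l
        · subst hkl
          obtain rfl := hH.eq_of_sep_eq (hk.trans hl.symm)
          exact (ih p q (by omega) (by omega) (by omega)).cons_congr _
        · have hbk : b ∈ k := by
            by_contra hb
            have : k ∈ sepWalls H x b := ⟨hkm.1, hkm.2.1, hb⟩
            rw [hl] at this; exact hkl this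
          have hal : a ∈ l := by
            by_contra ha
            have : l ∈ sepWalls H x a := ⟨hlm.1, hlm.2.1, ha⟩
            rw [hk] at this; exact hkl this.symm
          obtain ⟨d, hd1, hd2, hd3⟩ := hH.exists_square hk hl
            ⟨⟨x, hkm.2.1, hlm.2.1⟩, ⟨b, hbk, hlm.2.2⟩, ⟨a, hkm.2.2, hal⟩, ⟨y, hyk, hyl⟩⟩
          have d3 := hH.wallDist_step hd1 hyl
          obtain ⟨r, hr⟩ := hX.exists_walk d y
          have had := hX.adj_iff.2 ⟨_, hd1⟩
          have hbd := hX.adj_iff.2 ⟨_, hd2⟩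
          have h1 := ih p (.cons had r) (by omega)
            (by rw [SimpleGraph.Walk.length_cons]; omega) (by omega)
          have h2 := ih q (.cons hbd r) (by omega)
            (by rw [SimpleGraph.Walk.length_cons]; omega) (by omega)
          refine (h1.cons_congr hxa).trans (.trans ?_ (h2.cons_congr hxb).symm)
          exact .square .nil hxa had hxb hbd ((hX.cubes_iff _).2 hd3) r

theorem exists_geodesic_pathHomotopic {x y : V} (p : X.graph.Walk x y) :
    ∃ q : X.graph.Walk x y, q.length = wallDist H x y ∧ X.PathHomotopic p q := by
  have hH := hX.wallspace
  induction p with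
  | nil =>
    rename_i x
    have : sepWalls H x x = ∅ := Set.eq_empty_of_forall_notMem fun k hk => hk.2.2 hk.2.1
    exact ⟨.nil, by simp [wallDist, this], .refl _⟩
  | @cons x a y h p ih =>
    obtain ⟨g, hg, hpg⟩ := ih
    obtain ⟨k, hk⟩ := hX.adj_iff.1 h
    by_cases hy : y ∈ k
    · have d1 := hH.wallDist_step (hH.sep_symm hk) (fun h => h hy : y ∉ kᶜ)
      obtain ⟨r, hr⟩ := hX.exists_walk x y
      have h1 := hX.pathHomotopic_of_geodesic g (.cons h.symm r) hg
        (by rw [SimpleGraph.Walk.length_cons]; omega)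
      exact ⟨r, hr, (hpg.cons_congr h).trans ((h1.cons_congr h).trans (.backtrack .nil h r))⟩
    · have d1 := hH.wallDist_step hk hy
      exact ⟨.cons h g, by rw [SimpleGraph.Walk.length_cons]; omega, hpg.cons_congr h⟩

theorem isCAT0 [Nonempty V] : X.IsCAT0 where
  connected := hX.connected
  simplyConnected p q := by
    obtain ⟨p', h1, h2⟩ := hX.exists_geodesic_pathHomotopic p
    obtain ⟨q', h3, h4⟩ := hX.exists_geodesic_pathHomotopic q
    exact h2.trans ((hX.pathHomotopic_of_geodesic p' q' h1 h3).trans h4.symm)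
  flagLinks x S hS hpair := by
    choose! t ht using fun a ha => hX.adj_iff.1 (hS a ha)
    have hm : ∀ a ∈ S, t a ∈ sepWalls H x a := fun a ha => ht a ha ▸ rfl
    have hc := IsWallCube.of_directions hX.wallspace (x := x) (T := t '' S) (Set.toFinite _) (by
      rintro _ ⟨a, ha, rfl⟩ _ ⟨b, hb, rfl⟩ hne
      obtain ⟨C, hC, hxC, haC, hbC⟩ := hpair a ha b hb
      refine ((hX.cubes_iff C).1 hC).transverse _ (hm a ha).1 _ (hm b hb).1
        ⟨⟨x, (hm a ha).2.1, hxC⟩, ⟨a, (hm a ha).2.2, haC⟩⟩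
        ⟨⟨x, (hm b hb).2.1, hxC⟩, ⟨b, (hm b hb).2.2, hbC⟩⟩ hne fun e => ?_
      exact (e ▸ (hm a ha).2.1 : x ∈ (t b)ᶜ) (hm b hb).2.1)
    refine ⟨_, (hX.cubes_iff _).2 hc, fun k _ h _ => h, fun a ha k hk hxk hkT => ?_⟩
    by_contra hak
    have : k ∈ sepWalls H x a := ⟨hk, hxk, hak⟩
    rw [ht a ha] at this
    exact hkT ⟨a, ha, this.symm⟩

end IsDual

end CubeComplex

end

/-! ### CAT(0) cube complexes are dual to their wallspaces -/

namespace CubeComplex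

variable {V : Type u} (X : CubeComplex V)

/-- The vertices closer to `a` than to `b`. -/
def side (a b : V) : Set V := {v | X.graph.dist v a < X.graph.dist v b}

/-- The sets of vertices on one side of an edge. -/
def sides : Set (Set V) := {h | ∃ a b, X.graph.Adj a b ∧ h = X.side a b}

variable {X}

namespace IsCAT0

variable (hX : X.IsCAT0)
include hX

theorem dist_or (v : V) {a b : V} (h : X.graph.Adj a b) :
    X.graph.dist v b = X.graph.dist v a + 1 ∨ X.graph.dist v a = X.graph.dist v b + 1 := by
  have h1 := hX.dist_ne v h
  have h2 := hX.connected.dist_triangle (u := v) (v := a) (w := b)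
  have h3 := hX.connected.dist_triangle (u := v) (v := b) (w := a)
  rw [SimpleGraph.dist_eq_one_iff_adj.2 h] at h2
  rw [SimpleGraph.dist_eq_one_iff_adj.2 h.symm] at h3
  omega

theorem exists_closer {x y : V} (h : x ≠ y) :
    ∃ z, X.graph.Adj x z ∧ X.graph.dist y x = X.graph.dist y z + 1 := by
  obtain ⟨p, hp⟩ := hX.connected.exists_walk_length_eq_dist x y
  cases p with
  | nil => exact absurd rfl h
  | @cons _ z _ hz p =>
    refine ⟨z, hz, ?_⟩
    have h1 := SimpleGraph.dist_le p
    rw [SimpleGraph.Walk.length_cons] at hp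
    rw [SimpleGraph.dist_comm (u := y), SimpleGraph.dist_comm (u := y)]
    have h2 := hX.dist_or y hz
    rw [SimpleGraph.dist_comm (u := y), SimpleGraph.dist_comm (u := y)] at h2
    omega

theorem side_compl {a b : V} (h : X.graph.Adj a b) : (X.side a b)ᶜ = X.side b a := by
  ext v
  have := hX.dist_ne v h
  simp only [side, Set.mem_compl_iff, Set.mem_ofPred_eq]; omega

theorem side_eq_of_sq {a b c d : V} (hs : X.Sq a b c d) : X.side a b = X.side c d := by
  have key : ∀ {a b c d : V}, X.Sq a b c d → X.side a b ⊆ X.side c d := by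
    intro a b c d hs v hv
    by_contra hv'
    simp only [side, Set.mem_ofPred_eq] at hv hv'
    have h1 := hX.dist_or v hs.ab
    have h2 := hX.dist_or v hs.cd
    have h3 := hX.dist_or v hs.ac
    have h4 := hX.dist_or v hs.bd
    obtain ⟨c', hc, hc'⟩ := hX.quadrangle (v := v) hs.ab hs.bd.symm hs.ad_ne (by omega) (by omega)
    obtain rfl := hs.rot.unique hc.rev
    omega
  exact (key hs).antisymm (key hs.swap.rot.swap)

/-- The sides of an edge agree with the sides of any edge that they separate. -/
theorem side_eq_of_mem {a b u v : V} (hab : X.graph.Adj a b) (huv : X.graph.Adj u v)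
    (hu : u ∈ X.side a b) (hv : v ∉ X.side a b) : X.side u v = X.side a b := by
  induction hn : X.graph.dist u a using Nat.strong_induction_on generalizing u v with
  | _ n ih =>
    simp only [side, Set.mem_ofPred_eq] at hu hv
    have h1 := hX.dist_or u hab
    have h2 := hX.dist_or v hab
    have h3 := hX.dist_or a huv
    have h4 := hX.dist_or b huv
    simp only [SimpleGraph.dist_comm (u := a), SimpleGraph.dist_comm (u := b)] at h3 h4
    rcases Nat.eq_zero_or_pos n with h0 | h0
    · have e1 : u = a := (hX.connected u a).dist_eq_zero_iff.1 (by omega)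
      have e2 : v = b := (hX.connected v b).dist_eq_zero_iff.1 (by omega)
      rw [e1, e2]
    · have hvb : v ≠ b := by
        rintro rfl
        rw [SimpleGraph.dist_self] at *; omega
      obtain ⟨v', hv1, hv2⟩ := hX.exists_closer hvb
      have h5 := hX.dist_or v' hab
      have h6 := hX.dist_or a hv1
      have hne : u ≠ v' := by
        rintro rfl
        rw [SimpleGraph.dist_comm, SimpleGraph.dist_comm (u := b)] at hv2; omega
      rw [SimpleGraph.dist_comm, SimpleGraph.dist_comm (u := b)] at hv2
      rw [SimpleGraph.dist_comm, SimpleGraph.dist_comm (u := a)] at h6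
      obtain ⟨u', hu1, hu2⟩ := hX.quadrangle (v := a) huv hv1.symm hne
        (by rw [SimpleGraph.dist_comm, SimpleGraph.dist_comm (u := a)]; omega)
        (by rw [SimpleGraph.dist_comm, SimpleGraph.dist_comm (u := a)]; omega)
      rw [SimpleGraph.dist_comm, SimpleGraph.dist_comm (u := a)] at hu2
      have h7 := hX.dist_or u' hab
      have h8 := hX.dist_or b hu1.ab
      rw [SimpleGraph.dist_comm, SimpleGraph.dist_comm (u := b)] at h8
      rw [← ih (X.graph.dist u' a) (by omega) hu1.ac
        (by simp only [side, Set.mem_ofPred_eq]; omega)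
        (by simp only [side, Set.mem_ofPred_eq]; omega) rfl]
      exact (hX.side_eq_of_sq hu1.swap).symm

omit hX in
theorem mem_side {a b : V} (h : X.graph.Adj a b) : a ∈ X.side a b := by
  simp only [side, Set.mem_ofPred_eq, SimpleGraph.dist_self]
  rw [SimpleGraph.dist_eq_one_iff_adj.2 h]; exact one_pos

omit hX in
theorem notMem_side (a b : V) : b ∉ X.side a b := by
  simp [side]

theorem sep_of_adj {x y : V} (h : X.graph.Adj x y) : sepWalls X.sides x y = {X.side x y} := by
  ext k
  constructor
  · rintro ⟨⟨a, b, hab, rfl⟩, hx, hy⟩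
    exact (hX.side_eq_of_mem hab h hx hy).symm
  · rintro rfl
    exact ⟨⟨x, y, h, rfl⟩, mem_side h, notMem_side x y⟩

theorem isWallspace : IsWallspace X.sides where
  compl_mem := by
    rintro _ ⟨a, b, hab, rfl⟩
    exact ⟨b, a, hab.symm, hX.side_compl hab⟩
  nonempty := by
    rintro _ ⟨a, b, hab, rfl⟩
    exact ⟨a, mem_side hab⟩
  finite_sep x y := by
    obtain ⟨p⟩ := hX.connected x y
    induction p with
    | nil =>
      convert Set.finite_empty
      exact Set.eq_empty_of_forall_notMem fun k hk => hk.2.2 hk.2.1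
    | @cons x a y h p ih =>
      refine ((Set.finite_singleton (X.side x a)).union ih).subset ?_
      rintro k ⟨hk, hx, hy⟩
      by_cases ha : a ∈ k
      · exact Or.inr ⟨hk, ha, hy⟩
      · left
        rw [← hX.sep_of_adj h]; exact ⟨hk, hx, ha⟩
  eq_of_sep x y hs := by
    by_contra hxy
    obtain ⟨z, hz, hd⟩ := hX.exists_closer hxy
    have : X.side x z ∈ sepWalls X.sides x y :=
      ⟨⟨x, z, hz, rfl⟩, mem_side hz, by simp only [side, Set.mem_ofPred_eq]; omega⟩
    rw [hs] at this
    exact this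
  cross := by
    -- Let `u, v` be an edge crossing the wall with `u` in `h` nearest to `x`. If `u` is not `x`, the
    -- side containing `x` of the first edge from `u` towards `x` meets `hᶜ`, as `h` is minimal, and
    -- the quadrangle condition for a point of `hᶜ` on that side gives an edge nearer to `x`.
    intro x h hh hx hmin
    have hne : ∃ n u v, X.graph.dist x u = n ∧ X.graph.Adj u v ∧ u ∈ h ∧ v ∉ h := by
      obtain ⟨a, b, hab, rfl⟩ := hh
      exact ⟨_, a, b, rfl, hab, mem_side hab, notMem_side a b⟩
    classical
    obtain ⟨u, v, hn, huv, hu, hv⟩ := Nat.find_spec hne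
    have hleast : ∀ u' v', X.graph.Adj u' v' → u' ∈ h → v' ∉ h →
        X.graph.dist x u ≤ X.graph.dist x u' := fun u' v' h1 h2 h3 =>
      hn ▸ Nat.find_min' hne ⟨u', v', rfl, h1, h2, h3⟩
    have heq : ∀ u v, X.graph.Adj u v → u ∈ h → v ∉ h → X.side u v = h := by
      obtain ⟨a, b, hab, rfl⟩ := hh
      exact fun u v h1 h2 h3 => hX.side_eq_of_mem hab h1 h2 h3
    have hs := heq u v huv hu hv
    by_cases hux : u = x
    · subst hux
      exact ⟨v, by rw [hX.sep_of_adj huv, hs]⟩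
    · exfalso
      obtain ⟨u', hu1, hu2⟩ := hX.exists_closer hux
      have hxk : x ∈ X.side u' u := by
        simp only [side, Set.mem_ofPred_eq]; omega
      have hu'h : u' ∈ h := by
        by_contra hu'
        rw [← heq u u' hu1 hu hu'] at hx
        simp only [side, Set.mem_ofPred_eq] at hx hxk
        omega
      have hnsub : ¬ X.side u' u ⊆ h := by
        intro hsub
        have := hmin _ ⟨u', u, hu1.symm, rfl⟩ hxk hsub
        rw [← this] at hu
        exact notMem_side u' u hu
      obtain ⟨z, hz1, hz2⟩ := Set.not_subset.1 hnsub
      rw [← hs] at hz2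
      simp only [side, Set.mem_ofPred_eq] at hz1 hz2
      have e1 := hX.dist_or z hu1
      have e2 := hX.dist_or z huv
      obtain ⟨w, hw, -⟩ := hX.quadrangle (v := z) hu1.symm huv.symm
        (by rintro rfl; exact hv hu'h) (by omega) (by omega)
      have hw' : X.side u' w = h := by
        rw [← hs, ← hX.side_compl hw.ab, ← hX.side_compl huv.symm, hX.side_eq_of_sq hw]
      have := hleast u' w hw.ab.symm hu'h (hw' ▸ notMem_side u' w)
      omega

theorem adj_of_sep {x y : V} {h : Set V} (hxy : sepWalls X.sides x y = {h}) :
    X.graph.Adj x y := by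
  have hne : x ≠ y := by
    rintro rfl
    have : h ∈ sepWalls X.sides x x := hxy ▸ rfl
    exact this.2.2 this.2.1
  obtain ⟨z, hz, hd⟩ := hX.exists_closer hne
  have hm : X.side x z ∈ sepWalls X.sides x y :=
    ⟨⟨x, z, hz, rfl⟩, mem_side hz, by simp only [side, Set.mem_ofPred_eq]; omega⟩
  rw [hxy] at hm
  have e : sepWalls X.sides x z = sepWalls X.sides x y := by
    rw [hX.sep_of_adj hz, hxy, hm]
  rwa [← hX.isWallspace.eq_of_sep_eq e]

/-- Sageev's theorem: a CAT(0) cube complex is the cube complex of the wallspace of its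
halfspaces. -/
theorem isDual_sides : X.IsDual X.sides := by
  classical
  have hH := hX.isWallspace
  have hchart : ∀ {C : Set V} {n : ℕ} {f : (Fin n → Bool) → V}, X.IsChart C f →
      ∃ h, IsWallChart X.sides C h f := by
    intro C n f hf
    rw [← hf.range_eq]
    exact hH.exists_isWallChart hf.inj fun x i => ⟨_, hX.sep_of_adj (hf.adj_bflip x i)⟩
  refine ⟨hH, fun C => ⟨fun hC => ?_, fun hC => ?_⟩⟩
  · obtain ⟨n, f, hf⟩ := exists_isChart hC
    obtain ⟨h, hh⟩ := hchart hf
    exact hh.isWallCube hH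
  -- The edges of a wall cube at a vertex pairwise span squares, by the quadrangle condition. So they
  -- span a cube of `X`, and this cube contains the wall cube.
  · obtain ⟨n, h, f, hf⟩ := hC.exists_chart hH
    let t : Fin n → Bool := fun _ => true
    have hsep : ∀ i, sepWalls X.sides (f t) (f (bflip i t)) = {h i} := by
      intro i
      ext k
      constructor
      · rintro ⟨hk, h1, h2⟩
        have hc : Crosses k C := by
          rw [← hf.range_eq]
          exact ⟨⟨_, h1, Set.mem_range_self _⟩, ⟨_, h2, Set.mem_range_self _⟩⟩
        obtain ⟨j, rfl | rfl⟩ := hf.exists_of_crosses hk hc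
        · rw [hf.coord] at h2
          by_cases hji : j = i
          · rw [hji]; rfl
          · rw [bflip_of_ne hji] at h2; exact absurd rfl h2
        · exact absurd ((hf.coord t j).2 rfl) h1
      · rintro rfl
        refine ⟨hf.mem i, (hf.coord _ _).2 rfl, fun h1 => ?_⟩
        have := (hf.coord _ _).1 h1
        rw [bflip_same] at this; simp [t] at this
    have hadj : ∀ i, X.graph.Adj (f t) (f (bflip i t)) := fun i => hX.adj_of_sep (hsep i)
    have hside : ∀ i, X.side (f t) (f (bflip i t)) = h i := fun i =>
      Set.singleton_injective ((hX.sep_of_adj (hadj i)).symm.trans (hsep i))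
    obtain ⟨C', hC', hx, hS⟩ := hX.flagLinks (f t) (Finset.univ.image fun i => f (bflip i t)) (by
        simp only [Finset.mem_image, Finset.mem_univ, true_and]
        rintro _ ⟨i, rfl⟩; exact hadj i) (by
        simp only [Finset.mem_image, Finset.mem_univ, true_and]
        rintro _ ⟨i, rfl⟩ _ ⟨j, rfl⟩
        by_cases hij : i = j
        · subst hij
          exact ⟨_, (hadj i).2, by simp, by simp, by simp⟩
        · have hz : ∀ k, k = i ∨ k = j →
              X.graph.dist (f (bflip i (bflip j t))) (f t) =
                X.graph.dist (f (bflip i (bflip j t))) (f (bflip k t)) + 1 := by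
            intro k hk
            have h1 : f (bflip i (bflip j t)) ∉ X.side (f t) (f (bflip k t)) := by
              rw [hside, hf.coord]
              rcases hk with rfl | rfl
              · rw [bflip_same, bflip_of_ne hij]; simp [t]
              · rw [bflip_of_ne (Ne.symm hij), bflip_same]; simp [t]
            simp only [side, Set.mem_ofPred_eq] at h1
            have := hX.dist_or (f (bflip i (bflip j t))) (hadj k)
            omega
          obtain ⟨c, hc, -⟩ := hX.quadrangle (hadj i).symm (hadj j).symm
            (fun e => hij (bflip_injective (hf.injective e))) (hz i (Or.inl rfl))
            (hz j (Or.inr rfl))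
          exact ⟨_, hc.mem, by simp, by simp, by simp⟩)
    obtain ⟨m, g, hg⟩ := exists_isChart hC'
    obtain ⟨h', hg'⟩ := hchart hg
    have hCC' : C ⊆ C' := by
      intro z hz
      refine (hg'.isWallCube hH).closed z fun k hk hk' => ?_
      by_contra hzk
      have hc : Crosses k C := ⟨⟨f t, hk' hx, hf.range_eq ▸ Set.mem_range_self t⟩, ⟨z, hzk, hz⟩⟩
      obtain ⟨i, rfl | rfl⟩ := hf.exists_of_crosses hk hc
      · have := hk' (hS (f (bflip i t)) (by simp))
        rw [hf.coord, bflip_same] at this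
        simp [t] at this
      · exact hk' hx ((hf.coord t i).2 rfl)
    exact (hg.face C hCC').2 ((hg'.isWallCube_iff hH hCC').1 hC)

end IsCAT0

/-- The set of halfspaces of `X`. -/
def halfspaces (X : CubeComplex V) : Set (Set V) := {h | X.IsHalfspace h}

theorem IsDual.halfspaces_eq {H : Set (Set V)} (hX : X.IsDual H) : X.halfspaces = H :=
  Set.ext fun _ => hX.isHalfspace_iff

theorem IsCAT0.isDual (hX : X.IsCAT0) : X.IsDual X.halfspaces := by
  rw [hX.isDual_sides.halfspaces_eq]
  exact hX.isDual_sides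

end CubeComplex

/-! ### Convex subcomplexes -/

section Trace

variable {V : Type u}

/-- The halfspaces of a convex subset `S`: the intersections with `S` of the halfspaces whose
walls cross `S`. -/
def traceWalls (H : Set (Set V)) (S : Set V) : Set (Set S) :=
  {k | ∃ h ∈ H, k = Subtype.val ⁻¹' h ∧ k.Nonempty ∧ kᶜ.Nonempty}

variable {H : Set (Set V)} {S : Set V}

theorem mem_traceWalls_of_mem {h : Set V} (hh : h ∈ H) {x y : S} (hx : x.1 ∈ h) (hy : y.1 ∉ h) :
    Subtype.val ⁻¹' h ∈ traceWalls H S := ⟨h, hh, rfl, ⟨x, hx⟩, ⟨y, hy⟩⟩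

theorem sepWalls_trace (x y : S) :
    sepWalls (traceWalls H S) x y = (fun h => Subtype.val ⁻¹' h) '' sepWalls H x.1 y.1 := by
  ext k
  constructor
  · rintro ⟨⟨h, hh, rfl, -, -⟩, hx, hy⟩
    exact ⟨h, ⟨hh, hx, hy⟩, rfl⟩
  · rintro ⟨h, ⟨hh, hx, hy⟩, rfl⟩
    exact ⟨mem_traceWalls_of_mem hh hx hy, hx, hy⟩

namespace IsWallspace

variable (hH : IsWallspace H) (hS : WallConvex H S)
include hH hS

/-- A wall crossing a convex set is determined by its trace. -/
theorem eq_of_trace_eq {h k : Set V} (hh : h ∈ H) (hk : k ∈ H)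
    (he : (Subtype.val ⁻¹' h : Set S) = Subtype.val ⁻¹' k)
    (hm : (Subtype.val ⁻¹' h : Set S) ∈ traceWalls H S) : h = k := by
  have he' : ∀ x ∈ S, x ∈ h ↔ x ∈ k := fun x hx => Set.ext_iff.1 he ⟨x, hx⟩
  obtain ⟨-, -, -, ⟨x, hx⟩, ⟨y, hy⟩⟩ := hm
  have key : ∀ {h k : Set V}, h ∈ H → k ∈ H → (∀ x ∈ S, x ∈ h ↔ x ∈ k) → ∀ x ∈ S, ∀ y ∈ S,
      x ∈ h → y ∉ h → h ⊆ k := by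
    intro h k hh hk he x hx y hy hxh hyh z hz
    by_contra hzk
    obtain ⟨w, hw1, hw2, hw3⟩ := hH.helly hS hh (hH.compl_mem k hk) ⟨x, hx, hxh⟩
      ⟨y, hy, fun h => hyh ((he y hy).2 h)⟩ ⟨z, hz, hzk⟩
    exact hw3 ((he w hw1).1 hw2)
  refine (key hh hk he' x x.2 y y.2 hx hy).antisymm ?_
  exact key hk hh (fun z hz => (he' z hz).symm) x x.2 y y.2 ((he' x x.2).1 hx)
    fun h => hy ((he' y y.2).2 h)

theorem wallDist_trace (x y : S) : wallDist (traceWalls H S) x y = wallDist H x.1 y.1 := by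
  rw [wallDist, sepWalls_trace, wallDist]
  refine Set.InjOn.ncard_image ?_
  rintro h ⟨hh, hx, hy⟩ k ⟨hk, -, -⟩ he
  exact hH.eq_of_trace_eq hS hh hk he (mem_traceWalls_of_mem hh hx hy)

theorem trace : IsWallspace (traceWalls H S) where
  compl_mem := by
    rintro _ ⟨h, hh, rfl, h1, h2⟩
    exact ⟨hᶜ, hH.compl_mem h hh, rfl, h2, by rwa [compl_compl]⟩
  nonempty := fun _ ⟨_, _, _, h, _⟩ => h
  finite_sep x y := by
    rw [sepWalls_trace]; exact (hH.finite_sep _ _).image _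
  eq_of_sep x y h := by
    rw [sepWalls_trace, Set.image_eq_empty] at h
    exact Subtype.ext (hH.eq_of_sep _ _ h)
  cross := by
    rintro x _ ⟨h, hh, rfl, h1, h2⟩ hx hmin
    obtain ⟨s, hs⟩ := h2
    obtain ⟨y, hy⟩ := hH.cross x.1 h hh hx (by
      intro k hk hxk hkh
      have hsk : s.1 ∉ k := fun h => hs (hkh h)
      have h3 := hmin _ (mem_traceWalls_of_mem hk hxk hsk) hxk (Set.preimage_mono hkh)
      exact hH.eq_of_trace_eq hS hk hh h3 (mem_traceWalls_of_mem hk hxk hsk))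
    have hyS : y ∈ S := by
      refine hS x.1 x.2 s.1 s.2 y fun k hk hxk hsk => ?_
      by_contra hyk
      have : k ∈ sepWalls H x.1 y := ⟨hk, hxk, hyk⟩
      rw [hy] at this
      obtain rfl := this
      exact hs hsk
    exact ⟨⟨y, hyS⟩, by rw [sepWalls_trace, hy, Set.image_singleton]⟩

theorem isWallCube_trace_iff {C : Set S} :
    IsWallCube (traceWalls H S) C ↔ IsWallCube H (Subtype.val '' C) := by
  have hcr : ∀ k : Set V, Crosses k (Subtype.val '' C) ↔
      Crosses (Subtype.val ⁻¹' k : Set S) C := by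
    intro k
    constructor
    · rintro ⟨⟨_, h1, x, hx, rfl⟩, ⟨_, h2, y, hy, rfl⟩⟩
      exact ⟨⟨x, h1, hx⟩, ⟨y, h2, hy⟩⟩
    · rintro ⟨⟨x, h1, hx⟩, ⟨y, h2, hy⟩⟩
      exact ⟨⟨x, h1, x, hx, rfl⟩, ⟨y, h2, y, hy, rfl⟩⟩
  have hmem : ∀ {k : Set V}, k ∈ H → Crosses (Subtype.val ⁻¹' k : Set S) C →
      (Subtype.val ⁻¹' k : Set S) ∈ traceWalls H S := by
    rintro k hk ⟨⟨x, hx, -⟩, ⟨y, hy, -⟩⟩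
    exact mem_traceWalls_of_mem hk hx hy
  constructor
  · intro hC
    refine ⟨hC.nonempty.image _, ?_, ?_, ?_⟩
    · refine Set.Finite.of_finite_image (f := fun k => (Subtype.val ⁻¹' k : Set S))
        (hC.finite.subset ?_) ?_
      · rintro _ ⟨k, ⟨hk, hc⟩, rfl⟩
        exact ⟨hmem hk ((hcr k).1 hc), (hcr k).1 hc⟩
      · rintro h ⟨hh, hc⟩ k ⟨hk, -⟩ he
        exact hH.eq_of_trace_eq hS hh hk he (hmem hh ((hcr h).1 hc))
    · intro h hh k hk h1 h2 hne hne'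
      rw [hcr] at h1 h2
      obtain ⟨⟨a, ha⟩, ⟨b, hb⟩, ⟨c, hc⟩, ⟨d, hd⟩⟩ := hC.transverse _ (hmem hh h1) _ (hmem hk h2)
        h1 h2 (fun e => hne (hH.eq_of_trace_eq hS hh hk e (hmem hh h1)))
        (fun e => hne' (hH.eq_of_trace_eq hS hh (hH.compl_mem k hk) e (hmem hh h1)))
      exact ⟨⟨a, ha⟩, ⟨b, hb⟩, ⟨c, hc⟩, ⟨d, hd⟩⟩
    · intro z hz
      obtain ⟨x, hx⟩ := hC.nonempty
      obtain ⟨p, hp, hgate, -⟩ := hH.exists_gate hS ⟨x.1, x.2⟩ z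
      have hpz : p = z := by
        refine hH.eq_of_forall fun k hk hpk => ?_
        by_contra hzk
        refine hzk (hz k hk ?_)
        rintro _ ⟨y, hy, rfl⟩
        exact hgate k hk hpk hzk y.2
      subst hpz
      refine ⟨⟨p, hp⟩, hC.closed _ ?_, rfl⟩
      rintro _ ⟨k, hk, rfl, -, -⟩ hCk
      refine hz k hk ?_
      rintro _ ⟨y, hy, rfl⟩
      exact hCk hy
  · intro hC
    refine ⟨Set.image_nonempty.1 hC.nonempty, ?_, ?_, ?_⟩
    · refine (hC.finite.image (fun k => (Subtype.val ⁻¹' k : Set S))).subset ?_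
      rintro _ ⟨⟨k, hk, rfl, -, -⟩, hc⟩
      exact ⟨k, ⟨hk, (hcr k).2 hc⟩, rfl⟩
    · rintro _ ⟨h, hh, rfl, hs1, hs2⟩ _ ⟨k, hk, rfl, hs3, hs4⟩ h1 h2 hne hne'
      obtain ⟨t1, t2, t3, t4⟩ := hC.transverse h hh k hk ((hcr h).2 h1) ((hcr k).2 h2)
        (fun e => hne (by rw [e])) (fun e => hne' (by rw [e]; rfl))
      have key : ∀ {h k : Set V}, h ∈ H → k ∈ H → (Subtype.val ⁻¹' h : Set S).Nonempty →
          (Subtype.val ⁻¹' k : Set S).Nonempty → (h ∩ k).Nonempty →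
          ((Subtype.val ⁻¹' h : Set S) ∩ Subtype.val ⁻¹' k).Nonempty := by
        rintro h k hh hk ⟨x, hx⟩ ⟨y, hy⟩ hne
        obtain ⟨z, hz1, hz2⟩ := hH.helly hS hh hk ⟨x.1, x.2, hx⟩ ⟨y.1, y.2, hy⟩ hne
        exact ⟨⟨z, hz1⟩, hz2⟩
      have hh' := hH.compl_mem h hh
      have hk' := hH.compl_mem k hk
      exact ⟨key hh hk hs1 hs3 t1, key hh hk' hs1 hs4 t2, key hh' hk hs2 hs3 t3,
        key hh' hk' hs2 hs4 t4⟩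
    · intro z hz
      obtain ⟨x, hx⟩ := Set.image_nonempty.1 hC.nonempty
      have : z.1 ∈ Subtype.val '' C := by
        refine hC.closed _ fun k hk hCk => ?_
        by_contra hzk
        exact hzk (hz _ (mem_traceWalls_of_mem (x := x) (y := z) hk (hCk ⟨x, hx, rfl⟩) hzk)
          fun y hy => hCk ⟨y, hy, rfl⟩)
      obtain ⟨w, hw, hwz⟩ := this
      rwa [← Subtype.ext hwz]

end IsWallspace

theorem WallDimLE.preimage {N : ℕ} (hN : WallDimLE H N) {K : Set (Set S)}
    (hK : ∀ k ∈ K, ∃ h ∈ H, k = Subtype.val ⁻¹' h) : WallDimLE K N := by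
  classical
  intro T hT hp
  choose! e he using fun t ht => hK t (hT t ht)
  have hinj : Set.InjOn e T := by
    intro s hs t ht hst
    rw [(he s hs).2, (he t ht).2, hst]
  rw [← Finset.card_image_of_injOn hinj]
  refine hN _ ?_ ?_
  · intro h hh
    obtain ⟨t, ht, rfl⟩ := Finset.mem_image.1 hh
    exact (he t ht).1
  · intro h hh k hk hne
    obtain ⟨s, hs, rfl⟩ := Finset.mem_image.1 hh
    obtain ⟨t, ht, rfl⟩ := Finset.mem_image.1 hk
    have := hp s hs t ht (by rintro rfl; exact hne rfl)
    rw [(he s hs).2, (he t ht).2] at this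
    obtain ⟨⟨a, ha⟩, ⟨b, hb⟩, ⟨c, hc⟩, ⟨d, hd⟩⟩ := this
    exact ⟨⟨a, ha⟩, ⟨b, hb⟩, ⟨c, hc⟩, ⟨d, hd⟩⟩

theorem WallDimLE.trace {N : ℕ} (hN : WallDimLE H N) (S : Set V) :
    WallDimLE (traceWalls H S) N :=
  hN.preimage fun _ ⟨h, hh, he, _⟩ => ⟨h, hh, he⟩

/-- If `S` is coarsely dense, then `S ∩ h` is coarsely dense in a halfspace `h` that meets `S`. -/
theorem IsWallspace.exists_near_mem_inter (hH : IsWallspace H) (hS : WallConvex H S) {R : ℕ}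
    (hR : ∀ x, ∃ s ∈ S, wallDist H x s ≤ R) {h : Set V} (hh : h ∈ H) (hne : (S ∩ h).Nonempty)
    {x : V} (hx : x ∈ h) : ∃ p ∈ S, p ∈ h ∧ wallDist H x p ≤ R := by
  obtain ⟨p, hp, hgate, hmin⟩ := hH.exists_gate hS hne.left x
  obtain ⟨s, hs, hsd⟩ := hR x
  refine ⟨p, hp, ?_, (hmin s hs).trans hsd⟩
  by_contra hph
  obtain ⟨z, hz1, hz2⟩ := hne
  exact hgate _ (hH.compl_mem h hh) hph (fun h => h hx) hz1 hz2

namespace CubeComplex.IsDual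

variable {X : CubeComplex V} (hX : X.IsDual H)
include hX

theorem isConvex_iff : X.IsConvex S ↔ WallConvex H S := by
  have hH := hX.wallspace
  have hb : ∀ x y z : V, X.graph.edist x z + X.graph.edist z y = X.graph.edist x y ↔
      ∀ h ∈ H, x ∈ h → y ∈ h → z ∈ h := by
    intro x y z
    rw [hX.edist_eq, hX.edist_eq, hX.edist_eq, ← Nat.cast_add, Nat.cast_inj]
    have hsub : sepWalls H x y ⊆ sepWalls H x z ∪ sepWalls H z y := by
      rintro k ⟨hk, hx, hy⟩
      by_cases hz : z ∈ k
      · exact Or.inr ⟨hk, hz, hy⟩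
      · exact Or.inl ⟨hk, hx, hz⟩
    have hdisj : Disjoint (sepWalls H x z) (sepWalls H z y) := by
      rw [Set.disjoint_left]
      rintro k ⟨_, _, h1⟩ ⟨_, h2, _⟩
      exact h1 h2
    have hfin := (hH.finite_sep x z).union (hH.finite_sep z y)
    rw [wallDist, wallDist, wallDist,
      ← Set.ncard_union_eq hdisj (hH.finite_sep x z) (hH.finite_sep z y)]
    constructor
    · intro he h hh hxh hyh
      by_contra hzh
      have h1 : sepWalls H x y = sepWalls H x z ∪ sepWalls H z y :=
        Set.eq_of_subset_of_ncard_le hsub he.le hfin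
      have : h ∈ sepWalls H x y := h1 ▸ Or.inl ⟨hh, hxh, hzh⟩
      exact this.2.2 hyh
    · intro hz
      congr 1
      refine (Set.Subset.antisymm hsub ?_).symm
      rintro k (⟨hk, h1, h2⟩ | ⟨hk, h1, h2⟩)
      · exact ⟨hk, h1, fun h3 => h2 (hz k hk h1 h3)⟩
      · refine ⟨hk, ?_, h2⟩
        by_contra h3
        exact hz _ (hH.compl_mem k hk) h3 h2 h1
  simp only [IsConvex, WallConvex, hb]

theorem induce (hS : WallConvex H S) : (X.induce S).IsDual (traceWalls H S) :=
  ⟨hX.wallspace.trace hS, fun _ => (hX.cubes_iff _).trans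
    (hX.wallspace.isWallCube_trace_iff hS).symm⟩

end CubeComplex.IsDual

end Trace

/-! ### The essential core -/

section Core

variable {V : Type u} {H : Set (Set V)}

/-- The halfspace `h` lies in a bounded neighbourhood of its complement. -/
def WallShallow (H : Set (Set V)) (h : Set V) : Prop :=
  ∃ r, ∀ x ∈ h, ∃ y, y ∉ h ∧ wallDist H x y ≤ r

/-- No halfspace is shallow. -/
def WallEssential (H : Set (Set V)) : Prop := ∀ h ∈ H, ¬ WallShallow H h

namespace IsWallspace

/-- A shallow halfspace of least depth is minimal among all halfspaces. -/
theorem exists_minimal_shallow (hH : IsWallspace H) (hne : ∃ h ∈ H, WallShallow H h) :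
    ∃ h ∈ H, WallShallow H h ∧ ∀ k ∈ H, k ⊆ h → k = h := by
  classical
  have hex : ∃ r, ∃ h ∈ H, ∀ x ∈ h, ∃ y, y ∉ h ∧ wallDist H x y ≤ r := by
    obtain ⟨h, hh, r, hr⟩ := hne
    exact ⟨r, h, hh, hr⟩
  obtain ⟨h, hh, hr⟩ := Nat.find_spec hex
  -- A halfspace properly contained in `h` would be shallower: one reaches its complement before
  -- crossing the wall of `h`.
  refine ⟨h, hh, ⟨_, hr⟩, fun k hk hkh => ?_⟩
  by_contra hne
  have hpos : 0 < Nat.find hex := by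
    by_contra h0
    obtain ⟨x, hx⟩ := hH.nonempty h hh
    obtain ⟨y, hy1, hy2⟩ := hr x hx
    rw [hH.wallDist_eq_zero (Nat.le_zero.1 (hy2.trans (not_lt.1 h0)))] at hx
    exact hy1 hx
  refine Nat.find_min hex (Nat.sub_lt hpos one_pos) ⟨k, hk, fun x hx => ?_⟩
  obtain ⟨y, hy1, hy2, hmin⟩ : ∃ y, y ∉ h ∧ wallDist H x y ≤ Nat.find hex ∧
      ∀ z, z ∉ h → wallDist H x y ≤ wallDist H x z := by
    obtain ⟨y0, hy0, hd0⟩ := hr x (hkh hx)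
    obtain ⟨y, hy, hm⟩ := WellFounded.has_min (measure fun z => wallDist H x z).wf hᶜ ⟨y0, hy0⟩
    have hm' : ∀ z, z ∉ h → wallDist H x y ≤ wallDist H x z := fun z hz => not_lt.1 (hm z hz)
    exact ⟨y, hy, (hm' y0 hy0).trans hd0, hm'⟩
  have hyx : y ≠ x := by rintro rfl; exact hy1 (hkh hx)
  obtain ⟨z, m, hm, hz, -⟩ := hH.exists_step hyx
  have hd := hH.wallDist_step hz hm.2.2
  rw [hH.wallDist_comm, hH.wallDist_comm z] at hd
  have hzh : z ∈ h := by
    by_contra hzh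
    have := hmin z hzh
    omega
  have hmh : hᶜ = m := by
    have : hᶜ ∈ sepWalls H y z := ⟨hH.compl_mem h hh, hy1, fun h => h hzh⟩
    rwa [hz] at this
  refine ⟨z, fun hzk => ?_, by omega⟩
  have : kᶜ ∈ sepWalls H y z := ⟨hH.compl_mem k hk, fun h => hy1 (hkh h), fun h => h hzk⟩
  rw [hz, ← hmh] at this
  exact hne (compl_injective this)

variable {G : Type v} [Group G] [MulAction G V]

/-- Removing all translates of a minimal shallow halfspace leaves a coarsely dense, invariant,
convex set. -/
theorem exists_smaller (hH : IsWallspace H) (hG : ∀ g : G, ∀ h ∈ H, g • h ∈ H) {N : ℕ}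
    (hN : WallDimLE H N) (hinv : ∀ h ∈ H, WallShallow H h → ∀ g : G, g • h ≠ hᶜ)
    (hne : ∃ h ∈ H, WallShallow H h) :
    ∃ S : Set V, S ≠ Set.univ ∧ (∀ g : G, ∀ x ∈ S, g • x ∈ S) ∧ WallConvex H S ∧
      ∀ x, ∃ s ∈ S, wallDist H x s ≤ N := by
  obtain ⟨h, hh, hsh, hmin⟩ := hH.exists_minimal_shallow hne
  have hmin' : ∀ g : G, ∀ k ∈ H, k ⊆ g • h → k = g • h := by
    intro g k hk hkg
    have := hmin (g⁻¹ • k) (hG _ _ hk) (Set.smul_set_subset_iff_subset_inv_smul_set.2 (by simpa))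
    rw [← this, smul_inv_smul]
  have hcompl : ∀ g g' : G, g • h ≠ (g' • h)ᶜ := by
    intro g g' he
    refine hinv h hh hsh (g'⁻¹ * g) ?_
    rw [mul_smul, he, Set.smul_set_compl, inv_smul_smul]
  have htr : ∀ g g' : G, (g • h ∩ g' • h).Nonempty → g • h ≠ g' • h →
      CubeComplex.Transverse (g • h) (g' • h) := by
    intro g g' h1 hne
    refine ⟨h1, ?_, ?_, ?_⟩
    · by_contra he
      refine hne (hmin' g' _ (hG g h hh) fun z hz => ?_)
      by_contra hz'
      exact he ⟨z, hz, hz'⟩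
    · by_contra he
      refine hne (hmin' g _ (hG g' h hh) fun z hz => ?_).symm
      by_contra hz'
      exact he ⟨z, hz', hz⟩
    · by_contra he
      refine hcompl g g' (hmin' g _ (hH.compl_mem _ (hG g' h hh)) fun z hz => ?_).symm
      by_contra hz'
      exact he ⟨z, hz', hz⟩
  refine ⟨{x | ∀ g : G, x ∉ g • h}, ?_, ?_, ?_, ?_⟩
  · intro he
    obtain ⟨x, hx⟩ := hH.nonempty h hh
    have : x ∈ {x | ∀ g : G, x ∉ g • h} := he ▸ Set.mem_univ x
    exact this 1 (by rwa [one_smul])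
  · intro g x hx g' hgx
    refine hx (g⁻¹ * g') ?_
    rw [mul_smul]
    exact Set.mem_inv_smul_set_iff.2 hgx
  · intro x hx y hy z hz g
    exact hz _ (hH.compl_mem _ (hG g h hh)) (hx g) (hy g)
  · intro x
    have hTH : {k | x ∈ k ∧ ∃ g : G, k = g • h} ⊆ H := by
      rintro _ ⟨_, g, rfl⟩; exact hG g h hh
    have hTt : ∀ s ∈ {k | x ∈ k ∧ ∃ g : G, k = g • h}, ∀ t ∈ {k | x ∈ k ∧ ∃ g : G, k = g • h},
        s ≠ t → CubeComplex.Transverse s t := by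
      rintro _ ⟨h1, g, rfl⟩ _ ⟨h2, g', rfl⟩ hne
      exact htr g g' ⟨x, h1, h2⟩ hne
    obtain ⟨hfin, hcard⟩ := hN.finite_and_ncard_le hTH hTt
    obtain ⟨y, hy⟩ := hH.exists_sep_eq (x := x) hfin hTH (fun t ht => ht.1) (by
        rintro _ ⟨_, g, rfl⟩ k hk _ hkg
        exact hmin' g k hk hkg) (by
        intro s hs t ht hne hst
        obtain ⟨z, h1, h2⟩ := (hTt s hs t ht hne).2.2.2
        exact h2 (hst h1))
    refine ⟨y, fun g hyg => ?_, by rw [wallDist, hy]; exact hcard⟩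
    by_cases hxg : x ∈ g • h
    · have : g • h ∈ sepWalls H x y := by rw [hy]; exact ⟨hxg, g, rfl⟩
      exact this.2.2 hyg
    · have : (g • h)ᶜ ∈ sepWalls H x y :=
        ⟨hH.compl_mem _ (hG g h hh), hxg, fun h => h hyg⟩
      rw [hy] at this
      obtain ⟨_, g', hg'⟩ := this
      exact hcompl g' g hg'.symm

end IsWallspace

variable {G : Type v} [Group G] [MulAction G V]

theorem sepWalls_smul (hG : ∀ g : G, ∀ h ∈ H, g • h ∈ H) (g : G) (x y : V) :
    sepWalls H (g • x) (g • y) = (fun h => g • h) '' sepWalls H x y := by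
  ext k
  constructor
  · rintro ⟨hk, h1, h2⟩
    refine ⟨g⁻¹ • k, ⟨hG _ _ hk, ?_, fun h3 => h2 ?_⟩, smul_inv_smul g k⟩
    · exact Set.mem_inv_smul_set_iff.2 h1
    · exact Set.mem_inv_smul_set_iff.1 h3
  · rintro ⟨k, ⟨hk, h1, h2⟩, rfl⟩
    exact ⟨hG _ _ hk, Set.smul_mem_smul_set_iff.2 h1, fun h => h2 (Set.smul_mem_smul_set_iff.1 h)⟩

theorem wallDist_smul (hG : ∀ g : G, ∀ h ∈ H, g • h ∈ H) (g : G) (x y : V) :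
    wallDist H (g • x) (g • y) = wallDist H x y := by
  rw [wallDist, sepWalls_smul hG, Set.ncard_image_of_injective _ (MulAction.injective g), wallDist]

theorem IsWallCube.smul (hG : ∀ g : G, ∀ h ∈ H, g • h ∈ H) (g : G) {C : Set V}
    (hC : IsWallCube H C) : IsWallCube H (g • C) := by
  have hcr : ∀ k : Set V, Crosses k (g • C) → Crosses (g⁻¹ • k) C := by
    rintro k ⟨⟨_, h1, x, hx, rfl⟩, ⟨_, h2, y, hy, rfl⟩⟩
    exact ⟨⟨x, Set.mem_inv_smul_set_iff.2 h1, hx⟩,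
      ⟨y, fun h => h2 (Set.mem_inv_smul_set_iff.1 h), hy⟩⟩
  refine ⟨hC.nonempty.smul_set, ?_, ?_, ?_⟩
  · refine (hC.finite.image fun k => g • k).subset ?_
    rintro k ⟨hk, hc⟩
    exact ⟨g⁻¹ • k, ⟨hG _ _ hk, hcr k hc⟩, smul_inv_smul g k⟩
  · intro h hh k hk h1 h2 hne hne'
    have := hC.transverse _ (hG g⁻¹ h hh) _ (hG g⁻¹ k hk) (hcr h h1) (hcr k h2)
      (fun e => hne (MulAction.injective g⁻¹ e)) (fun e => hne' (MulAction.injective g⁻¹ (by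
        change g⁻¹ • h = g⁻¹ • kᶜ
        rw [e, Set.smul_set_compl])))
    simpa only [CubeComplex.Transverse, ← Set.smul_set_compl, ← Set.smul_set_inter,
      Set.smul_set_nonempty] using this
  · intro z hz
    refine Set.mem_smul_set_iff_inv_smul_mem.2 (hC.closed _ fun k hk hCk => ?_)
    exact Set.mem_smul_set_iff_inv_smul_mem.1 (hz _ (hG g k hk) (Set.smul_set_mono hCk))

/-- The action on an invariant subset. -/
@[reducible] def subsetAction (S : Set V) (hS : ∀ g : G, ∀ x ∈ S, g • x ∈ S) : MulAction G S where
  smul g x := ⟨g • x.1, hS g x.1 x.2⟩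
  one_smul x := Subtype.ext (one_smul G x.1)
  mul_smul g g' x := Subtype.ext (mul_smul g g' x.1)

theorem smul_preimage_val {S : Set V} (hS : ∀ g : G, ∀ x ∈ S, g • x ∈ S) (g : G) (h : Set V) :
    letI := subsetAction S hS
    g • (Subtype.val ⁻¹' h : Set S) = Subtype.val ⁻¹' (g • h) := by
  let := subsetAction S hS
  ext x
  rw [Set.mem_smul_set_iff_inv_smul_mem, Set.mem_preimage, Set.mem_preimage,
    Set.mem_smul_set_iff_inv_smul_mem]
  rfl

theorem smul_mem_traceWalls (hG : ∀ g : G, ∀ h ∈ H, g • h ∈ H) {S : Set V}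
    (hS : ∀ g : G, ∀ x ∈ S, g • x ∈ S) (g : G) {k : Set S} (hk : k ∈ traceWalls H S) :
    letI := subsetAction S hS
    g • k ∈ traceWalls H S := by
  let := subsetAction S hS
  obtain ⟨h, hh, rfl, h1, h2⟩ := hk
  refine ⟨g • h, hG g h hh, smul_preimage_val hS g h, h1.smul_set, ?_⟩
  rw [← Set.smul_set_compl]; exact h2.smul_set

/-- A coarsely dense, invariant, convex set meeting the least number of orbits is essential. -/
theorem IsWallspace.exists_core (hH : IsWallspace H) [Nonempty V]
    [Finite (MulAction.orbitRel.Quotient G V)] (hG : ∀ g : G, ∀ h ∈ H, g • h ∈ H) {N : ℕ}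
    (hN : WallDimLE H N) (hinv : ∀ h ∈ H, WallShallow H h → ∀ g : G, g • h ≠ hᶜ) :
    ∃ S : Set V, S.Nonempty ∧ (∀ g : G, ∀ x ∈ S, g • x ∈ S) ∧ WallConvex H S ∧
      (∃ R, ∀ x, ∃ s ∈ S, wallDist H x s ≤ R) ∧ WallEssential (traceWalls H S) := by
  let orb : Set V → Set (MulAction.orbitRel.Quotient G V) := fun S => Quotient.mk _ '' S
  -- Shallow halfspaces are removed as long as there are any; each time orbits get lost.
  suffices key : ∀ n, ∀ S : Set V, ∀ R, (orb S).ncard = n → S.Nonempty →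
      (∀ g : G, ∀ x ∈ S, g • x ∈ S) → WallConvex H S → (∀ x, ∃ s ∈ S, wallDist H x s ≤ R) →
      ∃ S : Set V, S.Nonempty ∧ (∀ g : G, ∀ x ∈ S, g • x ∈ S) ∧ WallConvex H S ∧
      (∃ R, ∀ x, ∃ s ∈ S, wallDist H x s ≤ R) ∧ WallEssential (traceWalls H S) by
    refine key _ Set.univ 0 rfl Set.univ_nonempty (fun _ _ _ => Set.mem_univ _)
      (fun _ _ _ _ _ _ => Set.mem_univ _) fun x => ⟨x, Set.mem_univ x, ?_⟩
    have : sepWalls H x x = ∅ := Set.eq_empty_of_forall_notMem fun k hk => hk.2.2 hk.2.1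
    rw [wallDist, this, Set.ncard_empty]
  intro n
  induction n using Nat.strong_induction_on with
  | _ n ih =>
    intro S R hn hne hS hconv hR
    by_cases hess : WallEssential (traceWalls H S)
    · exact ⟨S, hne, hS, hconv, ⟨R, hR⟩, hess⟩
    · let := subsetAction S hS
      unfold WallEssential at hess
      push Not at hess
      obtain ⟨S₁, h1, h2, h3, h4⟩ := (hH.trace hconv).exists_smaller
        (fun g k hk => smul_mem_traceWalls hG hS g hk) (hN.trace S) (by
          rintro _ ⟨h, hh, rfl, hk1, hk2⟩ ⟨r, hr⟩ g he
          rw [smul_preimage_val] at he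
          have hm : (Subtype.val ⁻¹' (g • h) : Set S) ∈ traceWalls H S := by
            rw [he]
            exact (hH.trace hconv).compl_mem _ ⟨h, hh, rfl, hk1, hk2⟩
          refine hinv h hh ⟨R + r, fun x hx => ?_⟩ g
            (hH.eq_of_trace_eq hconv (hG g h hh) (hH.compl_mem h hh) he hm)
          obtain ⟨p, hp, hph, hpd⟩ := hH.exists_near_mem_inter hconv hR hh
            (by obtain ⟨z, hz⟩ := hk1; exact ⟨z, z.2, hz⟩) hx
          obtain ⟨y, hy1, hy2⟩ := hr ⟨p, hp⟩ hph
          rw [hH.wallDist_trace hconv] at hy2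
          exact ⟨y, hy1, (hH.wallDist_triangle x p y).trans
            (add_le_add hpd hy2)⟩) hess
      have hsub : Subtype.val '' S₁ ⊆ S := by rintro _ ⟨x, _, rfl⟩; exact x.2
      have hinv' : ∀ g : G, ∀ x ∈ Subtype.val '' S₁, g • x ∈ Subtype.val '' S₁ := by
        rintro g _ ⟨x, hx, rfl⟩
        exact ⟨g • x, h2 g x hx, rfl⟩
      refine ih (orb (Subtype.val '' S₁)).ncard ?_ _ (R + N) rfl ?_ hinv' ?_ ?_
      · rw [← hn]
        refine Set.ncard_lt_ncard ⟨Set.image_mono hsub, fun hle => h1 ?_⟩ (Set.toFinite _)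
        refine Set.eq_univ_of_forall fun x => ?_
        obtain ⟨y, hy, hyx⟩ := hle ⟨x.1, x.2, rfl⟩
        obtain ⟨g, hg⟩ := (MulAction.orbitRel_apply (G := G)).1 (Quotient.exact hyx.symm)
        obtain ⟨z, hz, hzx⟩ := hinv' g y hy
        have : z = x := Subtype.ext (hzx.trans hg)
        rwa [← this]
      · obtain ⟨x, hx⟩ := hne
        obtain ⟨s, hs, -⟩ := h4 ⟨x, hx⟩
        exact ⟨s, s, hs, rfl⟩
      · rintro _ ⟨x, hx, rfl⟩ _ ⟨y, hy, rfl⟩ z hz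
        have hzS := hconv x.1 x.2 y.1 y.2 z hz
        refine ⟨⟨z, hzS⟩, h3 x hx y hy ⟨z, hzS⟩ ?_, rfl⟩
        rintro _ ⟨h, hh, rfl, -, -⟩ hxh hyh
        exact hz h hh hxh hyh
      · intro x
        obtain ⟨s, hs, hd⟩ := hR x
        obtain ⟨t, ht, hd'⟩ := h4 ⟨s, hs⟩
        rw [hH.wallDist_trace hconv] at hd'
        exact ⟨t, ⟨t, ht, rfl⟩, (hH.wallDist_triangle x s t).trans (add_le_add hd hd')⟩

end Core

/-! ### The quasi-order on the halfspaces of an essential wallspace -/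

section QuasiOrder

variable {V : Type u} {H : Set (Set V)}

/-- `h ≤ k` if every point of `h \ k` is at distance at most two from `k \ h`. For essential
wallspaces this says that `h ⊆ k` or `h ∩ kᶜ` is a quarterspace of depth zero. -/
def WallLE (H : Set (Set V)) (h k : Set V) : Prop :=
  ∀ x ∈ h, x ∉ k → ∃ y, y ∉ h ∧ y ∈ k ∧ wallDist H x y ≤ 2

/-- The points whose halfspaces form an upward closed set for the quasi-order `WallLE`, that is,
the points in no quarterspace of depth zero. -/
def consistentPoints (H : Set (Set V)) : Set V :=
  {x | ∀ h ∈ H, ∀ k ∈ H, WallLE H h k → x ∈ h → x ∈ k}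

/-- The intersections of the halfspaces with the set of consistent points. -/
def consistentWalls (H : Set (Set V)) : Set (Set (consistentPoints H)) :=
  {k | ∃ h ∈ H, k = Subtype.val ⁻¹' h}

theorem WallLE.of_subset {h k : Set V} (hhk : h ⊆ k) : WallLE H h k :=
  fun _ hx hxk => absurd (hhk hx) hxk

theorem ncard_pair_le {α : Type*} (a b : α) : ({a, b} : Set α).ncard ≤ 2 :=
  (Set.ncard_insert_le a {b}).trans (by rw [Set.ncard_singleton])

theorem WallLE.compl {h k : Set V} (hhk : WallLE H h k) : WallLE H kᶜ hᶜ := by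
  intro x hxk hxh
  obtain ⟨y, h1, h2, h3⟩ := hhk x (not_not.1 hxh) hxk
  exact ⟨y, fun h => h h2, h1, h3⟩

theorem sepWalls_consistent (x y : consistentPoints H) :
    sepWalls (consistentWalls H) x y = (fun h => Subtype.val ⁻¹' h) '' sepWalls H x.1 y.1 := by
  ext k
  constructor
  · rintro ⟨⟨h, hh, rfl⟩, hx, hy⟩
    exact ⟨h, ⟨hh, hx, hy⟩, rfl⟩
  · rintro ⟨h, ⟨hh, hx, hy⟩, rfl⟩
    exact ⟨⟨h, hh, rfl⟩, hx, hy⟩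

namespace IsWallspace

variable (hH : IsWallspace H) (hE : WallEssential H)
include hH

include hE

omit hH in
theorem not_wallLE_compl {h : Set V} (hh : h ∈ H) : ¬ WallLE H h hᶜ := by
  intro hle
  refine hE h hh ⟨2, fun x hx => ?_⟩
  obtain ⟨y, h1, -, h2⟩ := hle x hx fun h => h hx
  exact ⟨y, h1, h2⟩

/-- A point of `h \ k` can be moved to `k \ h` by crossing exactly these two walls. -/
theorem exists_sep_of_wallLE {h k : Set V} (hh : h ∈ H) (hk : k ∈ H) (hle : WallLE H h k) {x : V}
    (hxh : x ∈ h) (hxk : x ∉ k) : ∃ y, sepWalls H x y = {h, kᶜ} := by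
  obtain ⟨y, h1, h2, h3⟩ := hle x hxh hxk
  have hne : h ≠ kᶜ := by
    rintro rfl
    exact not_wallLE_compl hE hh (by rwa [compl_compl])
  refine ⟨y, (Set.eq_of_subset_of_ncard_le ?_ ?_ (hH.finite_sep x y)).symm⟩
  · rintro _ (rfl | rfl)
    · exact ⟨hh, hxh, h1⟩
    · exact ⟨hH.compl_mem k hk, hxk, fun h => h h2⟩
  · rw [Set.ncard_pair hne]; exact h3

/-- Transitivity: move a point of `h \ l` across the walls of the two relations one after the other;
the wall of `k` is crossed forth and back, if at all. -/
theorem wallLE_trans {h k l : Set V} (hh : h ∈ H) (hk : k ∈ H) (hl : l ∈ H)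
    (hhk : WallLE H h k) (hkl : WallLE H k l) : WallLE H h l := by
  have two : ∀ x y, sepWalls H x y ⊆ {h, lᶜ} → wallDist H x y ≤ 2 := by
    intro x y hs
    exact (Set.ncard_le_ncard hs (Set.toFinite _)).trans (ncard_pair_le _ _)
  intro x hxh hxl
  by_cases hxk : x ∈ k
  · obtain ⟨y, hy⟩ := hH.exists_sep_of_wallLE hE hk hl hkl hxk hxl
    have hyk : k ∈ sepWalls H x y := by rw [hy]; simp
    have hyl : lᶜ ∈ sepWalls H x y := by rw [hy]; simp
    by_cases hyh : y ∈ h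
    · obtain ⟨z, hz⟩ := hH.exists_sep_of_wallLE hE hh hk hhk hyh hyk.2.2
      have hzh : h ∈ sepWalls H y z := by rw [hz]; simp
      have hzk : kᶜ ∈ sepWalls H y z := by rw [hz]; simp
      have hzl : z ∈ l := by
        by_contra hzl
        have : l ∈ sepWalls H y z := ⟨hl, not_not.1 hyl.2.2, hzl⟩
        rw [hz] at this
        rcases this with rfl | rfl
        · exact hxl hxh
        · exact not_wallLE_compl hE hk hkl
      refine ⟨z, hzh.2.2, hzl, two _ _ ?_⟩
      rintro m ⟨hm, hxm, hzm⟩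
      by_cases hym : y ∈ m
      · have : m ∈ sepWalls H y z := ⟨hm, hym, hzm⟩
        rw [hz] at this
        rcases this with rfl | rfl
        · exact Or.inl rfl
        · exact absurd hxk hxm
      · have : m ∈ sepWalls H x y := ⟨hm, hxm, hym⟩
        rw [hy] at this
        rcases this with rfl | rfl
        · exact absurd hzm hzk.2.2
        · exact Or.inr rfl
    · refine ⟨y, hyh, not_not.1 hyl.2.2, ?_⟩
      rw [wallDist, hy]; exact ncard_pair_le _ _
  · obtain ⟨y, hy⟩ := hH.exists_sep_of_wallLE hE hh hk hhk hxh hxk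
    have hyh : h ∈ sepWalls H x y := by rw [hy]; simp
    have hyk : kᶜ ∈ sepWalls H x y := by rw [hy]; simp
    by_cases hyl : y ∈ l
    · refine ⟨y, hyh.2.2, hyl, ?_⟩
      rw [wallDist, hy]; exact ncard_pair_le _ _
    · obtain ⟨z, hz⟩ := hH.exists_sep_of_wallLE hE hk hl hkl (not_not.1 hyk.2.2) hyl
      have hzk : k ∈ sepWalls H y z := by rw [hz]; simp
      have hzl : lᶜ ∈ sepWalls H y z := by rw [hz]; simp
      have hzh : z ∉ h := by
        intro hzh
        have : hᶜ ∈ sepWalls H y z := ⟨hH.compl_mem h hh, hyh.2.2, fun h => h hzh⟩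
        rw [hz] at this
        rcases this with rfl | e
        · exact not_wallLE_compl hE hh hhk
        · rw [compl_injective e] at hxh; exact hxl hxh
      refine ⟨z, hzh, not_not.1 hzl.2.2, two _ _ ?_⟩
      rintro m ⟨hm, hxm, hzm⟩
      by_cases hym : y ∈ m
      · have : m ∈ sepWalls H y z := ⟨hm, hym, hzm⟩
        rw [hz] at this
        rcases this with rfl | rfl
        · exact absurd hxm hxk
        · exact Or.inr rfl
      · have : m ∈ sepWalls H x y := ⟨hm, hxm, hym⟩
        rw [hy] at this
        rcases this with rfl | rfl
        · exact Or.inl rfl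
        · exact absurd hzk.2.2 hzm

omit hE in
/-- A consistent choice of halfspaces for the quasi-order that differs only finitely from a point
is a consistent point. -/
theorem realize_consistent (ω : Set (Set V)) (hc : ∀ h ∈ H, h ∈ ω ↔ hᶜ ∉ ω)
    (hu : ∀ h ∈ H, ∀ k ∈ H, h ∈ ω → WallLE H h k → k ∈ ω) (x : V)
    (hf : {h | h ∈ H ∧ h ∈ ω ∧ x ∉ h}.Finite) :
    ∃ y ∈ consistentPoints H, ∀ h ∈ H, y ∈ h ↔ h ∈ ω := by
  obtain ⟨y, hy⟩ := hH.realize ω hc (fun h hh k hk hω hhk => hu h hh k hk hω (.of_subset hhk)) x hf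
  exact ⟨y, fun h hh k hk hhk hyh => (hy k hk).2 (hu h hh k hk ((hy h hh).1 hyh) hhk), hy⟩

/-- Consistent upward closed families of halfspaces extend to ultrafilters. -/
theorem exists_ultrafilter (φ : Set (Set V)) (hφH : φ ⊆ H)
    (hu : ∀ h ∈ φ, ∀ k ∈ H, WallLE H h k → k ∈ φ) (hc : ∀ h ∈ φ, hᶜ ∉ φ) :
    ∃ ω, φ ⊆ ω ∧ (∀ h ∈ H, h ∈ ω ↔ hᶜ ∉ ω) ∧
      ∀ h ∈ H, ∀ k ∈ H, h ∈ ω → WallLE H h k → k ∈ ω := by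
  obtain ⟨ω, hφω, hω⟩ := zorn_subset_nonempty
    {φ : Set (Set V) | φ ⊆ H ∧ (∀ h ∈ φ, ∀ k ∈ H, WallLE H h k → k ∈ φ) ∧ ∀ h ∈ φ, hᶜ ∉ φ} (by
      intro c hc hchain hne
      refine ⟨⋃₀ c, ⟨?_, ?_, ?_⟩, fun s hs => Set.subset_sUnion_of_mem hs⟩
      · exact Set.sUnion_subset fun s hs => (hc hs).1
      · rintro h ⟨s, hs, hhs⟩ k hk hle
        exact ⟨s, hs, (hc hs).2.1 h hhs k hk hle⟩
      · rintro h ⟨s, hs, hhs⟩ ⟨t, ht, hht⟩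
        rcases hchain.total hs ht with hst | hst
        · exact (hc ht).2.2 h (hst hhs) hht
        · exact (hc hs).2.2 h hhs (hst hht)) φ ⟨hφH, hu, hc⟩
  obtain ⟨⟨hω1, hω2, hω3⟩, hmax⟩ := hω
  refine ⟨ω, hφω, fun h hh => ⟨hω3 h, fun hn => ?_⟩, fun h hh k hk h1 h2 => hω2 h h1 k hk h2⟩
  have hsub : ω ⊆ ω ∪ {k | k ∈ H ∧ WallLE H h k} := Set.subset_union_left
  refine hmax ⟨?_, ?_, ?_⟩ hsub (Or.inr ⟨hh, .of_subset subset_rfl⟩)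
  · rintro k (hk | hk)
    exacts [hω1 hk, hk.1]
  · rintro k (hk | hk) l hl hkl
    · exact Or.inl (hω2 k hk l hl hkl)
    · exact Or.inr ⟨hl, hH.wallLE_trans hE hh hk.1 hl hk.2 hkl⟩
  · rintro k (hk | hk) (hk' | hk')
    · exact hω3 k hk hk'
    · refine hn (hω2 k hk _ (hH.compl_mem h hh) ?_)
      have := WallLE.compl hk'.2
      rwa [compl_compl] at this
    · exact hn (hω2 _ hk' _ (hH.compl_mem h hh) (WallLE.compl hk.2))
    · refine not_wallLE_compl hE hh (hH.wallLE_trans hE hh hk.1 (hH.compl_mem h hh) hk.2 ?_)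
      have := WallLE.compl hk'.2
      rwa [compl_compl] at this

/-- Near every point `x` there is a consistent point, and it can be chosen in any given halfspaces
containing `x` for which consistency does not forbid it. -/
theorem exists_consistent {N : ℕ} (hN : WallDimLE H N) (x : V) (A : Set (Set V))
    (hA : ∀ a ∈ A, a ∈ H ∧ x ∈ a) (hAA : ∀ a ∈ A, ∀ b ∈ A, ¬ WallLE H a bᶜ) :
    ∃ w ∈ consistentPoints H, (∀ a ∈ A, w ∈ a) ∧ wallDist H x w ≤ N := by
  -- The halfspaces containing `x` that are not involved in any inconsistency at `x` are kept.
  have hkey : ∀ h ∈ H, ∀ a ∈ A, (x ∈ hᶜ ∧ ∀ k ∈ H, WallLE H hᶜ k → x ∈ k) → ¬ WallLE H a h := by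
    intro h hh a ha hx hle
    exact hx.2 aᶜ (hH.compl_mem a (hA a ha).1) (WallLE.compl hle) (hA a ha).2
  obtain ⟨ω, h1, h2, h3⟩ := hH.exists_ultrafilter hE
    ({h | h ∈ H ∧ x ∈ h ∧ ∀ k ∈ H, WallLE H h k → x ∈ k} ∪ {k | k ∈ H ∧ ∃ a ∈ A, WallLE H a k})
    (by rintro k (hk | hk); exacts [hk.1, hk.1]) (by
      rintro h (⟨hh, hx, hxk⟩ | ⟨hh, a, ha, hah⟩) k hk hle
      · exact Or.inl ⟨hk, hxk k hk hle, fun l hl hkl =>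
          hxk l hl (hH.wallLE_trans hE hh hk hl hle hkl)⟩
      · exact Or.inr ⟨hk, a, ha, hH.wallLE_trans hE (hA a ha).1 hh hk hah hle⟩) (by
      rintro h (⟨hh, hx⟩ | ⟨hh, a, ha, hah⟩) (⟨hh', hx'⟩ | ⟨hh', b, hb, hbh⟩)
      · exact hx'.1 hx.1
      · exact hkey hᶜ hh' b hb (by rwa [compl_compl]) hbh
      · exact hkey h hh a ha hx' hah
      · refine hAA a ha b hb (hH.wallLE_trans hE (hA a ha).1 hh
          (hH.compl_mem b (hA b hb).1) hah ?_)
        have := WallLE.compl hbh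
        rwa [compl_compl] at this)
  -- The halfspaces that change are minimal at `x`, so they are pairwise transverse and there are at
  -- most `N` of them.
  have hmin : ∀ p ∈ H, x ∈ p → pᶜ ∈ ω → ∀ m ∈ H, x ∈ m → m ⊆ p → m = p := by
    intro p hp hxp hpω m hm hxm hmp
    have hex : ∃ k ∈ H, WallLE H p k ∧ x ∉ k := by
      by_contra hne
      push Not at hne
      exact (h2 p hp).1 (h1 (Or.inl ⟨hp, hxp, hne⟩)) hpω
    obtain ⟨k, hk, hle, hxk⟩ := hex
    obtain ⟨y, hy⟩ := hH.exists_sep_of_wallLE hE hp hk hle hxp hxk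
    have hyp : p ∈ sepWalls H x y := by rw [hy]; simp
    have : m ∈ sepWalls H x y := ⟨hm, hxm, fun h => hyp.2.2 (hmp h)⟩
    rw [hy] at this
    rcases this with h | rfl
    · exact h
    · refine absurd (hH.wallLE_trans hE hm hp hk (.of_subset hmp) hle) ?_
      have := not_wallLE_compl hE hm
      rwa [compl_compl] at this
  obtain ⟨hfin, hcard⟩ := hN.finite_and_ncard_le (T := {h | h ∈ H ∧ h ∈ ω ∧ x ∉ h})
    (fun h hh => hh.1) (by
      rintro s ⟨hs, hsω, hxs⟩ t ⟨ht, htω, hxt⟩ hne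
      have key : ∀ s t : Set V, s ∈ H → t ∈ H → s ∈ ω → t ∈ ω → x ∉ s → x ∉ t → s ≠ t →
          (s ∩ tᶜ).Nonempty := by
        intro s t hs ht hsω htω hxs hxt hne
        by_contra he
        refine hne (compl_injective (hmin _ (hH.compl_mem s hs) hxs (by rwa [compl_compl]) _
          (hH.compl_mem t ht) hxt (Set.compl_subset_compl.2 fun z hz => ?_))).symm
        by_contra hzt
        exact he ⟨z, hz, hzt⟩
      refine ⟨?_, key s t hs ht hsω htω hxs hxt hne, ?_, ⟨x, hxs, hxt⟩⟩
      · by_contra he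
        exact (h2 t ht).1 htω (h3 s hs _ (hH.compl_mem t ht) hsω
          (.of_subset fun z hz hzt => he ⟨z, hz, hzt⟩))
      · rw [Set.inter_comm]; exact key t s ht hs htω hsω hxt hxs hne.symm)
  obtain ⟨w, hw, hwω⟩ := hH.realize_consistent ω h2 h3 x hfin
  refine ⟨w, hw, fun a ha => (hwω a (hA a ha).1).2 (h1 (Or.inr ⟨(hA a ha).1, a, ha,
    .of_subset subset_rfl⟩)), ?_⟩
  rw [hH.wallDist_comm]
  refine le_of_eq_of_le ?_ hcard
  rw [wallDist]
  congr 1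
  ext k
  exact ⟨fun ⟨hk, h4, h5⟩ => ⟨hk, (hwω k hk).1 h4, h5⟩,
    fun ⟨hk, h4, h5⟩ => ⟨hk, (hwω k hk).2 h4, h5⟩⟩

variable {N : ℕ} (hN : WallDimLE H N)
include hN

/-- The quasi-order is the inclusion of the traces on the consistent points. -/
theorem preimage_subset_iff {h k : Set V} (hh : h ∈ H) (hk : k ∈ H) :
    (Subtype.val ⁻¹' h : Set (consistentPoints H)) ⊆ Subtype.val ⁻¹' k ↔ WallLE H h k := by
  constructor
  · intro hsub
    by_contra hle
    have hex : ∃ x ∈ h, x ∉ k := by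
      by_contra hne
      push Not at hne
      exact hle (.of_subset hne)
    obtain ⟨x, hxh, hxk⟩ := hex
    have hk' := hH.compl_mem k hk
    have hhk : ¬ WallLE H kᶜ hᶜ := fun h1 => hle (by
      have := WallLE.compl h1
      rwa [compl_compl, compl_compl] at this)
    obtain ⟨w, hw, hwA, -⟩ := hH.exists_consistent hE hN x {h, kᶜ}
      (by rintro _ (rfl | rfl); exacts [⟨hh, hxh⟩, ⟨hk', hxk⟩]) (by
        rintro _ (rfl | rfl) _ (rfl | rfl)
        · exact not_wallLE_compl hE hh
        · rwa [compl_compl]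
        · exact hhk
        · exact not_wallLE_compl hE hk')
    exact hwA kᶜ (by simp) (@hsub ⟨w, hw⟩ (hwA h (by simp)))
  · intro hle w hw
    exact w.2 h hh k hk hle hw

theorem preimage_nonempty {h : Set V} (hh : h ∈ H) :
    (Subtype.val ⁻¹' h : Set (consistentPoints H)).Nonempty := by
  obtain ⟨x, hx⟩ := hH.nonempty h hh
  obtain ⟨w, hw, hwA, -⟩ := hH.exists_consistent hE hN x {h}
    (by rintro _ rfl; exact ⟨hh, hx⟩) (by rintro _ rfl _ rfl; exact not_wallLE_compl hE hh)
  exact ⟨⟨w, hw⟩, hwA h rfl⟩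

/-- Distinct equivalent halfspaces are transverse. -/
theorem transverse_of_preimage_eq {h k : Set V} (hh : h ∈ H) (hk : k ∈ H) (hne : h ≠ k)
    (he : (Subtype.val ⁻¹' h : Set (consistentPoints H)) = Subtype.val ⁻¹' k) :
    CubeComplex.Transverse h k := by
  have key : ∀ h k : Set V, h ∈ H → k ∈ H → h ≠ k →
      (Subtype.val ⁻¹' h : Set (consistentPoints H)) = Subtype.val ⁻¹' k →
      (h ∩ kᶜ).Nonempty := by
    intro h k hh hk hne he
    by_contra hemp
    have hsub : h ⊆ k := fun z hz => by
      by_contra hzk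
      exact hemp ⟨z, hz, hzk⟩
    refine hne (hsub.antisymm fun z hz => ?_)
    by_contra hzh
    obtain ⟨y, h1, h2, -⟩ := (hH.preimage_subset_iff hE hN hk hh).1 he.ge z hz hzh
    exact h1 (hsub h2)
  obtain ⟨w, hw⟩ := hH.preimage_nonempty hE hN hh
  obtain ⟨w', hw'⟩ := hH.preimage_nonempty hE hN (hH.compl_mem h hh)
  refine ⟨⟨w, hw, ?_⟩, key h k hh hk hne he, ?_, ⟨w', hw', ?_⟩⟩
  · rw [he] at hw; exact hw
  · rw [Set.inter_comm]; exact key k h hk hh hne.symm he.symm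
  · rw [Set.preimage_compl, he] at hw'; exact hw'

/-- The consistent points form a wallspace. -/
theorem consistent : IsWallspace (consistentWalls H) where
  compl_mem := by
    rintro _ ⟨h, hh, rfl⟩
    exact ⟨hᶜ, hH.compl_mem h hh, rfl⟩
  nonempty := by
    rintro _ ⟨h, hh, rfl⟩
    exact hH.preimage_nonempty hE hN hh
  finite_sep x y := by
    rw [sepWalls_consistent]; exact (hH.finite_sep _ _).image _
  eq_of_sep x y h := by
    rw [sepWalls_consistent, Set.image_eq_empty] at h
    exact Subtype.ext (hH.eq_of_sep _ _ h)
  cross := by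
    rintro w _ ⟨h, hh, rfl⟩ hw hmin
    -- All the halfspaces in the class of `h` have to be left simultaneously.
    let cls : Set (Set V) := {k | k ∈ H ∧
      (Subtype.val ⁻¹' k : Set (consistentPoints H)) = Subtype.val ⁻¹' h}
    have hcls : cls.Finite := (hN.finite_and_ncard_le (T := cls) (fun k hk => hk.1)
      fun s hs t ht hne => hH.transverse_of_preimage_eq hE hN hs.1 ht.1 hne
        (hs.2.trans ht.2.symm)).1
    have hwc : ∀ k ∈ cls, w.1 ∈ k := by
      rintro k ⟨_, he⟩
      have : w ∈ (Subtype.val ⁻¹' k : Set (consistentPoints H)) := by rw [he]; exact hw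
      exact this
    have hwc' : ∀ k ∈ H, w.1 ∈ k → WallLE H k h → k ∈ cls := fun k hk hwk hle =>
      ⟨hk, hmin _ ⟨k, hk, rfl⟩ hwk ((hH.preimage_subset_iff hE hN hk hh).2 hle)⟩
    have hle : ∀ k ∈ cls, WallLE H k h ∧ WallLE H h k := fun k hk =>
      ⟨(hH.preimage_subset_iff hE hN hk.1 hh).1 hk.2.le,
        (hH.preimage_subset_iff hE hN hh hk.1).1 hk.2.ge⟩
    obtain ⟨y, hy, hyω⟩ := hH.realize_consistent {k | (w.1 ∈ k ∧ k ∉ cls) ∨ kᶜ ∈ cls} (by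
        intro k hk
        simp only [Set.mem_ofPred_eq, compl_compl, Set.mem_compl_iff]
        by_cases hwk : w.1 ∈ k
        · have h1 : kᶜ ∉ cls := fun h1 => hwc _ h1 hwk
          tauto
        · have h1 : k ∉ cls := fun h1 => hwk (hwc _ h1)
          tauto) (by
        rintro k hk l hl (⟨h1, h2⟩ | h1) hkl
        · refine Or.inl ⟨w.2 k hk l hl hkl h1, fun hlc => h2 (hwc' k hk h1 ?_)⟩
          exact hH.wallLE_trans hE hk hl hh hkl (hle l hlc).1
        · by_cases hwl : w.1 ∈ l
          · refine Or.inl ⟨hwl, fun hlc => not_wallLE_compl hE (hH.compl_mem h hh) ?_⟩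
            rw [compl_compl]
            have h4 := WallLE.compl (hle _ h1).1
            rw [compl_compl] at h4
            exact hH.wallLE_trans hE (hH.compl_mem h hh) hk hh h4
              (hH.wallLE_trans hE hk hl hh hkl (hle l hlc).1)
          · right
            refine hwc' lᶜ (hH.compl_mem l hl) hwl ?_
            exact hH.wallLE_trans hE (hH.compl_mem l hl) (hH.compl_mem k hk) hh
              (WallLE.compl hkl) (hle _ h1).1) w.1 (by
        refine (hcls.image compl).subset ?_
        rintro k ⟨hk, h1 | h1, h2⟩
        · exact absurd h1.1 h2
        · exact ⟨_, h1, compl_compl k⟩)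
    refine ⟨⟨y, hy⟩, ?_⟩
    rw [sepWalls_consistent]
    ext k
    constructor
    · rintro ⟨k, ⟨hk, hwk, hyk⟩, rfl⟩
      by_contra hne
      exact hyk ((hyω k hk).2 (Or.inl ⟨hwk, fun hkc => hne hkc.2⟩))
    · rintro rfl
      refine ⟨h, ⟨hh, hw, fun hyh => ?_⟩, rfl⟩
      rcases (hyω h hh).1 hyh with h1 | h1
      · exact h1.2 ⟨hh, rfl⟩
      · exact hwc _ h1 hw

omit hE hN in
theorem wallDist_consistent_le (x y : consistentPoints H) :
    wallDist (consistentWalls H) x y ≤ wallDist H x.1 y.1 := by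
  rw [wallDist, sepWalls_consistent]
  exact Set.ncard_image_le (hH.finite_sep _ _)

/-- Halfspaces with the same trace are pairwise transverse, so at most `N` of them get identified. -/
theorem wallDist_le_mul (x y : consistentPoints H) :
    wallDist H x.1 y.1 ≤ N * wallDist (consistentWalls H) x y := by
  classical
  have hf := hH.finite_sep x.1 y.1
  have himg : (hf.toFinset.image fun h => (Subtype.val ⁻¹' h : Set (consistentPoints H))).card =
      wallDist (consistentWalls H) x y := by
    rw [wallDist, sepWalls_consistent, ← Set.ncard_coe_finset]
    congr 1
    simp
  rw [← himg, wallDist, Set.ncard_eq_toFinset_card _ hf]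
  refine Finset.card_le_mul_card_image _ _ fun k _ => hN _ ?_ ?_
  · intro t ht
    exact ((Set.Finite.mem_toFinset hf).1 (Finset.mem_filter.1 ht).1).1
  · intro s hs t ht hne
    rw [Finset.mem_filter, Set.Finite.mem_toFinset] at hs ht
    exact hH.transverse_of_preimage_eq hE hN hs.1.1 ht.1.1 hne (hs.2.trans ht.2.symm)

/-- Every cube on the consistent points is contained in a cube of the original wallspace. -/
theorem exists_isWallCube {C : Set (consistentPoints H)} (hC : IsWallCube (consistentWalls H) C) :
    ∃ D, IsWallCube H D ∧ Subtype.val '' C ⊆ D := by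
  have hfin : C.Finite := by
    obtain ⟨n, h, f, hf⟩ := hC.exists_chart (hH.consistent hE hN)
    rw [← hf.range_eq]; exact Set.finite_range f
  have hcr : ∀ k, Crosses k {z | ∀ k ∈ H, Subtype.val '' C ⊆ k → z ∈ k} → k ∈ H →
      Crosses (Subtype.val ⁻¹' k : Set (consistentPoints H)) C := by
    rintro k ⟨⟨y, hyk, hy⟩, ⟨z, hzk, hz⟩⟩ hk
    constructor
    · by_contra hne
      refine hy _ (hH.compl_mem k hk) ?_ hyk
      rintro _ ⟨w, hw, rfl⟩ hwk
      exact hne ⟨w, hwk, hw⟩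
    · by_contra hne
      refine hzk (hz k hk ?_)
      rintro _ ⟨w, hw, rfl⟩
      by_contra hwk
      exact hne ⟨w, hwk, hw⟩
  have hsub : Subtype.val '' C ⊆ {z | ∀ k ∈ H, Subtype.val '' C ⊆ k → z ∈ k} :=
    fun z hz k _ hCk => hCk hz
  refine ⟨_, ⟨(hC.nonempty.image _).mono hsub, ?_, ?_, ?_⟩, hsub⟩
  · refine ((hfin.prod hfin).biUnion fun p _ => hH.finite_sep p.1.1 p.2.1).subset ?_
    rintro k ⟨hk, hc⟩
    obtain ⟨⟨y, hyk, hy⟩, ⟨z, hzk, hz⟩⟩ := hcr k hc hk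
    exact Set.mem_biUnion (x := (y, z)) ⟨hy, hz⟩ ⟨hk, hyk, hzk⟩
  · intro h hh k hk h1 h2 hne hne'
    by_cases e1 : (Subtype.val ⁻¹' h : Set (consistentPoints H)) = Subtype.val ⁻¹' k
    · exact hH.transverse_of_preimage_eq hE hN hh hk hne e1
    · by_cases e2 : (Subtype.val ⁻¹' h : Set (consistentPoints H)) = Subtype.val ⁻¹' kᶜ
      · obtain ⟨t1, t2, t3, t4⟩ :=
          hH.transverse_of_preimage_eq hE hN hh (hH.compl_mem k hk) hne' e2
        rw [compl_compl] at t2 t4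
        exact ⟨t2, t1, t4, t3⟩
      · obtain ⟨⟨a, ha⟩, ⟨b, hb⟩, ⟨c, hc⟩, ⟨d, hd⟩⟩ :=
          hC.transverse _ ⟨h, hh, rfl⟩ _ ⟨k, hk, rfl⟩ (hcr h h1 hh) (hcr k h2 hk) e1 e2
        exact ⟨⟨a, ha⟩, ⟨b, hb⟩, ⟨c, hc⟩, ⟨d, hd⟩⟩
  · intro z hz k hk hCk
    exact hz k hk fun y hy => hy k hk hCk

omit hN in
/-- If there is a shallow quarterspace then there is one of depth zero, whose points are not
consistent: a shallow quarterspace of least depth has depth zero. -/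
theorem consistentPoints_ne_univ (hsh : ∃ h ∈ H, ∃ k ∈ H, CubeComplex.Transverse h k ∧
      ∃ r, ∀ x ∈ h ∩ k, ∃ y, y ∉ h ∧ y ∉ k ∧ wallDist H x y ≤ r) :
    consistentPoints H ≠ Set.univ := by
  classical
  have hex : ∃ r, ∃ h ∈ H, ∃ k ∈ H, CubeComplex.Transverse h k ∧
      ∀ x ∈ h ∩ k, ∃ y, y ∉ h ∧ y ∉ k ∧ wallDist H x y ≤ r := by
    obtain ⟨h, hh, k, hk, ht, r, hr⟩ := hsh
    exact ⟨r, h, hh, k, hk, ht, hr⟩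
  obtain ⟨h, hh, k, hk, ht, hr⟩ := Nat.find_spec hex
  have hconv : ∀ {k l : Set V}, k ∈ H → l ∈ H → WallConvex H (kᶜ ∩ lᶜ) :=
    fun {k l} hk hl x hx y hy z hz =>
    ⟨hz _ (hH.compl_mem k hk) hx.1 hy.1, hz _ (hH.compl_mem l hl) hx.2 hy.2⟩
  have hconv1 : ∀ {k : Set V}, k ∈ H → WallConvex H k := fun hk x hx y hy z hz => hz _ hk hx hy
  have hle : WallLE H h kᶜ := by
    by_contra hle
    -- A third wall separates `x` from `hᶜ ∩ kᶜ`; it bounds a halfspace contained in `h` or `k`.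
    have key : ∀ h k m : Set V, h ∈ H → k ∈ H → m ∈ H → CubeComplex.Transverse h k →
        (∀ x ∈ h ∩ k, ∃ y, y ∉ h ∧ y ∉ k ∧ wallDist H x y ≤ Nat.find hex) →
        (m ∩ k).Nonempty → m ⊆ h → m ≠ h → False := by
      intro h k m hh hk hm ht hr hmk hmh hne
      have ht' : (mᶜ ∩ kᶜ).Nonempty :=
        ht.2.2.2.mono (Set.inter_subset_inter_left _ (Set.compl_subset_compl.2 hmh))
      have hmk' : (m ∩ kᶜ).Nonempty := by
        by_contra hemp
        refine hE m hm ⟨Nat.find hex, fun x hx => ?_⟩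
        have hxk : x ∈ k := by
          by_contra hxk
          exact hemp ⟨x, hx, hxk⟩
        obtain ⟨y, hy1, -, hy2⟩ := hr x ⟨hmh hx, hxk⟩
        exact ⟨y, fun h => hy1 (hmh h), hy2⟩
      obtain ⟨z, hz1, hz2, hz3⟩ : (h ∩ (mᶜ ∩ kᶜ)).Nonempty := by
        refine hH.helly (hconv1 hh) (hH.compl_mem m hm) (hH.compl_mem k hk) ?_ ht.2.1 ht'
        by_contra hemp
        refine hne (hmh.antisymm fun z hz => ?_)
        by_contra hzm
        exact hemp ⟨z, hz, hzm⟩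
      have hlt : ∀ x ∈ m ∩ k, ∃ y, y ∉ m ∧ y ∉ k ∧ wallDist H x y < Nat.find hex := by
        rintro x ⟨hxm, hxk⟩
        obtain ⟨y, hy1, hy2, hy3⟩ := hr x ⟨hmh hxm, hxk⟩
        obtain ⟨q, hq, hgate, -⟩ := hH.exists_gate (hconv hm hk) ht' x
        have hg : ∀ s ∈ sepWalls H x q, mᶜ ∩ kᶜ ⊆ sᶜ := fun s hs =>
          hgate _ (hH.compl_mem s hs.1) hs.2.2 fun h => h hs.2.1
        refine ⟨q, hq.1, hq.2, lt_of_lt_of_le ?_ hy3⟩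
        refine Set.ncard_lt_ncard ⟨?_, ?_⟩ (hH.finite_sep x y)
        · intro s hs
          exact ⟨hs.1, hs.2.1, hg s hs ⟨fun h => hy1 (hmh h), hy2⟩⟩
        · intro hsub
          exact hg h (hsub ⟨hh, hmh hxm, hy1⟩) ⟨hz2, hz3⟩ hz1
      have hpos : 0 < Nat.find hex := by
        obtain ⟨x, hx⟩ := hmk
        obtain ⟨y, -, -, h⟩ := hlt x hx
        omega
      refine Nat.find_min hex (Nat.sub_lt hpos one_pos) ⟨m, hm, k, hk, ⟨hmk, hmk', ?_, ht'⟩, ?_⟩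
      · exact ht.2.2.1.mono (Set.inter_subset_inter_left _ (Set.compl_subset_compl.2 hmh))
      · intro x hx
        obtain ⟨y, h1, h2, h3⟩ := hlt x hx
        exact ⟨y, h1, h2, by omega⟩
    unfold WallLE at hle
    push Not at hle
    obtain ⟨x, hxh, hxk, hx⟩ := hle
    have hxk : x ∈ k := by simpa using hxk
    obtain ⟨p, hp, hgate, -⟩ := hH.exists_gate (hconv hh hk) ht.2.2.2 x
    have hex3 : ∃ m ∈ sepWalls H x p, m ≠ h ∧ m ≠ k := by
      by_contra hne
      push Not at hne
      have hsub : sepWalls H x p ⊆ {h, k} := by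
        intro m hm
        by_cases e : m = h
        · exact Or.inl e
        · exact Or.inr (hne m hm e)
      have := hx p hp.1 hp.2
      have h2 := (Set.ncard_le_ncard hsub (Set.toFinite _)).trans (ncard_pair_le _ _)
      rw [wallDist] at this
      omega
    obtain ⟨m, hm, hmh, hmk⟩ := hex3
    have hg : hᶜ ∩ kᶜ ⊆ mᶜ := hgate _ (hH.compl_mem m hm.1) hm.2.2 fun h => h hm.2.1
    by_cases h1 : m ⊆ h
    · exact key h k m hh hk hm.1 ht hr ⟨x, hm.2.1, hxk⟩ h1 hmh
    · by_cases h2 : m ⊆ k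
      · refine key k h m hk hh hm.1 ?_ (fun x hx => ?_) ⟨x, hm.2.1, hxh⟩ h2 hmk
        · obtain ⟨t1, t2, t3, t4⟩ := ht
          rw [Set.inter_comm] at t1 t2 t3 t4
          exact ⟨t1, t3, t2, t4⟩
        · obtain ⟨y, h1, h2, h3⟩ := hr x hx.symm
          exact ⟨y, h2, h1, h3⟩
      · obtain ⟨y, hy⟩ := Set.not_subset.1 h1
        obtain ⟨z, hz⟩ := Set.not_subset.1 h2
        obtain ⟨w, hw1, hw2⟩ := hH.helly (hconv1 hm.1) (hH.compl_mem h hh) (hH.compl_mem k hk)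
          ⟨y, hy⟩ ⟨z, hz⟩ ht.2.2.2
        exact hg hw2 hw1
  intro huniv
  obtain ⟨x, hxh, hxk⟩ := ht.1
  have hx : x ∈ consistentPoints H := huniv ▸ Set.mem_univ x
  exact hx h hh kᶜ (hH.compl_mem k hk) hle hxh hxk

omit hE in
/-- Ultrafilters for the quasi-order without strictly descending chains are consistent points. -/
theorem exists_consistent_of_dcc [Nonempty V] (ω : Set (Set V))
    (hc : ∀ h ∈ H, h ∈ ω ↔ hᶜ ∉ ω)
    (hu : ∀ h ∈ H, ∀ k ∈ H, h ∈ ω → WallLE H h k → k ∈ ω)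
    (hdcc : ¬ ∃ A : ℕ → Set V, ∀ n, A n ∈ H ∧ A n ∈ ω ∧ WallLE H (A (n + 1)) (A n) ∧
      ¬ WallLE H (A n) (A (n + 1))) :
    ∃ y ∈ consistentPoints H, ∀ h ∈ H, y ∈ h ↔ h ∈ ω := by
  obtain ⟨x⟩ := ‹Nonempty V›
  refine hH.realize_consistent ω hc hu x ?_
  let r : {h : Set V // h ∈ H ∧ h ∈ ω} → {h : Set V // h ∈ H ∧ h ∈ ω} → Prop :=
    fun h k => h.1 ⊂ k.1
  have hwf : WellFounded r := by
    rw [wellFounded_iff_isEmpty_descending_chain]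
    refine ⟨fun ⟨A, hA⟩ => hdcc ⟨fun n => (A n).1, fun n => ⟨(A n).2.1, (A n).2.2,
      .of_subset (hA n).1, fun hle => ?_⟩⟩⟩
    obtain ⟨y, hy1, hy2⟩ := Set.not_subset.1 (hA n).2
    obtain ⟨z, hz1, hz2, -⟩ := hle y hy1 hy2
    exact hz1 ((hA n).1 hz2)
  -- The minimal elements of `ω` not containing `x` are pairwise transverse, hence finite in number.
  let M : Set (Set V) := {m | m ∈ H ∧ m ∈ ω ∧ x ∉ m ∧ ∀ k ∈ H, k ∈ ω → k ⊆ m → k = m}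
  have hM : M.Finite := by
    refine (hN.finite_and_ncard_le (T := M) (fun m hm => hm.1) ?_).1
    have key : ∀ s t : Set V, s ∈ M → t ∈ M → s ≠ t → (s ∩ tᶜ).Nonempty := by
      intro s t hs ht hne
      by_contra hemp
      refine hne (ht.2.2.2 s hs.1 hs.2.1 fun z hz => ?_)
      by_contra hzt
      exact hemp ⟨z, hz, hzt⟩
    intro s hs t ht hne
    refine ⟨?_, key s t hs ht hne, ?_, ⟨x, hs.2.2.1, ht.2.2.1⟩⟩
    · by_contra hemp
      exact (hc t ht.1).1 ht.2.1 (hu s hs.1 _ (hH.compl_mem t ht.1) hs.2.1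
        (.of_subset fun z hz hzt => hemp ⟨z, hz, hzt⟩))
    · rw [Set.inter_comm]; exact key t s ht hs hne.symm
  have hcover : {h | h ∈ H ∧ h ∈ ω ∧ x ∉ h} ⊆ ⋃ m ∈ M, {h | h ∈ H ∧ m ⊆ h ∧ x ∉ h} := by
    rintro h ⟨hh, hω, hxh⟩
    obtain ⟨⟨m, hm, hmω⟩, hmh, hmin⟩ := hwf.has_min
      {k : {h : Set V // h ∈ H ∧ h ∈ ω} | k.1 ⊆ h} ⟨⟨h, hh, hω⟩, Set.Subset.rfl⟩
    refine Set.mem_biUnion (x := m) ⟨hm, hmω, fun hxm => hxh (hmh hxm), fun k hk hkω hkm => ?_⟩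
      ⟨hh, hmh, hxh⟩
    by_contra hne
    exact hmin ⟨k, hk, hkω⟩ (hkm.trans hmh) (hkm.ssubset_of_ne hne)
  refine (hM.biUnion fun m hm => ?_).subset hcover
  obtain ⟨z, hz⟩ := hH.nonempty m hm.1
  exact (hH.finite_sep z x).subset fun h hh => ⟨hh.1, hh.2.1 hz, hh.2.2⟩

end IsWallspace

end QuasiOrder

/-! ### Group actions on cube complexes and their wallspaces -/

section Action

variable {V : Type u} {H : Set (Set V)} {G : Type v} [Group G] [MulAction G V]

theorem WallLE.smul (hG : ∀ g : G, ∀ h ∈ H, g • h ∈ H) (g : G) {h k : Set V}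
    (hhk : WallLE H h k) : WallLE H (g • h) (g • k) := by
  rintro _ ⟨x, hx, rfl⟩ hxk
  obtain ⟨y, h1, h2, h3⟩ := hhk x hx fun h => hxk (Set.smul_mem_smul_set_iff.2 h)
  exact ⟨g • y, fun h => h1 (Set.smul_mem_smul_set_iff.1 h), Set.smul_mem_smul_set_iff.2 h2,
    by rwa [wallDist_smul hG]⟩

theorem smul_mem_consistentPoints (hG : ∀ g : G, ∀ h ∈ H, g • h ∈ H) (g : G) {x : V}
    (hx : x ∈ consistentPoints H) : g • x ∈ consistentPoints H := by
  intro h hh k hk hle hgx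
  refine Set.mem_inv_smul_set_iff.1 ?_
  exact hx _ (hG g⁻¹ h hh) _ (hG g⁻¹ k hk) (hle.smul hG g⁻¹) (Set.mem_inv_smul_set_iff.2 hgx)

theorem smul_mem_consistentWalls (hG : ∀ g : G, ∀ h ∈ H, g • h ∈ H) (g : G)
    {k : Set (consistentPoints H)} (hk : k ∈ consistentWalls H) :
    letI := subsetAction (consistentPoints H) fun (g : G) _ hx => smul_mem_consistentPoints hG g hx
    g • k ∈ consistentWalls H := by
  obtain ⟨h, hh, rfl⟩ := hk
  exact ⟨g • h, hG g h hh,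
    smul_preimage_val (fun (g : G) _ hx => smul_mem_consistentPoints hG g hx) g h⟩

namespace CubeComplex.IsDual

variable {X : CubeComplex V} (hX : X.IsDual H)
include hX

theorem wallDist_smul_le (hA : X.ActsOn G) (g : G) (x y : V) :
    wallDist H (g • x) (g • y) ≤ wallDist H x y := by
  let f : X.graph →g X.graph := ⟨fun x => g • x, fun {a b} h => by
    refine ⟨fun e => h.1 (MulAction.injective g e), ?_⟩
    have := hA g _ h.2
    rwa [Set.smul_set_insert, Set.smul_set_singleton] at this⟩
  obtain ⟨p, hp⟩ := hX.exists_walk x y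
  have := hX.wallDist_le_length (p.map f)
  rw [SimpleGraph.Walk.length_map, hp] at this
  exact this

/-- Automorphisms map halfspaces to halfspaces. -/
theorem smul_mem (hA : X.ActsOn G) (g : G) {h : Set V} (hh : h ∈ H) : g • h ∈ H := by
  have hH := hX.wallspace
  have : Nonempty V := (hH.nonempty h hh).nonempty
  have hd : ∀ x y, wallDist H (g • x) (g • y) = wallDist H x y := fun x y => by
    refine le_antisymm (hX.wallDist_smul_le hA g x y) ?_
    have := hX.wallDist_smul_le hA g⁻¹ (g • x) (g • y)
    rwa [inv_smul_smul, inv_smul_smul] at this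
  obtain ⟨x, y, hxy⟩ := hH.exists_edge hh
  have hadj : X.graph.Adj (g • x) (g • y) := by
    have h1 := hX.adj_iff.2 ⟨_, hxy⟩
    refine ⟨fun e => h1.1 (MulAction.injective g e), ?_⟩
    have := hA g _ h1.2
    rwa [Set.smul_set_insert, Set.smul_set_singleton] at this
  obtain ⟨k, hk⟩ := hX.adj_iff.1 hadj
  have : g • h = k := by
    ext z
    rw [Set.mem_smul_set_iff_inv_smul_mem, hH.mem_iff_wallDist_lt hxy, hH.mem_iff_wallDist_lt hk,
      ← hd (g⁻¹ • z) x, ← hd (g⁻¹ • z) y, smul_inv_smul]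
  rw [this]
  exact (show k ∈ sepWalls H (g • x) (g • y) by rw [hk]; rfl).1

/-- Pairwise transverse halfspaces cross a common cube, and there are finitely many orbits of
cubes. -/
theorem exists_wallDimLE [Nonempty V] (hc : X.Cocompact G) : ∃ N, WallDimLE H N := by
  classical
  have hH := hX.wallspace
  obtain ⟨F, hF, hfin, hcov⟩ := hc
  obtain ⟨N, hN⟩ := (hfin.image Set.ncard).bddAbove
  refine ⟨N, fun T hT hp => ?_⟩
  obtain ⟨x, y, hxy⟩ := hH.exists_sep_eq_of_transverse T.finite_toSet hT ‹_› hp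
  have hx : ∀ t ∈ T, x ∈ t := fun t ht => (show t ∈ sepWalls H x y by rw [hxy]; exact ht).2.1
  have hC := IsWallCube.of_directions hH (x := x) T.finite_toSet hp
  obtain ⟨D, hD, g, hg⟩ := hcov _ ((hX.cubes_iff _).2 hC)
  have hcard := hN ⟨D, hD, rfl⟩
  rw [← Set.ncard_image_of_injective D (MulAction.injective g)] at hcard
  have hg' : (fun x => g • x) '' D = _ := hg
  rw [hg'] at hcard
  have hz : ∀ t ∈ T, ∃ z, sepWalls H x z = {t} := by
    intro t ht
    refine hH.cross x t (hT t ht) (hx t ht) fun k hk hxk hkt => ?_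
    have hkT : k ∈ T := by
      have hyt : y ∉ t := (show t ∈ sepWalls H x y by rw [hxy]; exact ht).2.2
      have : k ∈ sepWalls H x y := ⟨hk, hxk, fun h => hyt (hkt h)⟩
      rw [hxy] at this; exact this
    by_contra hne
    obtain ⟨z, hz1, hz2⟩ := (hp k hkT t ht hne).2.1
    exact hz2 (hkt hz1)
  choose! z hz using hz
  rw [← Set.ncard_coe_finset]
  refine (Set.ncard_le_ncard_of_injOn z ?_ ?_ (finite_cube ((hX.cubes_iff _).2 hC))).trans hcard
  · intro t ht k hk hxk hkT
    by_contra hzk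
    have : k ∈ sepWalls H x (z t) := ⟨hk, hxk, hzk⟩
    rw [hz t ht] at this
    obtain rfl := this
    exact hkT ht
  · intro s hs t ht hst
    have := hz s hs
    rw [hst, hz t ht] at this
    exact (Set.singleton_injective this).symm

end CubeComplex.IsDual

theorem CubeComplex.Cocompact.finite_orbits {X : CubeComplex V} (hc : X.Cocompact G) :
    Finite (MulAction.orbitRel.Quotient G V) := by
  obtain ⟨F, hF, hfin, hcov⟩ := hc
  have hU : (⋃ D ∈ F, D).Finite := hfin.biUnion fun D hD => finite_cube (hF hD)
  have := hU.to_subtype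
  refine Finite.of_surjective
    (fun v : (⋃ D ∈ F, D : Set V) => (Quotient.mk _ v.1 : MulAction.orbitRel.Quotient G V)) ?_
  intro q
  induction q using Quotient.ind with
  | _ v =>
  obtain ⟨D, hD, g, hg⟩ := hcov {v} (X.singleton_mem v)
  have hv : v ∈ g • D := hg ▸ rfl
  obtain ⟨w, hw, hwv⟩ := hv
  refine ⟨⟨w, Set.mem_biUnion hD hw⟩, Quotient.sound ?_⟩
  exact (MulAction.orbitRel_apply (G := G)).2 ⟨g⁻¹, by
    change g⁻¹ • v = w
    rw [← hwv]; exact inv_smul_smul g w⟩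

end Action

/-! ### Cubes as copies of the 1-skeleton of a cube -/

theorem hammingDist_eq_one_iff {n : ℕ} {x y : Fin n → Bool} :
    hammingDist x y = 1 ↔ ∃ i, y = bflip i x := by
  rw [hammingDist, Finset.card_eq_one]
  refine exists_congr fun i => ?_
  constructor
  · intro h
    have h' : ∀ j, x j ≠ y j ↔ j = i := fun j => by
      have := Finset.ext_iff.1 h j
      simpa using this
    funext j
    by_cases hj : j = i
    · subst hj
      have := (h' j).2 rfl
      rw [bflip_same]
      revert this; cases x j <;> cases y j <;> simp
    · rw [bflip_of_ne hj]
      exact (not_not.1 fun h => hj ((h' j).1 h)).symm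
  · rintro rfl
    ext j
    simp only [Finset.mem_filter, Finset.mem_univ, true_and, Finset.mem_singleton]
    by_cases hj : j = i
    · subst hj; simp [bflip_same]
    · simp [bflip_of_ne hj, hj]

theorem CubeComplex.IsDual.mem_cubes_iff {V : Type u} {H : Set (Set V)} {X : CubeComplex V}
    (hX : X.IsDual H) (C : Set V) :
    C ∈ X.cubes ↔ ∃ n : ℕ, Nonempty (Pocset.cubeGraph n ≃g X.graph.induce C) := by
  constructor
  · intro hC
    obtain ⟨n, f, hf⟩ := exists_isChart hC
    obtain rfl := hf.range_eq
    refine ⟨n, ⟨⟨Equiv.ofInjective f hf.inj, fun {x y} => ?_⟩⟩⟩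
    change X.graph.Adj (f x) (f y) ↔ hammingDist x y = 1
    rw [hammingDist_eq_one_iff]
    constructor
    · intro h
      obtain ⟨i, hi⟩ := hf.eq_bflip_of_adj (Set.mem_range_self y) h
      exact ⟨i, hf.inj hi⟩
    · rintro ⟨i, rfl⟩; exact hf.adj_bflip x i
  · rintro ⟨n, ⟨ψ⟩⟩
    have hr : Set.range (fun x => (ψ x).1) = C := by
      ext z
      constructor
      · rintro ⟨x, rfl⟩; exact (ψ x).2
      · intro hz; exact ⟨ψ.symm ⟨z, hz⟩, by simp⟩
    obtain ⟨h, hh⟩ := hX.wallspace.exists_isWallChart (f := fun x => (ψ x).1)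
      (Subtype.val_injective.comp ψ.injective) fun x i => by
        have h1 : (Pocset.cubeGraph n).Adj x (bflip i x) := hammingDist_eq_one_iff.2 ⟨i, rfl⟩
        exact hX.adj_iff.1 (ψ.map_rel_iff.2 h1)
    rw [hr] at hh
    exact (hX.cubes_iff C).2 (hh.isWallCube hX.wallspace)

/-! ### The quotient pocset and its cubing -/

namespace CubeComplex

variable {V : Type u} {X : CubeComplex V} {H : Set (Set V)}

theorem depth_eq_zero_iff {h k : Set V} :
    X.depth h k = 0 ↔ h ∩ k ⊆ X.nbhd 2 (hᶜ ∩ kᶜ) := by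
  constructor
  · intro h0
    by_contra hne
    have : (1 : ℕ∞) ≤ X.depth h k := le_iInf₂ fun r hr => by
      have : r ≠ 0 := by rintro rfl; exact hne hr
      exact_mod_cast Nat.one_le_iff_ne_zero.2 this
    rw [h0] at this
    exact absurd this (by simp)
  · intro h0
    exact le_antisymm (iInf₂_le (0 : ℕ) h0) bot_le

variable (hX : X.IsDual H) (hE : WallEssential H)
include hX hE

/-- The defining clause for transverse halfspaces is equivalent to `WallLE`: in an essential complex,
halfspaces related by `WallLE` are nested or transverse. -/
theorem Halfspace.le_iff (h k : X.Halfspace) : Halfspace.le h k ↔ WallLE H h.1 k.1 := by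
  have hh := hX.isHalfspace_iff.1 h.2
  have hk := hX.isHalfspace_iff.1 k.2
  constructor
  · rintro (hsub | ⟨-, hd⟩)
    · exact .of_subset hsub
    · intro x hxh hxk
      obtain ⟨y, hy, hxy⟩ := hX.mem_nbhd_iff.1 (depth_eq_zero_iff.1 hd ⟨hxh, hxk⟩)
      exact ⟨y, hy.1, not_not.1 hy.2, hxy⟩
  · intro hle
    by_cases hsub : h.1 ⊆ k.1
    · exact Or.inl hsub
    obtain ⟨x, hxh, hxk⟩ := Set.not_subset.1 hsub
    obtain ⟨y, hyh, hyk, -⟩ := hle x hxh hxk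
    refine Or.inr ⟨⟨⟨x, hxh, hxk⟩, ?_, ?_, ⟨y, hyh, not_not.2 hyk⟩⟩,
      depth_eq_zero_iff.2 fun z hz => hX.mem_nbhd_iff.2 ?_⟩
    -- Disjoint or covering halfspaces would be shallow.
    · by_contra hne
      refine hE _ hh ⟨2, fun z hz => ?_⟩
      obtain ⟨w, hw, -, hd⟩ := hle z hz fun hzk => hne ⟨z, hz, not_not.2 hzk⟩
      exact ⟨w, hw, hd⟩
    · by_contra hne
      refine hE _ (hX.wallspace.compl_mem _ hk) ⟨2, fun z hz => ?_⟩
      obtain ⟨w, -, hw, hd⟩ := hle z (by_contra fun hzh => hne ⟨z, hzh, hz⟩) hz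
      exact ⟨w, not_not.2 hw, hd⟩
    · obtain ⟨w, h1, h2, h3⟩ := hle z hz.1 hz.2
      exact ⟨w, ⟨h1, not_not.2 h2⟩, h3⟩

variable {N : ℕ} (hN : WallDimLE H N)
include hN

theorem Halfspace.preimage_subset_iff (h k : X.Halfspace) :
    (Subtype.val ⁻¹' h.1 : Set (consistentPoints H)) ⊆ Subtype.val ⁻¹' k.1 ↔ Halfspace.le h k := by
  rw [Halfspace.le_iff hX hE]
  exact hX.wallspace.preimage_subset_iff hE hN (hX.isHalfspace_iff.1 h.2)
    (hX.isHalfspace_iff.1 k.2)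

/-- The consistent points in a halfspace; this depends only on the class of the halfspace. -/
def HalfspaceQuotient.trace : X.HalfspaceQuotient → Set (consistentPoints H) :=
  Quot.lift (fun h => Subtype.val ⁻¹' h.1) fun h k hhk => subset_antisymm
    ((Halfspace.preimage_subset_iff hX hE hN h k).2 hhk.1)
    ((Halfspace.preimage_subset_iff hX hE hN k h).2 hhk.2)

namespace HalfspaceQuotient

local notation "tr" => HalfspaceQuotient.trace hX hE hN

theorem le_iff (A B : X.HalfspaceQuotient) : HalfspaceQuotient.le A B ↔ tr A ⊆ tr B := by
  constructor
  · rintro ⟨h, k, rfl, rfl, hle⟩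
    exact (Halfspace.preimage_subset_iff hX hE hN h k).2 hle
  · induction A using Quot.ind with
    | _ h =>
    induction B using Quot.ind with
    | _ k =>
    exact fun hsub => ⟨h, k, rfl, rfl, (Halfspace.preimage_subset_iff hX hE hN h k).1 hsub⟩

theorem trace_injective : Function.Injective tr := by
  intro A B
  induction A using Quot.ind with
  | _ h =>
  induction B using Quot.ind with
  | _ k =>
  exact fun he => Quot.sound ⟨(Halfspace.preimage_subset_iff hX hE hN h k).1 he.le,
    (Halfspace.preimage_subset_iff hX hE hN k h).1 he.ge⟩

theorem trace_star (A : X.HalfspaceQuotient) : tr (star A) = (tr A)ᶜ := by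
  induction A using Quot.ind with
  | _ h => rfl

theorem trace_mem (A : X.HalfspaceQuotient) : tr A ∈ consistentWalls H := by
  induction A using Quot.ind with
  | _ h => exact ⟨h.1, hX.isHalfspace_iff.1 h.2, rfl⟩

theorem exists_trace_eq {k : Set (consistentPoints H)} (hk : k ∈ consistentWalls H) :
    ∃ A, tr A = k := by
  obtain ⟨h, hh, rfl⟩ := hk
  exact ⟨Quot.mk _ ⟨h, hX.isHalfspace_iff.2 hh⟩, rfl⟩

theorem trace_nonempty (A : X.HalfspaceQuotient) : (tr A).Nonempty :=
  (hX.wallspace.consistent hE hN).nonempty _ (trace_mem hX hE hN A)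

theorem isPocset : IsPocset (le (X := X)) star where
  refl A := (le_iff hX hE hN _ _).2 subset_rfl
  trans A B C h1 h2 := (le_iff hX hE hN _ _).2
    (((le_iff hX hE hN _ _).1 h1).trans ((le_iff hX hE hN _ _).1 h2))
  antisymm A B h1 h2 := trace_injective hX hE hN
    (((le_iff hX hE hN _ _).1 h1).antisymm ((le_iff hX hE hN _ _).1 h2))
  star_star A := trace_injective hX hE hN (by rw [trace_star, trace_star, compl_compl])
  incomparable A := by
    rw [le_iff hX hE hN, le_iff hX hE hN, trace_star]
    obtain ⟨x, hx⟩ := trace_nonempty hX hE hN A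
    obtain ⟨y, hy⟩ := trace_nonempty hX hE hN (star A)
    rw [trace_star] at hy
    exact ⟨fun h => h hx hx, fun h => hy (h hy)⟩
  star_anti A B h := by
    rw [le_iff hX hE hN, trace_star, trace_star]
    exact Set.compl_subset_compl.2 ((le_iff hX hE hN _ _).1 h)

theorem finiteWidth : Pocset.FiniteWidth (le (X := X)) star := by
  classical
  have hN' : WallDimLE (consistentWalls H) N := hN.preimage fun k hk => hk
  refine ⟨N, fun T hT => ?_⟩
  rw [← Finset.card_image_of_injective T (trace_injective hX hE hN)]
  refine hN' _ (fun t ht => ?_) fun s hs t ht hst => ?_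
  · obtain ⟨A, -, rfl⟩ := Finset.mem_image.1 ht
    exact trace_mem hX hE hN A
  · obtain ⟨A, hA, rfl⟩ := Finset.mem_image.1 hs
    obtain ⟨B, hB, rfl⟩ := Finset.mem_image.1 ht
    obtain ⟨h1, h2, h3, h4⟩ := hT A hA B hB fun h => hst (h ▸ rfl)
    rw [le_iff hX hE hN, Set.not_subset] at h1 h2 h3 h4
    rw [trace_star] at h3 h4
    obtain ⟨a, ha1, ha2⟩ := h1
    obtain ⟨b, hb1, hb2⟩ := h2
    obtain ⟨c, hc1, hc2⟩ := h3
    obtain ⟨d, hd1, hd2⟩ := h4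
    exact ⟨⟨d, not_not.1 hd2, hd1⟩, ⟨a, ha1, ha2⟩, ⟨b, hb2, hb1⟩, ⟨c, hc1, hc2⟩⟩

/-- The classes of the halfspaces containing a point form a DCC ultrafilter: the elements of a
descending chain separate the point from any point outside its first element. -/
theorem isDCCUltrafilter (w : consistentPoints H) :
    Pocset.IsDCCUltrafilter (le (X := X)) star {A | w ∈ tr A} where
  complete A := by
    change Xor (w ∈ tr A) (w ∈ tr (star A))
    rw [trace_star]
    by_cases h : w ∈ tr A
    · exact Or.inl ⟨h, fun h' => h' h⟩
    · exact Or.inr ⟨h, h⟩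
  consistent A B hA hle := (le_iff hX hE hN _ _).1 hle hA
  dcc := by
    rintro ⟨A, hA⟩
    obtain ⟨w', hw'⟩ := trace_nonempty hX hE hN (star (A 0))
    rw [trace_star] at hw'
    have hanti : StrictAnti fun n => tr (A n) := strictAnti_nat_of_succ_lt fun n =>
      ((le_iff hX hE hN _ _).1 (hA n).2.1).ssubset_of_ne
        fun h => (hA n).2.2 (trace_injective hX hE hN h)
    refine Set.infinite_of_injective_forall_mem hanti.injective (fun n => ?_)
      ((hX.wallspace.consistent hE hN).finite_sep w w')
    exact ⟨trace_mem hX hE hN _, (hA n).1, fun h => hw' (hanti.antitone (Nat.zero_le n) h)⟩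

/-- The consistent points are the vertices of the cubing: a point corresponds to the set of the
classes of halfspaces that contain it. -/
noncomputable def pointEquiv [Nonempty V] :
    consistentPoints H ≃ Pocset.CubingVertex (le (X := X)) star :=
  Equiv.ofBijective (fun w => ⟨{A | w ∈ tr A}, isDCCUltrafilter hX hE hN w⟩) (by
    constructor
    · intro w w' he
      refine (hX.wallspace.consistent hE hN).eq_of_forall fun k hk hw => ?_
      obtain ⟨A, rfl⟩ := exists_trace_eq hX hE hN hk
      exact ((Set.ext_iff.1 (congrArg Subtype.val he) A).1 hw)
    · rintro ⟨ω, hω⟩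
      have hstar : ∀ A, A ∈ ω ↔ star A ∉ ω := fun A => by
        rcases hω.complete A with h | h
        · exact ⟨fun _ => h.2, fun _ => h.1⟩
        · exact ⟨fun h' => absurd h' h.2, fun h' => absurd h.1 h'⟩
      obtain ⟨y, hy, hyω⟩ := hX.wallspace.exists_consistent_of_dcc hN
        {h | ∃ hh : X.IsHalfspace h, (Quot.mk _ ⟨h, hh⟩ : X.HalfspaceQuotient) ∈ ω}
        (by
          intro h hh
          have hh' := hX.isHalfspace_iff.2 hh
          have hc' := hX.isHalfspace_iff.2 (hX.wallspace.compl_mem h hh)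
          have := hstar (Quot.mk _ ⟨h, hh'⟩)
          constructor
          · rintro ⟨_, h1⟩ ⟨_, h2⟩
            exact this.1 h1 h2
          · intro h1
            exact ⟨hh', this.2 fun h2 => h1 ⟨hc', h2⟩⟩)
        (by
          rintro h hh k hk ⟨hh', h1⟩ hle
          refine ⟨hX.isHalfspace_iff.2 hk, hω.consistent _ _ h1 ⟨_, _, rfl, rfl, ?_⟩⟩
          exact (Halfspace.le_iff hX hE _ _).2 hle)
        (by
          rintro ⟨A, hA⟩
          choose h1 h2 h3 h4 using hA
          choose h5 h6 using h2
          refine hω.dcc ⟨fun n => Quot.mk _ ⟨A n, h5 n⟩, fun n => ⟨h6 n, ⟨_, _, rfl, rfl,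
            (Halfspace.le_iff hX hE _ _).2 (h3 n)⟩, fun he => h4 n ?_⟩⟩
          have := congrArg (tr) he
          exact (hX.wallspace.preimage_subset_iff hE hN (h1 n) (h1 (n + 1))).1 this.ge)
      refine ⟨⟨y, hy⟩, Subtype.ext (Set.ext fun A => ?_)⟩
      induction A using Quot.ind with
      | _ h =>
      exact (hyω h.1 (hX.isHalfspace_iff.1 h.2)).trans ⟨fun h' => h'.2, fun h' => ⟨h.2, h'⟩⟩)

theorem mem_pointEquiv [Nonempty V] (w : consistentPoints H) (h : X.Halfspace) :
    (Quot.mk _ h : X.HalfspaceQuotient) ∈ (pointEquiv hX hE hN w).1 ↔ w.1 ∈ h.1 := Iff.rfl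

theorem adj_pointEquiv [Nonempty V] (w w' : consistentPoints H) :
    (Pocset.cubingGraph (le (X := X)) star).Adj (pointEquiv hX hE hN w) (pointEquiv hX hE hN w') ↔
      ∃ k, sepWalls (consistentWalls H) w w' = {k} := by
  have hmem : ∀ A : X.HalfspaceQuotient,
      A ∈ symmDiff (pointEquiv hX hE hN w).1 (pointEquiv hX hE hN w').1 ↔
        (w ∈ tr A ∧ w' ∉ tr A) ∨ (w' ∈ tr A ∧ w ∉ tr A) := fun A => Set.mem_symmDiff
  have key : ∀ A : X.HalfspaceQuotient, w ∈ tr A → w' ∉ tr A →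
      (symmDiff (pointEquiv hX hE hN w).1 (pointEquiv hX hE hN w').1 = {A, star A} ↔
        sepWalls (consistentWalls H) w w' = {tr A}) := by
    intro A hw hw'
    constructor
    · intro hA
      ext k
      constructor
      · rintro ⟨hk, h1, h2⟩
        obtain ⟨B, rfl⟩ := exists_trace_eq hX hE hN hk
        have hB := (hmem B).2 (Or.inl ⟨h1, h2⟩)
        rw [hA] at hB
        rcases hB with rfl | rfl
        · rfl
        · rw [trace_star] at h1; exact absurd hw h1
      · rintro rfl
        exact ⟨trace_mem hX hE hN A, hw, hw'⟩
    · intro hs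
      have huniq : ∀ B, w ∈ tr B → w' ∉ tr B → B = A := fun B h1 h2 => by
        have : tr B ∈ sepWalls (consistentWalls H) w w' := ⟨trace_mem hX hE hN B, h1, h2⟩
        rw [hs] at this
        exact trace_injective hX hE hN this
      ext B
      rw [hmem]
      constructor
      · rintro (⟨h1, h2⟩ | ⟨h1, h2⟩)
        · exact Or.inl (huniq B h1 h2)
        · right
          have := huniq (star B) (by rw [trace_star]; exact h2) (by
            rw [trace_star]; exact fun h => h h1)
          change B = star A
          rw [← this]
          exact ((isPocset hX hE hN).star_star B).symm
      · rintro (rfl | rfl)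
        · exact Or.inl ⟨hw, hw'⟩
        · rw [trace_star]
          exact Or.inr ⟨hw', fun h => h hw⟩
  constructor
  · rintro ⟨A, hA⟩
    have hA' := (hmem A).1 (by rw [hA]; exact Set.mem_insert _ _)
    rcases hA' with ⟨h1, h2⟩ | ⟨h1, h2⟩
    · exact ⟨_, (key A h1 h2).1 hA⟩
    · refine ⟨_, (key (star A) (by rw [trace_star]; exact h2) (by
        rw [trace_star]; exact fun h => h h1)).1 ?_⟩
      rw [hA, (isPocset hX hE hN).star_star, Set.pair_comm]
  · rintro ⟨k, hk⟩
    have hk' : k ∈ sepWalls (consistentWalls H) w w' := by rw [hk]; rfl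
    obtain ⟨A, rfl⟩ := exists_trace_eq hX hE hN hk'.1
    exact ⟨A, (key A hk'.2.1 hk'.2.2).2 hk⟩

/-- The complex of consistent points is the cubing of the quotient pocset. -/
theorem mem_cubes_iff_isCubingCube [Nonempty V] {Y : CubeComplex (consistentPoints H)}
    (hY : Y.IsDual (consistentWalls H)) (C : Set (consistentPoints H)) :
    C ∈ Y.cubes ↔ Pocset.IsCubingCube (le (X := X)) star (pointEquiv hX hE hN '' C) := by
  have iso : Y.graph.induce C ≃g
      (Pocset.cubingGraph (le (X := X)) star).induce (pointEquiv hX hE hN '' C) :=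
    ⟨(pointEquiv hX hE hN).image C, fun {a b} =>
      (adj_pointEquiv hX hE hN a.1 b.1).trans hY.adj_iff.symm⟩
  rw [hY.mem_cubes_iff]
  exact exists_congr fun n => ⟨fun ⟨f⟩ => ⟨f.trans iso⟩, fun ⟨f⟩ => ⟨f.trans iso.symm⟩⟩

end HalfspaceQuotient

end CubeComplex

/-! ### Equivariant embeddings of vertex sets and cocompactness -/

namespace CubeComplex

theorem IsDual.halfspaceShallow_iff {V : Type u} {X : CubeComplex V} {H : Set (Set V)}
    (hX : X.IsDual H) {h : Set V} : X.HalfspaceShallow h ↔ WallShallow H h := by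
  simp only [HalfspaceShallow, WallShallow, Set.subset_def, hX.mem_nbhd_iff, Set.mem_compl_iff]

theorem IsDual.isEssential_iff {V : Type u} {X : CubeComplex V} {H : Set (Set V)}
    (hX : X.IsDual H) : X.IsEssential ↔ WallEssential H := by
  simp only [IsEssential, WallEssential, hX.isHalfspace_iff, hX.halfspaceShallow_iff]

section Embedding

variable {V W : Type u} {X : CubeComplex V} {Y : CubeComplex W} {φ : W → V}
  (hφ : Function.Injective φ)
include hφ

theorem finite_cubes_image_subset {U : Set V} (hU : U.Finite) :
    {C ∈ Y.cubes | φ '' C ⊆ U}.Finite :=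
  (hU.preimage hφ.injOn).finite_subsets.subset fun _ hC => Set.image_subset_iff.1 hC.2

theorem IsLocallyFinite.of_embedding (hC : ∀ C ∈ Y.cubes, ∃ D ∈ X.cubes, φ '' C ⊆ D)
    (hX : X.IsLocallyFinite) : Y.IsLocallyFinite := by
  intro w
  have hU : (⋃ D ∈ {D ∈ X.cubes | φ w ∈ D}, D).Finite :=
    (hX (φ w)).biUnion fun D hD => finite_cube hD.1
  refine (finite_cubes_image_subset (Y := Y) hφ hU).subset fun C hCw => ?_
  obtain ⟨D, hD, hCD⟩ := hC C hCw.1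
  exact ⟨hCw.1, hCD.trans (Set.subset_biUnion_of_mem (u := fun D => D)
    (show D ∈ {D ∈ X.cubes | φ w ∈ D} from ⟨hD, hCD ⟨w, hCw.2, rfl⟩⟩))⟩

variable {G : Type v} [Group G] [MulAction G V] [MulAction G W]
  (heq : ∀ (g : G) (w : W), φ (g • w) = g • φ w)
include heq

theorem Cocompact.of_embedding (hC : ∀ C ∈ Y.cubes, ∃ D ∈ X.cubes, φ '' C ⊆ D)
    (hY : Y.ActsOn G) (hX : X.Cocompact G) : Y.Cocompact G := by
  obtain ⟨F, hF, hfin, hcov⟩ := hX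
  have hU : (⋃ D ∈ F, D).Finite := hfin.biUnion fun D hD => finite_cube (hF hD)
  refine ⟨_, fun C h => h.1, finite_cubes_image_subset hφ hU, fun C hCY => ?_⟩
  obtain ⟨D, hD, hCD⟩ := hC C hCY
  obtain ⟨D₀, hD₀, g, rfl⟩ := hcov D hD
  refine ⟨g⁻¹ • C, ⟨hY g⁻¹ C hCY, ?_⟩, g, smul_inv_smul g C⟩
  refine Set.Subset.trans ?_ (Set.subset_biUnion_of_mem (u := fun D => D) hD₀)
  rintro _ ⟨_, ⟨w, hw, rfl⟩, rfl⟩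
  change φ (g⁻¹ • w) ∈ D₀
  rw [heq]
  exact Set.mem_smul_set_iff_inv_smul_mem.1 (hCD ⟨w, hw, rfl⟩)

theorem card_orbits_lt [Finite (MulAction.orbitRel.Quotient G V)] {v : V} (hv : v ∉ Set.range φ) :
    ENat.card (MulAction.orbitRel.Quotient G W) < ENat.card (MulAction.orbitRel.Quotient G V) := by
  let ψ : MulAction.orbitRel.Quotient G W → MulAction.orbitRel.Quotient G V :=
    Quotient.map' φ (by
      rintro _ b ⟨g, rfl⟩
      exact ⟨g, (heq g b).symm⟩)
  have hinj : Function.Injective ψ := by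
    intro a b hab
    induction a using Quotient.ind with
    | _ a =>
    induction b using Quotient.ind with
    | _ b =>
    obtain ⟨g, hg⟩ := Quotient.exact hab
    exact Quotient.sound ⟨g, hφ ((heq g b).trans hg)⟩
  have hns : ¬ Function.Surjective ψ := by
    intro hs
    obtain ⟨a, ha⟩ := hs (Quotient.mk _ v)
    induction a using Quotient.ind with
    | _ a =>
    obtain ⟨g, hg⟩ := Quotient.exact ha.symm
    exact hv ⟨g • a, (heq g a).trans hg⟩
  have := Finite.of_injective ψ hinj
  have := Fintype.ofFinite (MulAction.orbitRel.Quotient G V)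
  have := Fintype.ofFinite (MulAction.orbitRel.Quotient G W)
  rw [ENat.card_eq_coe_fintype_card, ENat.card_eq_coe_fintype_card, Nat.cast_lt]
  exact Fintype.card_lt_of_injective_not_surjective ψ hinj hns

end Embedding

end CubeComplex

theorem theorem4p1 {V : Type u} (X : CubeComplex V) (hX : X.IsCAT0)
    (G : Type v) [Group G] [MulAction G V]
    (hG : X.ActsOn G) (hcocompact : X.Cocompact G) (hinv : X.NoShallowInversions G)
    (hshallow : X.HasShallowQuarterspace) :
    ∃ (W : Type u) (_ : MulAction G W) (Y : CubeComplex W),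
      Y.IsCAT0 ∧ Y.ActsOn G ∧ Y.Cocompact G ∧
      ENat.card (MulAction.orbitRel.Quotient G W) < ENat.card (MulAction.orbitRel.Quotient G V) ∧
      (∃ φ : W → V, (∀ (g : G) (y : W), φ (g • y) = g • φ y) ∧ X.IsQuasiIsometry Y φ ∧
        ∀ h, Y.IsHalfspace h → ∃ k, X.IsHalfspace k ∧ X.FiniteHausdorff (φ '' h) k) ∧
      (X.IsLocallyFinite → Y.IsLocallyFinite) ∧
      ∃ S : Set V, X.IsEssentialCore G S ∧ Y.IsCubingOfQuotient X S G := by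
  obtain ⟨h₀, k₀, hh₀, hk₀, ht₀, r₀, hr₀⟩ := hshallow
  have : Nonempty V := hX.connected.nonempty
  have hD := hX.isDual
  set H := X.halfspaces
  have hH := hD.wallspace
  have hGH : ∀ g : G, ∀ h ∈ H, g • h ∈ H := fun g h hh => hD.smul_mem hG g hh
  obtain ⟨N, hN⟩ := hD.exists_wallDimLE hcocompact
  have := hcocompact.finite_orbits
  -- The essential core `S`, with halfspaces `HS`.
  obtain ⟨S, hSne, hSG, hS, ⟨R, hR⟩, hE⟩ := hH.exists_core hGH hN fun h hh hsh =>
    hinv h (hD.isHalfspace_iff.2 hh) (hD.halfspaceShallow_iff.2 hsh)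
  have hDS := hD.induce hS
  have hdS := fun x y => hH.wallDist_trace hS x y
  let := subsetAction S hSG
  have hGS : ∀ g : G, ∀ k ∈ traceWalls H S, g • k ∈ traceWalls H S :=
    fun g k hk => smul_mem_traceWalls hGH hSG g hk
  have hNS : WallDimLE (traceWalls H S) N := hN.trace S
  set HS := traceWalls H S
  have hHS := hDS.wallspace
  have hSne' : Nonempty S := hSne.to_subtype
  let := subsetAction (consistentPoints HS)
    fun (g : G) _ hx => smul_mem_consistentPoints hGS g hx
  have hHW := hHS.consistent hE hNS
  let Y := CubeComplex.ofWalls hHW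
  have hDY : Y.IsDual (consistentWalls HS) := CubeComplex.isDual_ofWalls hHW
  let φ : consistentPoints HS → V := fun w => w.1.1
  have hφ : Function.Injective φ := Subtype.val_injective.comp Subtype.val_injective
  have heq : ∀ (g : G) w, φ (g • w) = g • φ w := fun g w => rfl
  have hcube : ∀ C ∈ Y.cubes, ∃ D ∈ X.cubes, φ '' C ⊆ D := by
    intro C hC
    obtain ⟨D, hD', hCD⟩ := hHS.exists_isWallCube hE hNS ((hDY.cubes_iff C).1 hC)
    refine ⟨_, (hDS.cubes_iff D).2 hD', ?_⟩
    rintro _ ⟨w, hw, rfl⟩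
    exact ⟨w.1, hCD ⟨w, hw, rfl⟩, rfl⟩
  have hact : Y.ActsOn G := fun g C hC =>
    (hDY.cubes_iff _).2 (((hDY.cubes_iff _).1 hC).smul
      (fun g k hk => smul_mem_consistentWalls hGS g hk) g)
  -- Every point of a halfspace of `S` is close to a vertex of `Y` in that halfspace.
  have hnear : ∀ (x : S) (A : Set (Set S)), (∀ a ∈ A, a ∈ HS ∧ x ∈ a) →
      (∀ a ∈ A, ∀ b ∈ A, a = b) → ∃ w : consistentPoints HS,
        (∀ a ∈ A, w.1 ∈ a) ∧ wallDist H x.1 (φ w) ≤ N := by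
    intro x A hA hAA
    obtain ⟨w, hw, hwA, hd⟩ := hHS.exists_consistent hE hNS x A hA (by
      intro a ha b hb
      obtain rfl := hAA a ha b hb
      exact IsWallspace.not_wallLE_compl hE (hA a ha).1)
    rw [hdS] at hd
    exact ⟨⟨w, hw⟩, hwA, hd⟩
  have : Nonempty (consistentPoints HS) := by
    obtain ⟨x⟩ := hSne'
    obtain ⟨w, -, -⟩ := hnear x ∅ (by simp) (by simp)
    exact ⟨w⟩
  refine ⟨consistentPoints HS, inferInstance, Y, hDY.isCAT0, hact,
    .of_embedding hφ heq hcube hact hcocompact, ?_, ⟨φ, heq, ?_, ?_⟩,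
    .of_embedding hφ hcube, S, ?_, ?_⟩
  · -- Some vertex of `X` is not a vertex of `Y`.
    have hv : ∃ v, v ∉ Set.range φ := by
      by_cases hu : ∃ v, v ∉ S
      · obtain ⟨v, hv⟩ := hu
        refine ⟨v, ?_⟩
        rintro ⟨w, rfl⟩
        exact hv w.1.2
      · push Not at hu
        have hmem : ∀ {h : Set V}, h ∈ H → (Subtype.val ⁻¹' h : Set S) ∈ HS := by
          intro h hh
          obtain ⟨x, hx⟩ := hH.nonempty h hh
          obtain ⟨y, hy⟩ := hH.nonempty _ (hH.compl_mem h hh)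
          exact mem_traceWalls_of_mem hh (x := ⟨x, hu x⟩) (y := ⟨y, hu y⟩) hx hy
        have hne := hHS.consistentPoints_ne_univ hE
          ⟨_, hmem (hD.isHalfspace_iff.1 hh₀), _, hmem (hD.isHalfspace_iff.1 hk₀),
            (by
              obtain ⟨⟨a, ha⟩, ⟨b, hb⟩, ⟨c, hc⟩, ⟨d, hd⟩⟩ := ht₀
              exact ⟨⟨⟨a, hu a⟩, ha⟩, ⟨⟨b, hu b⟩, hb⟩, ⟨⟨c, hu c⟩, hc⟩, ⟨⟨d, hu d⟩, hd⟩⟩),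
            r₀, by
              intro x hx
              obtain ⟨y, hy, hxy⟩ := hD.mem_nbhd_iff.1 (hr₀ (show x.1 ∈ h₀ ∩ k₀ from hx))
              refine ⟨⟨y, hu y⟩, hy.1, hy.2, ?_⟩
              rw [hdS]
              exact hxy⟩
        obtain ⟨s, hs⟩ := (Set.ne_univ_iff_exists_notMem _).1 hne
        refine ⟨s.1, ?_⟩
        rintro ⟨w, hw⟩
        exact hs (Subtype.val_injective hw ▸ w.2)
    obtain ⟨v, hv⟩ := hv
    exact CubeComplex.card_orbits_lt hφ heq hv
  · refine ⟨N + 1, R + N, by simp, by positivity, fun y z => ?_, fun x => ?_⟩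
    · rw [hDY.dist_eq, hD.dist_eq]
      have h1 : wallDist (consistentWalls HS) y z ≤ wallDist H (φ y) (φ z) := by
        rw [← hdS y.1 z.1]; exact hHS.wallDist_consistent_le y z
      have h2 : wallDist H (φ y) (φ z) ≤ N * wallDist (consistentWalls HS) y z := by
        rw [← hdS y.1 z.1]; exact hHS.wallDist_le_mul hE hNS y z
      have h1' : (wallDist (consistentWalls HS) y z : ℝ) ≤ wallDist H (φ y) (φ z) := by
        exact_mod_cast h1
      have h2' : (wallDist H (φ y) (φ z) : ℝ) ≤ N * wallDist (consistentWalls HS) y z := by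
        exact_mod_cast h2
      have h3 : (wallDist (consistentWalls HS) y z : ℝ) / (N + 1) ≤
          wallDist (consistentWalls HS) y z := div_le_self (by positivity) (by simp)
      have h4 : (0 : ℝ) ≤ R + N := by positivity
      have h5 : (0 : ℝ) ≤ wallDist (consistentWalls HS) y z := by positivity
      exact ⟨by linarith, by linarith⟩
    · obtain ⟨s, hs, hxs⟩ := hR x
      obtain ⟨w, -, hw⟩ := hnear ⟨s, hs⟩ ∅ (by simp) (by simp)
      refine ⟨w, ?_⟩
      rw [hD.dist_eq]
      exact_mod_cast (hH.wallDist_triangle x s (φ w)).trans (add_le_add hxs hw)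
  · intro h' hh'
    obtain ⟨k, hk, rfl⟩ := hDY.isHalfspace_iff.1 hh'
    obtain ⟨h, hh, hkh, hkne, -⟩ := id hk
    refine ⟨h, hD.isHalfspace_iff.2 hh, R + N, ?_, fun x hx => hD.mem_nbhd_iff.2 ?_⟩
    · rintro _ ⟨w, hw, rfl⟩
      refine hD.mem_nbhd_iff.2 ⟨φ w, ?_, ?_⟩
      · have : w.1 ∈ k := hw
        rw [hkh] at this
        exact this
      · simp [wallDist, sepWalls]
    · obtain ⟨p, hp, hph, hxp⟩ := hH.exists_near_mem_inter hS hR hh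
        (by obtain ⟨z, hz⟩ := hkne; rw [hkh] at hz; exact ⟨z, z.2, hz⟩) hx
      obtain ⟨w, hw, hpw⟩ := hnear ⟨p, hp⟩ {k}
        (by rintro _ rfl; exact ⟨hk, by rw [hkh]; exact hph⟩) (by rintro _ rfl _ rfl; rfl)
      exact ⟨φ w, ⟨w, hw k rfl, rfl⟩,
        (hH.wallDist_triangle x p (φ w)).trans (add_le_add hxp hpw)⟩
  · have hsub : ∀ g : G, g • S ⊆ S := by
      rintro g _ ⟨x, hx, rfl⟩
      exact hSG g x hx
    exact ⟨hSne, fun g => (hsub g).antisymm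
        fun x hx => Set.mem_smul_set_iff_inv_smul_mem.2 (hSG g⁻¹ x hx),
      hD.isConvex_iff.2 hS, hDS.isEssential_iff.2 hE⟩
  · refine ⟨fun h k l hhk hkl => ?_, CubeComplex.HalfspaceQuotient.isPocset hDS hE hNS,
      CubeComplex.HalfspaceQuotient.finiteWidth hDS hE hNS,
      CubeComplex.HalfspaceQuotient.pointEquiv hDS hE hNS,
      CubeComplex.HalfspaceQuotient.mem_cubes_iff_isCubingCube hDS hE hNS hDY,
      fun g y h k hgk => ?_⟩
    · rw [← CubeComplex.Halfspace.preimage_subset_iff hDS hE hNS] at *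
      exact hhk.trans hkl
    · rw [CubeComplex.HalfspaceQuotient.mem_pointEquiv,
        CubeComplex.HalfspaceQuotient.mem_pointEquiv, ← Subtype.val_injective.mem_set_image,
        ← Subtype.val_injective.mem_set_image (s := h.1), hgk]
      exact Set.smul_mem_smul_set_iff (a := g) (x := y.1.1)
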